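/- **Setting.** Let $n=\ell+2m$, $k\ge 0$, and let $\mathbf R^{2n}\times\mathbf R^{2k}$ carry symplectic coordinates $\rho=(x',\xi',x'',\xi'')$ with $(x',\xi')\in\mathbf R^{2n}$ and $\sigma=(x'',\xi'')\in\mathbf R^{2k}$; write $H_p=\partial_\xi p\cdot\partial_x-\partial_x p\cdot\partial_\xi$. Let $V\subset\mathbf R^{2k}$ be open and $\Sigma=\{(0,\sigma):\sigma\in V\}$. Let $p$ be a real $C^\infty$ function on $\mathbf R^{2n}\times\mathbf R^{2k}$ such that at each point of $\Sigma$ one has $dp=0$ and the quadratic part of $p$ is $\langle A_0(\sigma)x',\xi'\rangle$, where $$A_0(\sigma)=\operatorname{diag}\Bigl(a_1,\dots,a_\ell,\begin{pmatrix}c_1&-d_1\\ d_1&c_1\end{pmatrix},\dots,\begin{pmatrix}c_m&-d_m\\ d_m&c_m\end{pmatrix}\Bigr),\qquad a_j=a_j(\sigma)>0,\quad c_j=c_j(\sigma)>0,\quad d_j=d_j(\sigma)\in\mathbf R .$$ For $k=0$ this says that $\rho_0=0$ is a hyperbolic fixed point of $p$ on $\mathbf R^{2n}$, in symplectic coordinates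 adapted to the expanding and contracting subspaces, $\Lambda_+=\{\xi=0\}$, $\Lambda_-=\{x=0\}$, and $\Sigma=\{\rho_0\}$. For $k=1$ it is the situation near a two-dimensional center manifold $\Sigma$. Put $\|y\|_0^2=\langle B_0y,y\rangle$ with $B_0=\int_0^\infty e^{-s\,{}^tA_0}e^{-sA_0}\,ds=\operatorname{diag}\bigl(\tfrac1{2\operatorname{Re}\lambda_j}\bigr)$, the $\lambda_j$ being the eigenvalues of $A_0(\sigma)$ (so $\|\cdot\|_0$ depends on $\sigma$ when $k>0$). For a function $r\ge0$ on $\mathbf R^{2k}$ let $$\Omega_r=\{\rho:\ \sigma\in V,\ \|x'\|_0^2+\|\xi'\|_0^2<r(\sigma)\}$$ (for $k=0$, $r=\delta^2$ is a constant and $\Omega_r$ is the ball $\|x\|_0^2+\|\xi\|_0^2<\delta^2$ around $\rho_0$). A function is *flat* at a point if it and all its derivatives vanish there. A *modification* of $p$ is a real $C^\infty$ function $q$ on the whole space with $q=p$ on $\Omega_r$, such that the flow $\exp(tH_q)$ is defined for all times and each of its trajectories crosses $\Omega_r$ at most once, that is, is in $\Omega_r$ for a (possibly empty) interval of times. **Proposition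 1.2.** For every $\sigma_0\in V$ there is $\varepsilon>0$ such that the following holds for every $C^\infty$ function $r\ge0$ on $\mathbf R^{2k}$ supported in the ball of radius $\varepsilon$ about $\sigma_0$ and with $r$, $|dr|$, $|d^2r|\le\varepsilon$ (for $k=0$: for every $\delta$ with $\delta^2\le\varepsilon$). 1. A modification $q$ of $p$ exists. 2. Let $q$ be any modification of $p$. Let $\chi^{\rm out}+\chi^{\rm in}=1$ on $\{(x',\xi')\ne0\}$, where $\chi^{\rm out},\chi^{\rm in}$ are $C^\infty$ functions of $(x',\xi')\neq 0$, homogeneous of degree $0$, with $\operatorname{supp}\chi^{\rm out}\subset\{\|\xi'\|_0<2\|x'\|_0\}$ and $\operatorname{supp}\chi^{\rm in}\subset\{\|x'\|_0<2\|\xi'\|_0\}$ (for the norms at all $\sigma$ with $r(\sigma)>0$). Let $g$ be a $C^\infty$ function, flat at every point of $\Sigma$, with $\operatorname{supp}g\subset\Omega_r$. Then for every $\rho\in\Omega_r$ the integrals in $$f(\rho)=\int_{-\infty}^0(\chi^{\rm out}g)\circ\exp(tH_q)(\rho)\,dt-\int_0^{\infty}(\chi^{\rm in}g)\circ\exp(tH_q)(\rho)\,dt$$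 converge absolutely, $f$ is $C^\infty$ in $\Omega_r$, $f$ is flat at every point of $\Sigma\cap\Omega_r$ (for $k=0$ and $\delta>0$: at $\rho_0$), and $H_pf=g$ in $\Omega_r$. -/

import Mathlib

open scoped ContDiff Matrix

noncomputable section

/-- Symplectic space `T^*ℝ^J`: pairs (position, momentum). -/
abbrev SymplSpace (J : Type) : Type := (J → ℝ) × (J → ℝ)

/-- Labels of the hyperbolic degrees of freedom: `ℓ` real eigenvalues and `m` complex pairs
(the two members of the `j`-th pair are `Sum.inr (0, j)` and `Sum.inr (1, j)`). -/
abbrev HypIndex (ℓ m : ℕ) : Type := Fin ℓ ⊕ (Fin 2 × Fin m)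

/-- The phase space, with points `ρ = ((x', ξ'), (x'', ξ''))`: hyperbolic variables `(x', ξ')` and
`2k` center variables `(x'', ξ'')`. For `k = 0` the second factor is a single point and this is
`T^*ℝⁿ`, `n = ℓ + 2 m`. The center manifold `Σ` is `{(x', ξ') = 0}`; for `k = 0` it is the
origin. -/
abbrev PhaseSpace (ℓ m k : ℕ) : Type := SymplSpace (HypIndex ℓ m) × SymplSpace (Fin k)

variable {ℓ m k : ℕ}

/-- The Hamilton field `H_p = ∂_ξ p · ∂_x - ∂_x p · ∂_ξ`. -/
def hamiltonField (p : PhaseSpace ℓ m k → ℝ) (ρ : PhaseSpace ℓ m k) : PhaseSpace ℓ m k :=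
  ((fun j => fderiv ℝ p ρ ((0, Pi.single j 1), 0),
    fun j => -fderiv ℝ p ρ ((Pi.single j 1, 0), 0)),
   (fun j => fderiv ℝ p ρ (0, (0, Pi.single j 1)),
    fun j => -fderiv ℝ p ρ (0, (Pi.single j 1, 0))))

/-- `φ t ρ = exp(t H_p)(ρ)`, defined for all times. -/
structure IsHamiltonFlow (p : PhaseSpace ℓ m k → ℝ)
    (φ : ℝ → PhaseSpace ℓ m k → PhaseSpace ℓ m k) : Prop where
  zero : ∀ ρ, φ 0 ρ = ρ
  hasDerivAt : ∀ ρ t, HasDerivAt (fun s => φ s ρ) (hamiltonField p (φ t ρ)) t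

/-- The real normal form `A₀ = diag(λ₁, …, λₙ)`: the numbers `a j` on the diagonal, followed by
the `2 × 2` blocks with rows `(c j, -d j)` and `(d j, c j)`, whose eigenvalues are
`c j ± i d j`. -/
def normalMatrix (a : Fin ℓ → ℝ) (c d : Fin m → ℝ) :
    Matrix (HypIndex ℓ m) (HypIndex ℓ m) ℝ :=
  Matrix.fromBlocks (Matrix.diagonal a) 0 0
    (Matrix.blockDiagonal fun j => !![c j, -d j; d j, c j])

/-- The matrix `B₀ = ∫₀^∞ exp(-s A₀ᵀ) exp(-s A₀) ds = diag(1 / (2 Re λ_j))`. -/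
def lyapunovMatrix (a : Fin ℓ → ℝ) (c : Fin m → ℝ) :
    Matrix (HypIndex ℓ m) (HypIndex ℓ m) ℝ :=
  Matrix.diagonal (Sum.elim (fun j => (2 * a j)⁻¹) (fun ij => (2 * c ij.2)⁻¹))

/-- `B₀` is the solution of the Lyapunov equation `A₀ᵀ B₀ + B₀ A₀ = 1`. -/
theorem lyapunovMatrix_spec (a : Fin ℓ → ℝ) (c d : Fin m → ℝ) (ha : ∀ j, 0 < a j)
    (hc : ∀ j, 0 < c j) :
    (normalMatrix a c d)ᵀ * lyapunovMatrix a c + lyapunovMatrix a c * normalMatrix a c d = 1 := by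
  ext i j
  simp only [lyapunovMatrix, Matrix.add_apply, Matrix.mul_diagonal, Matrix.diagonal_mul,
    Matrix.transpose_apply, normalMatrix]
  rcases i with i | ⟨i, i'⟩ <;> rcases j with j | ⟨j, j'⟩
  · by_cases h : i = j
    · subst h
      have := (ha i).ne'
      simp
      field_simp
      norm_num
    · have h' : ¬ j = i := fun e => h e.symm
      simp [h, h']
  · simp
  · simp
  · by_cases h : i' = j'
    · subst h
      have := (hc i').ne'
      fin_cases i <;> fin_cases j <;> simp <;> field_simp <;> norm_num
    · have h' : ¬ j' = i' := fun e => h e.symm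
      simp [h, h', Matrix.blockDiagonal_apply]

/-- The square `‖x‖₀² = ⟨B₀ x, x⟩` of the adapted norm. -/
def adaptedNormSq (a : Fin ℓ → ℝ) (c : Fin m → ℝ) (x : HypIndex ℓ m → ℝ) : ℝ :=
  (lyapunovMatrix a c *ᵥ x) ⬝ᵥ x

/-- `p` is smooth and, along the part `(x', ξ') = 0`, `(x'', ξ'') ∈ V` of the center manifold, it
is stationary with quadratic part `⟨A₀ x', ξ'⟩` in normal form, all the eigenvalues
`λ_j(x'', ξ'')` of `A₀ = A₀(x'', ξ'')` having positive real parts. For `k = 0` this says that the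
origin is a critical point of (complex) hyperbolic type, in symplectic coordinates such that
`Λ₊ = {ξ = 0}` and `Λ₋ = {x = 0}`. -/
structure IsHyperbolicAlong (V : Set (SymplSpace (Fin k))) (a : SymplSpace (Fin k) → Fin ℓ → ℝ)
    (c d : SymplSpace (Fin k) → Fin m → ℝ) (p : PhaseSpace ℓ m k → ℝ) : Prop where
  smooth : ContDiff ℝ ∞ p
  a_pos : ∀ σ ∈ V, ∀ j, 0 < a σ j
  c_pos : ∀ σ ∈ V, ∀ j, 0 < c σ j
  critical : ∀ σ ∈ V, fderiv ℝ p (0, σ) = 0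
  hessian : ∀ σ ∈ V, ∀ u v : PhaseSpace ℓ m k,
    fderiv ℝ (fderiv ℝ p) (0, σ) u v =
      (normalMatrix (a σ) (c σ) (d σ) *ᵥ u.1.1) ⬝ᵥ v.1.2 +
      (normalMatrix (a σ) (c σ) (d σ) *ᵥ v.1.1) ⬝ᵥ u.1.2

/-- The region `Ω = {‖x'‖₀² + ‖ξ'‖₀² < r(x'', ξ'')}`, the norms being those at the point
`(x'', ξ'') ∈ V`. For `k = 0` the function `r` is a number `δ²`. -/
def region (V : Set (SymplSpace (Fin k))) (a : SymplSpace (Fin k) → Fin ℓ → ℝ)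
    (c : SymplSpace (Fin k) → Fin m → ℝ) (r : SymplSpace (Fin k) → ℝ) :
    Set (PhaseSpace ℓ m k) :=
  {ρ | ρ.2 ∈ V ∧
    adaptedNormSq (a ρ.2) (c ρ.2) ρ.1.1 + adaptedNormSq (a ρ.2) (c ρ.2) ρ.1.2 < r ρ.2}

/-- A smooth nonnegative function with support close to `σ₀`, and with small values and
derivatives (of order at most two). For `k = 0`: a number in `[0, ε]`. -/
structure IsSmallRadius (σ₀ : SymplSpace (Fin k)) (ε : ℝ) (r : SymplSpace (Fin k) → ℝ) :
    Prop where
  smooth : ContDiff ℝ ∞ r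
  nonneg : ∀ σ, 0 ≤ r σ
  support : tsupport r ⊆ Metric.ball σ₀ ε
  small : ∀ σ, r σ ≤ ε
  small_fderiv : ∀ σ, ‖fderiv ℝ r σ‖ ≤ ε
  small_fderiv_two : ∀ σ, ‖fderiv ℝ (fderiv ℝ r) σ‖ ≤ ε

/-- `q` is a smooth Hamiltonian which coincides with `p` in `Ω`, whose Hamilton field has the
complete flow `φ`, and all of whose trajectories cross `Ω` at most once. -/
structure IsModification (Ω : Set (PhaseSpace ℓ m k)) (p q : PhaseSpace ℓ m k → ℝ)
    (φ : ℝ → PhaseSpace ℓ m k → PhaseSpace ℓ m k) : Prop where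
  smooth : ContDiff ℝ ∞ q
  eqOn : Set.EqOn q p Ω
  flow : IsHamiltonFlow q φ
  crossing : ∀ ρ, {t : ℝ | φ t ρ ∈ Ω}.OrdConnected

/-- `χout + χin = 1` is a smooth partition of unity on the unit sphere of the variables
`(x', ξ')`, extended to `(x', ξ') ≠ 0` as homogeneous functions of degree `0`, with
`supp χout ⊂ {‖ξ'‖₀ < 2 ‖x'‖₀}` and `supp χin ⊂ {‖x'‖₀ < 2 ‖ξ'‖₀}`, the norms being those at the
points `σ ∈ S`. The values at `(x', ξ') = 0` are irrelevant. -/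
structure IsConePartition (S : Set (SymplSpace (Fin k))) (a : SymplSpace (Fin k) → Fin ℓ → ℝ)
    (c : SymplSpace (Fin k) → Fin m → ℝ) (χout χin : SymplSpace (HypIndex ℓ m) → ℝ) : Prop where
  smooth_out : ContDiffOn ℝ ∞ χout {0}ᶜ
  smooth_in : ContDiffOn ℝ ∞ χin {0}ᶜ
  homogeneous_out : ∀ t : ℝ, 0 < t → ∀ v, v ≠ 0 → χout (t • v) = χout v
  homogeneous_in : ∀ t : ℝ, 0 < t → ∀ v, v ≠ 0 → χin (t • v) = χin v
  sum_eq_one : ∀ v, v ≠ 0 → χout v + χin v = 1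
  support_out : ∀ v ∈ tsupport χout, v ≠ 0 → ∀ σ ∈ S,
    adaptedNormSq (a σ) (c σ) v.2 < 4 * adaptedNormSq (a σ) (c σ) v.1
  support_in : ∀ v ∈ tsupport χin, v ≠ 0 → ∀ σ ∈ S,
    adaptedNormSq (a σ) (c σ) v.1 < 4 * adaptedNormSq (a σ) (c σ) v.2

/-- All derivatives of `g` (including `g` itself) vanish at the points `(0, σ)`, `σ ∈ S`. -/
def IsFlatOn (S : Set (SymplSpace (Fin k))) (g : PhaseSpace ℓ m k → ℝ) : Prop :=
  ∀ σ ∈ S, ∀ j : ℕ, iteratedFDeriv ℝ j g (0, σ) = 0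

/-- `f = ∫_{-∞}^0 (χout g) ∘ exp(t H) dt - ∫_0^∞ (χin g) ∘ exp(t H) dt`. -/
def homologicalSolution (φ : ℝ → PhaseSpace ℓ m k → PhaseSpace ℓ m k)
    (χout χin : SymplSpace (HypIndex ℓ m) → ℝ) (g : PhaseSpace ℓ m k → ℝ)
    (ρ : PhaseSpace ℓ m k) : ℝ :=
  (∫ t in Set.Iic (0 : ℝ), χout (φ t ρ).1 * g (φ t ρ)) +
    -(∫ t in Set.Ici (0 : ℝ), χin (φ t ρ).1 * g (φ t ρ))

end

/-! Write `w = (x', ξ')`. Along the linear field `L w = (A₀ x', -A₀ᵀ ξ')` the Lyapunov equation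
makes `‖x'‖₀²` grow at the rate `|x'|²` and `‖ξ'‖₀²` decrease at the rate `|ξ'|²`. Hence `‖x'‖₀² +
‖ξ'‖₀²` has second derivative `2⟨A₀ x', x'⟩ + 2⟨A₀ᵀ ξ', ξ'⟩ ≥ c₀ |w|²`. Near `σ₀`, `p` coincides
with a model defined on the whole space: its quadratic part at `(0, σ₀)` plus a cut-off remainder
with small second derivatives (`IsHyperbolicAlong.exists_model`). The model field is `(L w, 0)` up
to `δ |w|`, and the second derivative of `r` along it is `O(|w|²)` with a small constant. So `‖x'‖₀²
+ ‖ξ'‖₀² - r` is convex along model trajectories (`IsPerturbedLinear.convexOn`), and is negative on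
an interval of times: the model is a modification.

For an arbitrary modification, a trajectory that is in `Ω` now and in `supp g` later stays in `Ω` in
between, where it follows the model. Along it `‖x'‖₀² - 4 ‖ξ'‖₀²` is nondecreasing. If it ends in
`supp χin`, it has therefore been in the cone `‖x'‖₀² ≤ 4 ‖ξ'‖₀²` all along, and there `‖ξ'‖₀²`
controls `|w|²` and decays exponentially (`IsPerturbedLinear.decay`). Since `χin g` is smooth and
vanishes to infinite order at `w = 0` (`contDiff_homogeneous_mul`), the integrand decays at any
prescribed exponential rate. The integral over the past is the same statement with time reversed and
`x'`, `ξ'` exchanged.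

Differentiating the flow costs a factor `exp(λ t)`, which this decay absorbs. To handle all orders,
the derivative of a flow integral in a direction `v` is written as a flow integral at `(y, v)` of
the tangent system on `E × E`, with observable `dG(y) v`. The class `IsDecayingIntegrand` is stable
under this passage, so smoothness and flatness follow by induction over all spaces at once
(`IsDecayingIntegrand.contDiffOn_and_flat`). Finally the field applied to `∫₀^∞ G ∘ φ_t dt` gives
`-G`, and the two contributions add up to `(χout + χin) g = g`. -/

/-- `φ` is the (complete) flow of the vector field `F`. -/
structure IsFlow {E : Type*} [NormedAddCommGroup E] [NormedSpace ℝ E] (F : E → E)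
    (φ : ℝ → E → E) : Prop where
  zero : ∀ y, φ 0 y = y
  hasDerivAt : ∀ y t, HasDerivAt (fun s => φ s y) (F (φ t y)) t

/-! ### Flows: uniqueness, group law, Gronwall, completeness -/

section ODE

open Set Metric
open scoped Topology NNReal Manifold

variable {E : Type*} [NormedAddCommGroup E] [NormedSpace ℝ E]

theorem isMIntegralCurveOn_Ioo_iff_hasDerivAt {F : E → E} {γ : ℝ → E} {a b : ℝ} :
    IsMIntegralCurveOn (I := 𝓘(ℝ, E)) γ F (Ioo a b) ↔
      ∀ t ∈ Ioo a b, HasDerivAt γ (F (γ t)) t := by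
  refine forall₂_congr fun t ht => ?_
  refine hasMFDerivWithinAt_iff_hasFDerivWithinAt.trans ⟨fun h => ?_, fun h => ?_⟩
  · have h : HasFDerivWithinAt γ ((1 : ℝ →L[ℝ] ℝ).smulRight (F (γ t))) (Ioo a b) t := h
    exact (h.hasFDerivAt (isOpen_Ioo.mem_nhds ht)).hasDerivAt.congr_deriv (one_smul ℝ _)
  · exact h.hasFDerivAt.hasFDerivWithinAt

theorem isMIntegralCurve_iff_hasDerivAt {F : E → E} {γ : ℝ → E} :
    IsMIntegralCurve (I := 𝓘(ℝ, E)) γ F ↔ ∀ t, HasDerivAt γ (F (γ t)) t := by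
  refine forall_congr' fun t => ?_
  refine hasMFDerivAt_iff_hasFDerivAt.trans ⟨fun h => ?_, fun h => ?_⟩
  · have h : HasFDerivAt γ ((1 : ℝ →L[ℝ] ℝ).smulRight (F (γ t))) t := h
    exact h.hasDerivAt.congr_deriv (one_smul ℝ _)
  · exact h.hasFDerivAt

theorem contMDiff_section_of_contDiff {F : E → E} (hF : ContDiff ℝ 1 F) :
    ContMDiff 𝓘(ℝ, E) (𝓘(ℝ, E).prod 𝓘(ℝ, E)) 1
      (fun x => (⟨x, F x⟩ : TangentBundle 𝓘(ℝ, E) E)) :=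
  contMDiff_vectorSpace_iff_contDiff.mpr hF

theorem eqOn_Ioo_of_hasDerivAt {F : E → E} (hF : ContDiff ℝ 1 F) {γ γ' : ℝ → E} {a b t₀ : ℝ}
    (ht₀ : t₀ ∈ Ioo a b) (hγ : ∀ t ∈ Ioo a b, HasDerivAt γ (F (γ t)) t)
    (hγ' : ∀ t ∈ Ioo a b, HasDerivAt γ' (F (γ' t)) t) (h : γ t₀ = γ' t₀) :
    EqOn γ γ' (Ioo a b) :=
  isMIntegralCurveOn_Ioo_eqOn_of_contMDiff_boundaryless (I := 𝓘(ℝ, E)) ht₀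
    (contMDiff_section_of_contDiff hF) (isMIntegralCurveOn_Ioo_iff_hasDerivAt.mpr hγ)
    (isMIntegralCurveOn_Ioo_iff_hasDerivAt.mpr hγ') h

theorem IsFlow.add {F : E → E} (hF : ContDiff ℝ 1 F) {φ : ℝ → E → E} (hφ : IsFlow F φ)
    (s t : ℝ) (y : E) : φ t (φ s y) = φ (t + s) y := by
  have h1 : ∀ u ∈ Ioo (-|t| - 1) (|t| + 1),
      HasDerivAt (fun u => φ u (φ s y)) (F (φ u (φ s y))) u := fun u _ => hφ.hasDerivAt _ u
  have h2 : ∀ u ∈ Ioo (-|t| - 1) (|t| + 1),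
      HasDerivAt (fun u => φ (u + s) y) (F (φ (u + s) y)) u := fun u _ =>
    (hφ.hasDerivAt y (u + s)).comp_add_const u s
  refine eqOn_Ioo_of_hasDerivAt hF (t₀ := 0) ⟨?_, ?_⟩ h1 h2 ?_ ⟨?_, ?_⟩
  · have := abs_nonneg t; linarith
  · have := abs_nonneg t; linarith
  · simp [hφ.zero]
  · have := neg_abs_le t; linarith
  · have := le_abs_self t; linarith

theorem IsFlow.reverse {F : E → E} {φ : ℝ → E → E} (hφ : IsFlow F φ) :
    IsFlow (fun y => -F y) (fun t => φ (-t)) where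
  zero y := by simp [hφ.zero]
  hasDerivAt y t := by
    simpa [Function.comp_def] using (hφ.hasDerivAt y (-t)).scomp t (hasDerivAt_neg t)

theorem IsFlow.continuous {F : E → E} {φ : ℝ → E → E} (hφ : IsFlow F φ) (y : E) :
    Continuous fun t => φ t y :=
  continuous_iff_continuousAt.mpr fun t => (hφ.hasDerivAt y t).continuousAt

/-- Gronwall's inequality, in both directions of time. -/
theorem norm_le_gronwallBound_abs {f f' : ℝ → E} {δ K ε T : ℝ}
    (hf : ∀ t, |t| ≤ T → HasDerivAt f (f' t) t) (h0 : ‖f 0‖ ≤ δ)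
    (hb : ∀ t, |t| ≤ T → ‖f' t‖ ≤ K * ‖f t‖ + ε) {t : ℝ} (ht : |t| ≤ T) :
    ‖f t‖ ≤ gronwallBound δ K ε |t| := by
  have key : ∀ (f f' : ℝ → E), (∀ t, |t| ≤ T → HasDerivAt f (f' t) t) → ‖f 0‖ ≤ δ →
      (∀ t, |t| ≤ T → ‖f' t‖ ≤ K * ‖f t‖ + ε) → ∀ t, 0 ≤ t → t ≤ T →
      ‖f t‖ ≤ gronwallBound δ K ε t := by
    intro f f' hf h0 hb t ht0 htT
    have aux : ∀ s, 0 ≤ s → s ≤ t → |s| ≤ T := fun s h1 h2 => by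
      rw [abs_of_nonneg h1]; linarith
    have := norm_le_gronwallBound_of_norm_deriv_right_le (f := f) (f' := f') (a := 0) (b := t)
      (fun s hs => (hf s (aux s hs.1 hs.2)).continuousAt.continuousWithinAt)
      (fun s hs => (hf s (aux s hs.1 hs.2.le)).hasDerivWithinAt) h0
      (fun s hs => hb s (aux s hs.1 hs.2.le)) t ⟨ht0, le_rfl⟩
    simpa using this
  rcases le_total 0 t with h | h
  · rw [abs_of_nonneg h] at ht ⊢
    exact key f f' hf h0 hb t h ht
  · rw [abs_of_nonpos h] at ht ⊢
    have := key (fun s => f (-s)) (fun s => -f' (-s))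
      (fun s hs => by
        simpa [Function.comp_def] using
          (hf (-s) (by simpa using hs)).scomp s (hasDerivAt_neg s))
      (by simpa using h0) (fun s hs => by simpa using hb (-s) (by simpa using hs)) (-t)
      (by linarith) ht
    simpa using this

/-- A `C¹` vector field of linear growth is complete. -/
theorem exists_isFlow_of_linear_growth {E : Type*} [NormedAddCommGroup E] [NormedSpace ℝ E]
    [FiniteDimensional ℝ E] {F : E → E} (hF : ContDiff ℝ 1 F) {C : ℝ}
    (hC : ∀ y, ‖F y‖ ≤ C * (1 + ‖y‖)) : ∃ φ, IsFlow F φ := by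
  have : CompleteSpace E := FiniteDimensional.complete ℝ E
  have : ProperSpace E := FiniteDimensional.proper_real E
  have hC0 : 0 ≤ C := by
    have := (norm_nonneg _).trans (hC 0)
    simpa using this
  -- On the ball of radius `1 + ‖x‖` about `x` the speed is at most `2 C (1 + ‖x‖)`, so a solution
  -- from `x` lasts for the time `τ`, which does not depend on `x`; a uniform existence time gives
  -- global solutions.
  set τ : ℝ := (2 * (C + 1))⁻¹ with hτ
  have hτ0 : 0 < τ := by positivity
  have loc : ∀ x, ∃ γ : ℝ → E, γ 0 = x ∧
      IsMIntegralCurveOn (I := 𝓘(ℝ, E)) γ F (Ioo (-τ) τ) := by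
    intro x
    obtain ⟨K, hK⟩ : ∃ K, LipschitzOnWith K F (closedBall x (1 + ‖x‖)) :=
      hF.contDiffOn.exists_lipschitzOnWith one_ne_zero (convex_closedBall _ _)
        (isCompact_closedBall _ _)
    have hPL : IsPicardLindelof (fun _ => F) (tmin := -τ) (tmax := τ)
        ⟨0, by simp [hτ0.le]⟩ x (.mk (1 + ‖x‖) (by positivity)) 0
        (.mk (C * (1 + (‖x‖ + (1 + ‖x‖)))) (by positivity)) K := by
      refine IsPicardLindelof.of_time_independent ?_ hK ?_
      · intro y hy
        refine (hC y).trans ?_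
        simp only [NNReal.coe_mk]
        gcongr
        have : ‖y - x‖ ≤ 1 + ‖x‖ := by simpa [dist_eq_norm] using hy
        calc ‖y‖ = ‖x + (y - x)‖ := by congr 1; abel
          _ ≤ ‖x‖ + ‖y - x‖ := norm_add_le _ _
          _ ≤ _ := by gcongr
      · simp only [NNReal.coe_mk, sub_zero, zero_sub, neg_neg, max_self, NNReal.coe_zero]
        rw [hτ, ← div_eq_mul_inv, div_le_iff₀ (by positivity)]
        nlinarith [norm_nonneg x]
    obtain ⟨γ, h0, hγ⟩ := hPL.exists_eq_forall_mem_Icc_hasDerivWithinAt₀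
    refine ⟨γ, h0, isMIntegralCurveOn_Ioo_iff_hasDerivAt.mpr fun t ht => ?_⟩
    exact (hγ t ⟨ht.1.le, ht.2.le⟩).hasDerivAt (Icc_mem_nhds ht.1 ht.2)
  choose γ hγ0 hγ using exists_isMIntegralCurve_of_isMIntegralCurveOn (I := 𝓘(ℝ, E)) (v := F)
    (contMDiff_section_of_contDiff hF) hτ0 loc
  exact ⟨fun t y => γ y t, hγ0, fun y => isMIntegralCurve_iff_hasDerivAt.mp (hγ y)⟩

end ODE

/-! ### Differentiability of the flow and the variational equation -/

section FlowDerivative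

open Set Metric Asymptotics
open scoped Topology NNReal

variable {E : Type*} [NormedAddCommGroup E] [NormedSpace ℝ E]

theorem gronwallBound_zero_left (K ε x : ℝ) :
    gronwallBound 0 K ε x = ε * gronwallBound 0 K 1 x := by
  unfold gronwallBound
  split_ifs <;> ring

theorem norm_sub_sub_fderiv_le {F : Type*} [NormedAddCommGroup F] [NormedSpace ℝ F] {f : E → F}
    (hf : ContDiff ℝ 2 f) {K : ℝ}
    (hK : ∀ y, ‖fderiv ℝ (fderiv ℝ f) y‖ ≤ K) (y z : E) :
    ‖f z - f y - fderiv ℝ f y (z - y)‖ ≤ K * ‖z - y‖ ^ 2 := by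
  have hd : Differentiable ℝ f := hf.differentiable (by norm_num)
  have hd' : Differentiable ℝ (fderiv ℝ f) :=
    (hf.fderiv_right (m := 1) (by norm_num)).differentiable (by norm_num)
  have hK0 : 0 ≤ K := (norm_nonneg (fderiv ℝ (fderiv ℝ f) 0)).trans (hK 0)
  have h1 : ∀ x ∈ closedBall y ‖z - y‖, ‖fderiv ℝ f x - fderiv ℝ f y‖ ≤ K * ‖z - y‖ := by
    intro x hx
    refine (convex_univ.norm_image_sub_le_of_norm_fderiv_le (fun x _ => hd' x) (fun x _ => hK x)
      (mem_univ y) (mem_univ x)).trans ?_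
    gcongr
    simpa [dist_eq_norm] using hx
  have := (convex_closedBall y ‖z - y‖).norm_image_sub_le_of_norm_fderiv_le'
    (fun x _ => hd x) h1 (mem_closedBall_self (norm_nonneg _))
    (by simp [dist_eq_norm] : z ∈ closedBall y ‖z - y‖)
  calc _ ≤ _ := this
    _ = _ := by ring

theorem IsFlow.norm_sub_le {F : E → E} (hF : Differentiable ℝ F) {φ : ℝ → E → E}
    (hφ : IsFlow F φ) {K : ℝ} (hK : ∀ y, ‖fderiv ℝ F y‖ ≤ K) (t : ℝ) (y z : E) :
    ‖φ t z - φ t y‖ ≤ ‖z - y‖ * Real.exp (K * |t|) := by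
  rw [← gronwallBound_ε0]
  refine norm_le_gronwallBound_abs (f := fun s => φ s z - φ s y)
    (f' := fun s => F (φ s z) - F (φ s y)) (T := |t|)
    (fun s _ => (hφ.hasDerivAt z s).sub (hφ.hasDerivAt y s)) (by simp [hφ.zero]) ?_ le_rfl
  intro s _
  simpa using convex_univ.norm_image_sub_le_of_norm_fderiv_le (fun x _ => hF x)
    (fun x _ => hK x) (mem_univ (φ s y)) (mem_univ (φ s z))

/-- The flow of a compactly supported vector field is differentiable, and its derivative solves
the variational equation. -/
theorem IsFlow.exists_hasFDerivAt_of_hasCompactSupport [FiniteDimensional ℝ E] {F : E → E}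
    (hF : ContDiff ℝ 2 F) (hc : HasCompactSupport F) {φ : ℝ → E → E} (hφ : IsFlow F φ) :
    ∃ J : ℝ → E → E →L[ℝ] E, (∀ t y, HasFDerivAt (φ t) (J t y) y) ∧
      ∀ y t, HasDerivAt (fun s => J s y) ((fderiv ℝ F (φ t y)).comp (J t y)) t := by
  have hF1 : ContDiff ℝ 1 (fderiv ℝ F) := hF.fderiv_right (by norm_num)
  have hF2 : Continuous (fderiv ℝ (fderiv ℝ F)) :=
    (hF1.fderiv_right (m := 0) (by norm_num)).continuous
  obtain ⟨M, hM⟩ := hF.continuous.bounded_above_of_compact_support hc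
  obtain ⟨K, hK⟩ := hF1.continuous.bounded_above_of_compact_support (hc.fderiv ℝ)
  obtain ⟨K', hK'⟩ := hF2.bounded_above_of_compact_support ((hc.fderiv ℝ).fderiv ℝ)
  have hM0 : 0 ≤ M := (norm_nonneg _).trans (hM 0)
  have hK0 : 0 ≤ K := (norm_nonneg _).trans (hK 0)
  have hK0' : 0 ≤ K' := (norm_nonneg _).trans (hK' 0)
  have hd : Differentiable ℝ F := hF.differentiable (by norm_num)
  -- The field and its variational equation form a single field of linear growth on `E × (E →L[ℝ]
  -- E)`; the second component, started at the identity, is the candidate derivative.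
  obtain ⟨Φ, hΦ⟩ := exists_isFlow_of_linear_growth
    (F := fun p : E × (E →L[ℝ] E) => (F p.1, (fderiv ℝ F p.1).comp p.2)) (C := M + K)
    (((hF.of_le (by norm_num)).comp contDiff_fst).prodMk
      ((hF1.comp contDiff_fst).clm_comp contDiff_snd)) (by
      rintro ⟨y, A⟩
      have h0 : 0 ≤ ‖(y, A)‖ := norm_nonneg _
      refine max_le ?_ ?_
      · refine (hM y).trans ?_
        nlinarith [mul_nonneg hM0 h0, mul_nonneg hK0 h0]
      · refine (ContinuousLinearMap.opNorm_comp_le _ _).trans ?_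
        have h1 : ‖fderiv ℝ F y‖ * ‖A‖ ≤ K * ‖(y, A)‖ :=
          mul_le_mul (hK y) (norm_snd_le (y, A)) (norm_nonneg _) hK0
        refine h1.trans ?_
        nlinarith [mul_nonneg hM0 h0])
  have hfst : ∀ y A t, HasDerivAt (fun s => (Φ s (y, A)).1) (F (Φ t (y, A)).1) t := fun y A t =>
    (hΦ.hasDerivAt (y, A) t).fst
  have hsnd : ∀ y A t, HasDerivAt (fun s => (Φ s (y, A)).2)
      ((fderiv ℝ F (Φ t (y, A)).1).comp (Φ t (y, A)).2) t := fun y A t =>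
    (hΦ.hasDerivAt (y, A) t).snd
  have heq : ∀ y A t, (Φ t (y, A)).1 = φ t y := by
    intro y A t
    refine eqOn_Ioo_of_hasDerivAt (hF.of_le (by norm_num)) (a := -|t| - 1) (b := |t| + 1) (t₀ := 0)
      ⟨?_, ?_⟩ (fun u _ => hfst y A u) (fun u _ => hφ.hasDerivAt y u) ?_ ⟨?_, ?_⟩
    · have := abs_nonneg t; linarith
    · have := abs_nonneg t; linarith
    · simp [hφ.zero, hΦ.zero]
    · have := neg_abs_le t; linarith
    · have := le_abs_self t; linarith
  simp only [heq] at hsnd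
  refine ⟨fun t y => (Φ t (y, ContinuousLinearMap.id ℝ E)).2, fun t y => ?_,
    fun y t => hsnd y _ t⟩
  set J : ℝ → E →L[ℝ] E := fun t => (Φ t (y, ContinuousLinearMap.id ℝ E)).2 with hJ
  have hJ' : ∀ t, HasDerivAt J ((fderiv ℝ F (φ t y)).comp (J t)) t := fun t => hsnd y _ t
  have hJ0 : J 0 = ContinuousLinearMap.id ℝ E := by simp [hJ, hΦ.zero]
  set c : ℝ := K' * Real.exp (K * |t|) ^ 2 * gronwallBound 0 K 1 |t| with hcdef
  have key : ∀ h : E, ‖φ t (y + h) - φ t y - J t h‖ ≤ c * ‖h‖ ^ 2 := by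
    intro h
    have hder : ∀ s, HasDerivAt (fun s => φ s (y + h) - φ s y - J s h)
        (F (φ s (y + h)) - F (φ s y) - fderiv ℝ F (φ s y) (J s h)) s := fun s =>
      ((hφ.hasDerivAt (y + h) s).sub (hφ.hasDerivAt y s)).sub
        (by simpa using (hJ' s).clm_apply (hasDerivAt_const s h))
    have := norm_le_gronwallBound_abs (T := |t|) (δ := 0) (K := K)
      (ε := K' * (‖h‖ * Real.exp (K * |t|)) ^ 2)
      (fun s _ => hder s) (by simp [hφ.zero, hJ0]) (fun s hs => ?_) le_rfl
    · rw [gronwallBound_zero_left] at this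
      refine this.trans (le_of_eq ?_)
      rw [hcdef]; ring
    -- The error of the linear approximation solves the variational equation with the Taylor
    -- remainder of `F` as source. This source is quadratic in `h`, so Gronwall from initial value
    -- `0` keeps the error quadratic.
    · have e1 : F (φ s (y + h)) - F (φ s y) - fderiv ℝ F (φ s y) (J s h) =
          fderiv ℝ F (φ s y) (φ s (y + h) - φ s y - J s h) +
          (F (φ s (y + h)) - F (φ s y) - fderiv ℝ F (φ s y) (φ s (y + h) - φ s y)) := by
        simp only [map_sub]; abel
      rw [e1]
      refine (norm_add_le _ _).trans (add_le_add ?_ ?_)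
      · exact (ContinuousLinearMap.le_opNorm _ _).trans
          (mul_le_mul_of_nonneg_right (hK _) (norm_nonneg _))
      · refine (norm_sub_sub_fderiv_le hF hK' _ _).trans ?_
        gcongr
        have := hφ.norm_sub_le hd hK s y (y + h)
        rw [add_sub_cancel_left] at this
        refine this.trans ?_
        gcongr
  rw [hasFDerivAt_iff_isLittleO_nhds_zero]
  refine (IsBigO.of_bound c (Filter.Eventually.of_forall fun h => ?_)).trans_isLittleO
    (isLittleO_norm_pow_id one_lt_two)
  simpa using key h

/-- The flow of a smooth vector field is differentiable, and its derivative solves the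
variational equation. -/
theorem IsFlow.hasFDerivAt_and_hasDerivAt_fderiv [FiniteDimensional ℝ E] {F : E → E}
    (hF : ContDiff ℝ ∞ F) {φ : ℝ → E → E} (hφ : IsFlow F φ) (y : E) (t : ℝ) :
    HasFDerivAt (φ t) (fderiv ℝ (φ t) y) y ∧
      HasDerivAt (fun s => fderiv ℝ (φ s) y)
        ((fderiv ℝ F (φ t y)).comp (fderiv ℝ (φ t) y)) t := by
  set T : ℝ := |t| + 1 with hT
  have hT0 : 0 < T := by positivity
  have htT : t ∈ Ioo (-T) T :=
    ⟨by have := neg_abs_le t; linarith, by have := le_abs_self t; linarith⟩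
  obtain ⟨R, hR⟩ : ∃ R, ∀ s ∈ Icc (-T) T, ‖φ s y‖ ≤ R :=
    isCompact_Icc.exists_bound_of_continuousOn (hφ.continuous y).continuousOn
  have hR0 : 0 ≤ R := (norm_nonneg _).trans (hR 0 ⟨by linarith, by linarith⟩)
  let χ : ContDiffBump (0 : E) := ⟨R + 1, R + 2, by linarith, by linarith⟩
  set G : E → E := fun x => χ x • F x with hG
  have hGs : ContDiff ℝ ∞ G := χ.contDiff.smul hF
  have hGc : HasCompactSupport G := χ.hasCompactSupport.smul_right
  have hGF : ∀ x ∈ closedBall (0 : E) (R + 1), G x = F x := fun x hx => by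
    simp [hG, χ.one_of_mem_closedBall hx]
  have hG2 : ContDiff ℝ 2 G := by exact_mod_cast contDiff_infty.mp hGs 2
  obtain ⟨M, hM⟩ := hGs.continuous.bounded_above_of_compact_support hGc
  obtain ⟨K, hK⟩ := (hG2.continuous_fderiv (by norm_num)).bounded_above_of_compact_support
    (hGc.fderiv ℝ)
  have hM0 : 0 ≤ M := (norm_nonneg _).trans (hM 0)
  have hK0 : 0 ≤ K := (norm_nonneg _).trans (hK 0)
  obtain ⟨ψ, hψ⟩ := exists_isFlow_of_linear_growth (F := G) (hG2.of_le (by norm_num)) (C := M)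
    (fun y => (hM y).trans (by nlinarith [norm_nonneg y]))
  obtain ⟨J, hJ, hJ'⟩ := hψ.exists_hasFDerivAt_of_hasCompactSupport hG2 hGc
  have h0T : (0 : ℝ) ∈ Ioo (-T) T := ⟨by linarith, hT0⟩
  have e1 : EqOn (fun s => φ s y) (fun s => ψ s y) (Ioo (-T) T) := by
    refine eqOn_Ioo_of_hasDerivAt (hG2.of_le (by norm_num)) h0T (fun s hs => ?_)
      (fun s _ => hψ.hasDerivAt y s) (by simp [hφ.zero, hψ.zero])
    rw [hGF]
    · exact hφ.hasDerivAt y s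
    · have := hR s ⟨hs.1.le, hs.2.le⟩
      simp only [mem_closedBall, dist_zero_right]; linarith
  have e2 : ∀ᶠ z in 𝓝 y, ∀ s ∈ Ioo (-T) T, φ s z = ψ s z := by
    -- The cut-off field is globally `K`-Lipschitz: starting within `exp(-K T)` of `y` keeps `ψ s z`
    -- within distance `1` of `ψ s y`, hence in the ball of radius `R + 1` where both fields agree.
    filter_upwards [ball_mem_nhds y (Real.exp_pos (-(K * T)))] with z hz
    refine eqOn_Ioo_of_hasDerivAt (hF.of_le (by exact_mod_cast le_top)) h0T
      (fun s _ => hφ.hasDerivAt z s)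
      (fun s hs => ?_) (by simp [hφ.zero, hψ.zero])
    rw [← hGF]
    · exact hψ.hasDerivAt z s
    · have h1 := hψ.norm_sub_le (hG2.differentiable (by norm_num)) hK s y z
      have h2 : ‖ψ s y‖ ≤ R := by
        have h : φ s y = ψ s y := e1 hs
        rw [← h]; exact hR s ⟨hs.1.le, hs.2.le⟩
      have h3 : ‖z - y‖ < Real.exp (-(K * T)) := by simpa [dist_eq_norm] using hz
      have h4 : ‖z - y‖ * Real.exp (K * |s|) ≤ 1 := by
        have : |s| ≤ T := abs_le.mpr ⟨hs.1.le, hs.2.le⟩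
        calc _ ≤ Real.exp (-(K * T)) * Real.exp (K * T) := by gcongr
          _ = 1 := by rw [← Real.exp_add]; simp
      have h5 : ψ s z = ψ s y + (ψ s z - ψ s y) := by abel
      simp only [mem_closedBall, dist_zero_right]
      rw [h5]
      refine (norm_add_le _ _).trans ?_
      linarith
  have hder : ∀ s ∈ Ioo (-T) T, HasFDerivAt (φ s) (J s y) y := fun s hs =>
    (hJ s y).congr_of_eventuallyEq (e2.mono fun z hz => hz s hs)
  refine ⟨(hder t htT).differentiableAt.hasFDerivAt, ?_⟩
  rw [(hder t htT).fderiv]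
  have hGF' : fderiv ℝ F (φ t y) = fderiv ℝ G (ψ t y) := by
    have h : φ t y = ψ t y := e1 htT
    rw [← h]
    refine Filter.EventuallyEq.fderiv_eq ?_
    filter_upwards [ball_mem_nhds (φ t y) one_pos] with z hz
    refine (hGF z ?_).symm
    have h1 := hR t ⟨htT.1.le, htT.2.le⟩
    have h2 : ‖z - φ t y‖ < 1 := by simpa [dist_eq_norm] using hz
    have h3 : z = φ t y + (z - φ t y) := by abel
    simp only [mem_closedBall, dist_zero_right]
    rw [h3]
    refine (norm_add_le _ _).trans ?_
    linarith
  rw [hGF']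
  refine (hJ' y t).congr_of_eventuallyEq ?_
  filter_upwards [isOpen_Ioo.mem_nhds htT] with s hs
  exact (hder s hs).fderiv

theorem IsFlow.fderiv_zero {F : E → E} {φ : ℝ → E → E} (hφ : IsFlow F φ) (y : E) :
    fderiv ℝ (φ 0) y = ContinuousLinearMap.id ℝ E := by
  have : φ 0 = id := funext hφ.zero
  rw [this]; exact fderiv_id

end FlowDerivative

/-! ### Decaying integrands and their stability under differentiation -/

section DecayingIntegrand

open Set Metric MeasureTheory
open scoped Topology NNReal

variable {E : Type} [NormedAddCommGroup E] [NormedSpace ℝ E]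

/-- The observable `G` is so flat on `{d = 0}`, and the forward trajectories starting in the bounded
open set `U` which reach the support of `G` approach `{d = 0}` so quickly, that the integral of `G`
along these trajectories depends smoothly on the starting point in `U`. -/
structure IsDecayingIntegrand (F : E → E) (φ : ℝ → E → E) (G : E → ℝ) (U : Set E) (d : E → ℝ)
    (c C : ℝ) : Prop where
  contDiff_field : ContDiff ℝ ∞ F
  flow : IsFlow F φ
  contDiff : ContDiff ℝ ∞ G
  isOpen : IsOpen U
  isBounded : Bornology.IsBounded U
  c_pos : 0 < c
  C_nonneg : 0 ≤ C
  d_nonneg : ∀ y, 0 ≤ d y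
  d_le : ∀ y ∈ U, d y ≤ 1
  mem : ∀ y ∈ U, ∀ t, 0 ≤ t → φ t y ∈ tsupport G → ∀ s ∈ Icc 0 t, φ s y ∈ U
  decay : ∀ y ∈ U, ∀ t, 0 ≤ t → φ t y ∈ tsupport G → d (φ t y) ≤ C * Real.exp (-c * t) * d y
  flat : ∀ j N : ℕ, ∃ B, ∀ y ∈ U, ‖iteratedFDeriv ℝ j G y‖ ≤ B * d y ^ N

/-- The derivative of the flow, rescaled in time. -/
noncomputable def tangentFlow (φ : ℝ → E → E) (lam : ℝ) (t : ℝ) (p : E × E) : E × E :=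
  (φ t p.1, Real.exp (-lam * t) • fderiv ℝ (φ t) p.1 p.2)

/-- The generator of the rescaled tangent flow. -/
noncomputable def tangentField (F : E → E) (lam : ℝ) (p : E × E) : E × E :=
  (F p.1, fderiv ℝ F p.1 p.2 - lam • p.2)

theorem IsFlow.tangentFlow [FiniteDimensional ℝ E] {F : E → E} (hF : ContDiff ℝ ∞ F)
    {φ : ℝ → E → E} (hφ : IsFlow F φ) (lam : ℝ) :
    IsFlow (tangentField F lam) (tangentFlow φ lam) where
  zero p := by simp [_root_.tangentFlow, hφ.zero, hφ.fderiv_zero]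
  hasDerivAt p t := by
    refine (hφ.hasDerivAt p.1 t).prodMk ?_
    have h1 := (hφ.hasFDerivAt_and_hasDerivAt_fderiv hF p.1 t).2.clm_apply
      (hasDerivAt_const t p.2)
    have h2 : HasDerivAt (fun s => Real.exp (-lam * s)) (Real.exp (-lam * t) * -lam) t := by
      simpa using ((hasDerivAt_id t).const_mul (-lam)).exp
    refine (h2.smul h1).congr_deriv ?_
    simp only [_root_.tangentFlow, ContinuousLinearMap.comp_apply, map_zero, add_zero, map_smul,
      smul_smul]
    rw [sub_eq_add_neg, ← neg_smul]
    congr 2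
    ring

theorem IsDecayingIntegrand.exists_norm_fderiv_le [FiniteDimensional ℝ E]
    {F : E → E} {φ : ℝ → E → E} {G : E → ℝ} {U : Set E}
    {d : E → ℝ} {c C : ℝ} (h : IsDecayingIntegrand F φ G U d c C) :
    ∃ lam, 0 ≤ lam ∧ ∀ y ∈ U, ‖fderiv ℝ F y‖ ≤ lam := by
  obtain ⟨B, hB⟩ := h.isBounded.isCompact_closure.exists_bound_of_continuousOn
    (h.contDiff_field.continuous_fderiv (by simp)).continuousOn
  exact ⟨max B 0, le_max_right _ _, fun y hy => (hB y (subset_closure hy)).trans (le_max_left _ _)⟩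

/-- Gronwall for the variational equation. Only the values of `fderiv ℝ F` along the trajectory
enter, so a bound on `U` suffices while the trajectory stays there. -/
theorem IsDecayingIntegrand.norm_fderiv_flow_le [FiniteDimensional ℝ E]
    {F : E → E} {φ : ℝ → E → E} {G : E → ℝ} {U : Set E}
    {d : E → ℝ} {c C : ℝ} (h : IsDecayingIntegrand F φ G U d c C) {lam : ℝ}
    (hlam : ∀ y ∈ U, ‖fderiv ℝ F y‖ ≤ lam) {y : E} {t : ℝ} (ht : 0 ≤ t)
    (hs : ∀ s ∈ Icc 0 t, φ s y ∈ U) : ‖fderiv ℝ (φ t) y‖ ≤ Real.exp (lam * t) := by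
  have hder := fun s => (h.flow.hasFDerivAt_and_hasDerivAt_fderiv h.contDiff_field y s).2
  have := norm_le_gronwallBound_of_norm_deriv_right_le (f := fun s => fderiv ℝ (φ s) y)
    (a := 0) (b := t) (δ := 1) (K := lam) (ε := 0)
    (fun s _ => (hder s).continuousAt.continuousWithinAt) (fun s _ => (hder s).hasDerivWithinAt)
    (by rw [h.flow.fderiv_zero]; exact ContinuousLinearMap.norm_id_le)
    (fun s hs' => by
      rw [add_zero]
      exact (ContinuousLinearMap.opNorm_comp_le _ _).trans
        (mul_le_mul_of_nonneg_right (hlam _ (hs s ⟨hs'.1, hs'.2.le⟩)) (norm_nonneg _)))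
    t ⟨ht, le_rfl⟩
  simpa [gronwallBound_ε0] using this

theorem tsupport_fderiv_pairing_subset (G : E → ℝ) :
    tsupport (fun p : E × E => fderiv ℝ G p.1 p.2) ⊆ Prod.fst ⁻¹' tsupport G := by
  refine closure_minimal (fun p hp => ?_) ((isClosed_tsupport G).preimage continuous_fst)
  refine support_fderiv_subset ℝ (f := G) ?_
  intro h0
  exact hp (by simp [h0])

/-- The rescaling by `exp(-lam t)` compensates the growth of the derivative of the flow, so the
vector component does not leave `ball 0 R` while the base point is in `U`. Decay and flatness only
concern the base point, because `d` ignores the vector and the support of `dG(y) v` lies over the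
support of `G`. -/
theorem IsDecayingIntegrand.tangent [FiniteDimensional ℝ E] {F : E → E} {φ : ℝ → E → E} {G : E → ℝ} {U : Set E}
    {d : E → ℝ} {c C : ℝ} (h : IsDecayingIntegrand F φ G U d c C) {lam : ℝ}
    (hlam : ∀ y ∈ U, ‖fderiv ℝ F y‖ ≤ lam) (R : ℝ) :
    IsDecayingIntegrand (tangentField F lam) (tangentFlow φ lam)
      (fun p : E × E => fderiv ℝ G p.1 p.2) (U ×ˢ ball 0 R) (fun p => d p.1) c C where
  contDiff_field := by
    have h1 : ContDiff ℝ ∞ (fderiv ℝ F) := h.contDiff_field.fderiv_right (by simp)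
    exact (h.contDiff_field.comp contDiff_fst).prodMk
      (((h1.comp contDiff_fst).clm_apply contDiff_snd).sub (contDiff_snd.const_smul lam))
  flow := h.flow.tangentFlow h.contDiff_field lam
  contDiff := by
    have h1 : ContDiff ℝ ∞ (fderiv ℝ G) := h.contDiff.fderiv_right (by simp)
    exact (h1.comp contDiff_fst).clm_apply contDiff_snd
  isOpen := h.isOpen.prod isOpen_ball
  isBounded := h.isBounded.prod isBounded_ball
  c_pos := h.c_pos
  C_nonneg := h.C_nonneg
  d_nonneg p := h.d_nonneg p.1
  d_le p hp := h.d_le p.1 hp.1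
  mem := by
    rintro ⟨y, v⟩ ⟨hy, hv⟩ t ht hG s hs
    have hmem := h.mem y hy t ht (tsupport_fderiv_pairing_subset G hG)
    refine ⟨hmem s hs, ?_⟩
    have h1 := h.norm_fderiv_flow_le hlam hs.1
      (fun u hu => hmem u ⟨hu.1, hu.2.trans hs.2⟩)
    simp only [mem_ball, dist_zero_right] at hv ⊢
    refine lt_of_le_of_lt ?_ hv
    simp only [tangentFlow, norm_smul, Real.norm_eq_abs, Real.abs_exp]
    calc _ ≤ Real.exp (-lam * s) * (Real.exp (lam * s) * ‖v‖) := by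
          gcongr
          exact (ContinuousLinearMap.le_opNorm _ _).trans (by gcongr)
      _ = ‖v‖ := by rw [← mul_assoc, ← Real.exp_add]; simp
  decay := by
    rintro ⟨y, v⟩ ⟨hy, _⟩ t ht hG
    exact h.decay y hy t ht (tsupport_fderiv_pairing_subset G hG)
  flat := by
    intro j N
    have hsnd : ∀ i : ℕ, ∃ B, 0 ≤ B ∧ ∀ p ∈ U ×ˢ ball (0 : E) R,
        ‖iteratedFDeriv ℝ i (Prod.snd : E × E → E) p‖ ≤ B := by
      intro i
      obtain ⟨B, hB⟩ :=
        (h.isBounded.prod (isBounded_ball (x := (0 : E)) (r := R))).isCompact_closure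
        |>.exists_bound_of_continuousOn
          (contDiff_snd.continuous_iteratedFDeriv (m := i) (n := ∞) (𝕜 := ℝ) (F := E) (E := E × E)
            (by exact_mod_cast le_top)).continuousOn
      exact ⟨max B 0, le_max_right _ _,
        fun p hp => (hB p (subset_closure hp)).trans (le_max_left _ _)⟩
    choose B hB0 hB using hsnd
    choose A hA using fun i => h.flat (i + 1) N
    have h1 : ContDiff ℝ ∞ (fderiv ℝ G) := h.contDiff.fderiv_right (by simp)
    -- Leibniz rule for the pairing of `fderiv ℝ G` with the vector: the first factor carries the
    -- flatness (one order higher in `G`), the second is bounded with all derivatives on a bounded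
    -- set.
    refine ⟨∑ i ∈ Finset.range (j + 1), j.choose i * A i * B (j - i), fun p hp => ?_⟩
    refine (norm_iteratedFDeriv_clm_apply (h1.comp contDiff_fst)
      contDiff_snd p (by exact_mod_cast le_top)).trans ?_
    rw [Finset.sum_mul]
    refine Finset.sum_le_sum fun i _ => ?_
    have e1 : ‖iteratedFDeriv ℝ i (fderiv ℝ G ∘ (Prod.fst : E × E → E)) p‖ ≤ A i * d p.1 ^ N := by
      rw [show (Prod.fst : E × E → E) = ContinuousLinearMap.fst ℝ E E from rfl,
        ContinuousLinearMap.iteratedFDeriv_comp_right _ h1 _ (by exact_mod_cast le_top)]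
      refine (ContinuousMultilinearMap.norm_compContinuousLinearMap_le _ _).trans ?_
      refine (mul_le_of_le_one_right (norm_nonneg _)
        (Finset.prod_le_one (fun _ _ => norm_nonneg _)
          fun _ _ => ContinuousLinearMap.norm_fst_le ℝ E E)).trans ?_
      rw [norm_iteratedFDeriv_fderiv]
      exact hA i _ hp.1
    calc _ ≤ (j.choose i : ℝ) * (A i * d p.1 ^ N) * B (j - i) := by
          gcongr
          · exact mul_nonneg (Nat.cast_nonneg _) ((norm_nonneg _).trans e1)
          · exact hB _ p hp
      _ = _ := by ring

end DecayingIntegrand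

/-! ### Smoothness and flatness of integrals along the flow -/

section FlowIntegral

open Set Metric MeasureTheory
open scoped Topology NNReal

/-- The weighted integral of the observable `G` along the forward trajectories. -/
noncomputable def flowIntegral {E : Type} (φ : ℝ → E → E) (G : E → ℝ) (μ : ℝ) (y : E) : ℝ :=
  ∫ t in Ici (0 : ℝ), Real.exp (μ * t) * G (φ t y)

theorem integrableOn_exp_neg_Ici (B : ℝ) :
    IntegrableOn (fun t : ℝ => B * Real.exp (-t)) (Ici 0) := by
  rw [integrableOn_Ici_iff_integrableOn_Ioi]
  have := (exp_neg_integrableOn_Ioi 0 one_pos).const_mul B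
  simpa [IntegrableOn] using this

variable {E : Type} [NormedAddCommGroup E] [NormedSpace ℝ E]
  {F : E → E} {φ : ℝ → E → E} {G : E → ℝ} {U : Set E} {d : E → ℝ} {c C : ℝ}

/-- High-order flatness turns the exponential approach to `{d = 0}` into decay at any prescribed
rate. The factor `d y` is kept so that the integrals vanish on `{d = 0}`. -/
theorem IsDecayingIntegrand.exists_bound (h : IsDecayingIntegrand F φ G U d c C) (j : ℕ) (μ : ℝ) :
    ∃ B, 0 ≤ B ∧ ∀ y ∈ U, ∀ t, 0 ≤ t →
      Real.exp (μ * t) * ‖iteratedFDeriv ℝ j G (φ t y)‖ ≤ B * Real.exp (-t) * d y := by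
  -- Flatness of order `N + 1` gives the rate `c (N + 1) ≥ μ + 1`, which beats the weight with
  -- `exp(-t)` to spare. The order is at least `1`, and `d y ≤ 1`, so one factor `d y` survives.
  obtain ⟨N, hN⟩ := exists_nat_ge ((μ + 1) / c)
  have hN' : μ + 1 ≤ c * (N + 1) := by
    rw [div_le_iff₀ h.c_pos] at hN
    nlinarith [h.c_pos]
  obtain ⟨B, hB⟩ := h.flat j (N + 1)
  have hC := h.C_nonneg
  refine ⟨max B 0 * C ^ (N + 1), by positivity, fun y hy t ht => ?_⟩
  have hd := h.d_nonneg y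
  by_cases hG : φ t y ∈ tsupport G
  · have hU := h.mem y hy t ht hG t ⟨ht, le_rfl⟩
    have h1 := h.decay y hy t ht hG
    have h2 : d (φ t y) ^ (N + 1) ≤ C ^ (N + 1) * Real.exp (-(c * (N + 1)) * t) * d y := by
      calc d (φ t y) ^ (N + 1) ≤ (C * Real.exp (-c * t) * d y) ^ (N + 1) := by
            gcongr; exact h.d_nonneg _
        _ = C ^ (N + 1) * Real.exp (-(c * (N + 1)) * t) * d y ^ (N + 1) := by
            rw [mul_pow, mul_pow, ← Real.exp_nat_mul]
            congr 3
            push_cast; ring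
        _ ≤ C ^ (N + 1) * Real.exp (-(c * (N + 1)) * t) * d y := by
            gcongr
            exact pow_le_of_le_one hd (h.d_le y hy) (by simp)
    calc _ ≤ Real.exp (μ * t) * (max B 0 * (C ^ (N + 1) *
            Real.exp (-(c * (N + 1)) * t) * d y)) := by
          gcongr
          refine (hB _ hU).trans ?_
          have := h.d_nonneg (φ t y)
          gcongr
          exact le_max_left _ _
      _ = max B 0 * C ^ (N + 1) * Real.exp ((μ - c * (N + 1)) * t) * d y := by
          rw [show (μ - c * (N + 1)) * t = μ * t + -(c * (N + 1)) * t by ring, Real.exp_add]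
          ring
      _ ≤ _ := by
          gcongr
          nlinarith
  · have : iteratedFDeriv ℝ j G (φ t y) = 0 := by
      by_contra h0
      exact hG (support_iteratedFDeriv_subset j h0)
    rw [this, norm_zero, mul_zero]
    positivity

theorem IsDecayingIntegrand.continuous_integrand (h : IsDecayingIntegrand F φ G U d c C) (μ : ℝ)
    (y : E) : Continuous fun t => Real.exp (μ * t) * G (φ t y) := by
  have h1 := h.contDiff.continuous.comp (h.flow.continuous y)
  exact (by fun_prop : Continuous fun t => Real.exp (μ * t)).mul h1

theorem IsDecayingIntegrand.integrableOn (h : IsDecayingIntegrand F φ G U d c C) (μ : ℝ)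
    {y : E} (hy : y ∈ U) : IntegrableOn (fun t => Real.exp (μ * t) * G (φ t y)) (Ici 0) := by
  obtain ⟨B, -, hB⟩ := h.exists_bound 0 μ
  refine (integrableOn_exp_neg_Ici (B * d y)).mono'
    (h.continuous_integrand μ y).aestronglyMeasurable ?_
  filter_upwards [ae_restrict_mem measurableSet_Ici] with t ht
  have := hB y hy t ht
  rw [norm_iteratedFDeriv_zero] at this
  rw [norm_mul, Real.norm_eq_abs, Real.abs_exp]
  linarith

theorem IsDecayingIntegrand.flowIntegral_eq_zero (h : IsDecayingIntegrand F φ G U d c C) (μ : ℝ)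
    {y : E} (hy : y ∈ U) (hd : d y = 0) : flowIntegral φ G μ y = 0 := by
  obtain ⟨B, -, hB⟩ := h.exists_bound 0 μ
  rw [flowIntegral, ← setIntegral_congr_fun measurableSet_Ici (f := fun _ => (0 : ℝ))]
  · simp
  · intro t ht
    have := hB y hy t ht
    rw [norm_iteratedFDeriv_zero, hd, mul_zero] at this
    have h2 : ‖G (φ t y)‖ ≤ 0 := by
      by_contra h3
      push Not at h3
      have := mul_pos (Real.exp_pos (μ * t)) h3
      linarith
    simp [norm_le_zero_iff.mp h2]

/-- Partial derivatives of a function which is flat at `(y, v)` vanish. -/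
theorem iteratedFDeriv_slice_eq_zero {f : E × E → ℝ} {W : Set (E × E)} {n : ℕ}
    (hf : ContDiffOn ℝ n f W) (hW : IsOpen W) {y v : E} (hy : (y, v) ∈ W)
    (h0 : iteratedFDeriv ℝ n f (y, v) = 0) : iteratedFDeriv ℝ n (fun z => f (z, v)) y = 0 := by
  set W' : Set (E × E) := (fun p => p + (0, v)) ⁻¹' W with hW'
  have hW'o : IsOpen W' := hW.preimage (by fun_prop)
  have hf' : ContDiffOn ℝ n (fun p => f (p + (0, v))) W' :=
    hf.comp (by fun_prop) (fun p hp => hp)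
  have hpre : IsOpen (ContinuousLinearMap.inl ℝ E E ⁻¹' W') :=
    hW'o.preimage (ContinuousLinearMap.continuous _)
  have hmem : ContinuousLinearMap.inl ℝ E E y ∈ W' := by simpa [hW'] using hy
  have key := (ContinuousLinearMap.inl ℝ E E).iteratedFDerivWithin_comp_right hf'
    hW'o.uniqueDiffOn hpre.uniqueDiffOn hmem le_rfl
  rw [iteratedFDerivWithin_of_isOpen n hpre hmem, iteratedFDerivWithin_of_isOpen n hW'o hmem,
    iteratedFDeriv_comp_add_right] at key
  have e : (fun p => f (p + (0, v))) ∘ (ContinuousLinearMap.inl ℝ E E) = fun z => f (z, v) := by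
    ext z; simp
  rw [e] at key
  rw [key]
  simp only [ContinuousLinearMap.inl_apply, Prod.mk_add_mk, add_zero, zero_add, h0]
  rfl

variable [FiniteDimensional ℝ E]

/-- The derivative of a flow integral is a flow integral of the tangent system. -/
theorem IsDecayingIntegrand.hasFDerivAt_flowIntegral (h : IsDecayingIntegrand F φ G U d c C)
    (μ : ℝ) {lam : ℝ} (hlam : ∀ y ∈ U, ‖fderiv ℝ F y‖ ≤ lam) {y : E} (hy : y ∈ U) :
    ∃ A : E →L[ℝ] ℝ, HasFDerivAt (flowIntegral φ G μ) A y ∧ ∀ v, A v =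
      flowIntegral (tangentFlow φ lam) (fun p : E × E => fderiv ℝ G p.1 p.2) (μ + lam) (y, v) := by
  obtain ⟨B, hB0, hB⟩ := h.exists_bound 1 (μ + lam)
  set D : E → ℝ → E →L[ℝ] ℝ := fun z t =>
    Real.exp (μ * t) • (fderiv ℝ G (φ t z)).comp (fderiv ℝ (φ t) z) with hD
  have hfl := h.flow.hasFDerivAt_and_hasDerivAt_fderiv h.contDiff_field
  -- The chain rule costs `exp(lam t)`; the first-derivative bound was taken with weight `μ + lam`
  -- for this reason. It is uniform in `z ∈ U`, which permits differentiation under the integral.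
  have hbound : ∀ z ∈ U, ∀ t, 0 ≤ t → ‖D z t‖ ≤ B * Real.exp (-t) := by
    intro z hz t ht
    have h1 : ‖fderiv ℝ G (φ t z)‖ = ‖iteratedFDeriv ℝ 1 G (φ t z)‖ :=
      by rw [← norm_iteratedFDeriv_fderiv, norm_iteratedFDeriv_zero]
    rw [hD]
    simp only [norm_smul, Real.norm_eq_abs, Real.abs_exp]
    by_cases hG : φ t z ∈ tsupport G
    · have h2 := h.norm_fderiv_flow_le hlam ht (h.mem z hz t ht hG)
      have h3 := hB z hz t ht
      calc _ ≤ Real.exp (μ * t) * (‖fderiv ℝ G (φ t z)‖ * Real.exp (lam * t)) := by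
            gcongr
            exact (ContinuousLinearMap.opNorm_comp_le _ _).trans (by gcongr)
        _ = Real.exp ((μ + lam) * t) * ‖iteratedFDeriv ℝ 1 G (φ t z)‖ := by
            rw [h1, add_mul, Real.exp_add]; ring
        _ ≤ B * Real.exp (-t) * d z := h3
        _ ≤ B * Real.exp (-t) * 1 := by gcongr; exact h.d_le z hz
        _ = _ := mul_one _
    · have : fderiv ℝ G (φ t z) = 0 := by
        by_contra h0
        exact hG (support_fderiv_subset ℝ h0)
      rw [this]
      simp only [ContinuousLinearMap.zero_comp, norm_zero, mul_zero]
      positivity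
  have hcont : Continuous (D y) := by
    have h1 : Continuous fun t => fderiv ℝ (φ t) y :=
      continuous_iff_continuousAt.mpr fun t => (hfl y t).2.continuousAt
    have h2 : Continuous fun t => fderiv ℝ G (φ t y) :=
      (h.contDiff.continuous_fderiv (by simp)).comp (h.flow.continuous y)
    exact (by fun_prop : Continuous fun t => Real.exp (μ * t)).smul (h2.clm_comp h1)
  have hint : Integrable (D y) (volume.restrict (Ici 0)) := by
    refine (integrableOn_exp_neg_Ici B).mono' hcont.aestronglyMeasurable ?_
    filter_upwards [ae_restrict_mem measurableSet_Ici] with t ht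
    exact hbound y hy t ht
  refine ⟨∫ t in Ici (0 : ℝ), D y t, ?_, fun v => ?_⟩
  · refine hasFDerivAt_integral_of_dominated_of_fderiv_le (μ := volume.restrict (Ici 0))
      (F := fun z t => Real.exp (μ * t) * G (φ t z)) (F' := D) (h.isOpen.mem_nhds hy)
      (Filter.Eventually.of_forall fun z => (h.continuous_integrand μ z).aestronglyMeasurable)
      (h.integrableOn μ hy) hcont.aestronglyMeasurable ?_ (integrableOn_exp_neg_Ici B) ?_
    · filter_upwards [ae_restrict_mem measurableSet_Ici] with t ht z hz
      exact hbound z hz t ht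
    · refine Filter.Eventually.of_forall fun t z _ => ?_
      have h1 : HasFDerivAt G (fderiv ℝ G (φ t z)) (φ t z) :=
        (h.contDiff.differentiable (by simp) _).hasFDerivAt
      exact (h1.comp z (hfl z t).1).const_mul (Real.exp (μ * t))
  · rw [ContinuousLinearMap.integral_apply hint, flowIntegral]
    refine setIntegral_congr_fun measurableSet_Ici fun t _ => ?_
    simp only [hD, tangentFlow, smul_apply, ContinuousLinearMap.comp_apply,
      map_smul, smul_eq_mul]
    rw [← mul_assoc, ← Real.exp_add]
    congr 2
    ring

/-- The space, the flow and the weight are quantified inside the induction, because one derivative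
on `E` is an undifferentiated flow integral on `E × E` with the weight raised by `lam`. -/
theorem IsDecayingIntegrand.contDiffOn_and_flat (n : ℕ) :
    ∀ {E : Type} [NormedAddCommGroup E] [NormedSpace ℝ E] [FiniteDimensional ℝ E]
      {F : E → E} {φ : ℝ → E → E} {G : E → ℝ} {U : Set E} {d : E → ℝ} {c C : ℝ},
      IsDecayingIntegrand F φ G U d c C → ∀ μ : ℝ,
      ContDiffOn ℝ n (flowIntegral φ G μ) U ∧
        ∀ y ∈ U, d y = 0 → iteratedFDeriv ℝ n (flowIntegral φ G μ) y = 0 := by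
  induction n with
  | zero =>
    intro E _ _ _ F φ G U d c C h μ
    obtain ⟨lam, -, hlam⟩ := h.exists_norm_fderiv_le
    refine ⟨?_, fun y hy hd => ?_⟩
    · refine contDiffOn_zero.mpr fun y hy => ?_
      obtain ⟨A, hA, -⟩ := h.hasFDerivAt_flowIntegral μ hlam hy
      exact hA.continuousAt.continuousWithinAt
    · rw [← norm_le_zero_iff, norm_iteratedFDeriv_zero, h.flowIntegral_eq_zero μ hy hd, norm_zero]
  | succ n ih =>
    intro E _ _ _ F φ G U d c C h μ
    obtain ⟨lam, -, hlam⟩ := h.exists_norm_fderiv_le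
    have hder : ∀ y ∈ U, HasFDerivAt (flowIntegral φ G μ) (fderiv ℝ (flowIntegral φ G μ) y) y ∧
        ∀ v, fderiv ℝ (flowIntegral φ G μ) y v = flowIntegral (tangentFlow φ lam)
          (fun p : E × E => fderiv ℝ G p.1 p.2) (μ + lam) (y, v) := by
      intro y hy
      obtain ⟨A, hA, hAv⟩ := h.hasFDerivAt_flowIntegral μ hlam hy
      rw [hA.fderiv]
      exact ⟨hA, hAv⟩
    have hball : ∀ v : E, v ∈ ball (0 : E) (‖v‖ + 1) := fun v => by simp
    -- In finite dimension the derivative may be tested on one vector `v` at a time; the radius `‖v‖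
    -- + 1` puts `v` in the ball of the tangent system.
    have hfd : ContDiffOn ℝ n (fderiv ℝ (flowIntegral φ G μ)) U := by
      refine contDiffOn_clm_apply.mpr fun v => ?_
      have h1 := (ih (h.tangent hlam (‖v‖ + 1)) (μ + lam)).1
      refine (h1.comp (f := fun y => (y, v)) (s := U) (by fun_prop)
        (fun y hy => ⟨hy, hball v⟩)).congr fun y hy => (hder y hy).2 v
    refine ⟨?_, fun y hy hd => ?_⟩
    · push_cast
      rw [contDiffOn_succ_iff_fderiv_of_isOpen h.isOpen]
      exact ⟨fun y hy => (hder y hy).1.differentiableAt.differentiableWithinAt, by simp, hfd⟩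
    -- Evaluated at `v`, the derivative of order `n + 1` is the one of order `n` in `z` of the
    -- tangent integral at `(z, v)`, and the full `n`-th derivative of the latter vanishes at `(y,
    -- v)` by induction.
    · rw [← norm_le_zero_iff, ← norm_iteratedFDeriv_fderiv, norm_le_zero_iff]
      ext1 m
      ext1 v
      have hat : ContDiffAt ℝ n (fderiv ℝ (flowIntegral φ G μ)) y :=
        hfd.contDiffAt (h.isOpen.mem_nhds hy)
      have e1 := ContinuousLinearMap.iteratedFDeriv_comp_left
        (ContinuousLinearMap.apply ℝ ℝ v) hat (i := n) le_rfl
      have e2 : ((ContinuousLinearMap.apply ℝ ℝ v) ∘ fderiv ℝ (flowIntegral φ G μ))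
          =ᶠ[𝓝 y] fun z => flowIntegral (tangentFlow φ lam)
          (fun p : E × E => fderiv ℝ G p.1 p.2) (μ + lam) (z, v) := by
        filter_upwards [h.isOpen.mem_nhds hy] with z hz
        exact (hder z hz).2 v
      have hT := h.tangent hlam (‖v‖ + 1)
      have h1 := ih hT (μ + lam)
      rw [(e2.iteratedFDeriv ℝ n).self_of_nhds, iteratedFDeriv_slice_eq_zero h1.1 hT.isOpen ⟨hy, hball v⟩
        (h1.2 (y, v) ⟨hy, hball v⟩ hd)] at e1
      have e3 := congrArg (fun A => A m) e1
      simpa using e3.symm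

theorem IsDecayingIntegrand.contDiffOn_flowIntegral (h : IsDecayingIntegrand F φ G U d c C)
    (μ : ℝ) : ContDiffOn ℝ ∞ (flowIntegral φ G μ) U :=
  contDiffOn_infty.mpr fun n => (IsDecayingIntegrand.contDiffOn_and_flat n h μ).1

theorem IsDecayingIntegrand.iteratedFDeriv_flowIntegral_eq_zero
    (h : IsDecayingIntegrand F φ G U d c C) (μ : ℝ) (n : ℕ) {y : E} (hy : y ∈ U) (hd : d y = 0) :
    iteratedFDeriv ℝ n (flowIntegral φ G μ) y = 0 :=
  (IsDecayingIntegrand.contDiffOn_and_flat n h μ).2 y hy hd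

end FlowIntegral

/-! ### Flat functions times homogeneous functions of degree 0 -/

section Flat

open Set Metric
open scoped Topology

variable {W S : Type} [NormedAddCommGroup W] [NormedSpace ℝ W] [NormedAddCommGroup S]
  [NormedSpace ℝ S]

theorem isOpen_fst_ne_zero {W S : Type*} [NormedAddCommGroup W] [NormedAddCommGroup S] :
    IsOpen {y : W × S | y.1 ≠ 0} :=
  isOpen_ne.preimage continuous_fst

/-- A smooth function of compact support which is flat on `{0} × S` is, with all its derivatives,
bounded by any power of the first variable. -/
theorem exists_norm_iteratedFDeriv_le_pow {g : W × S → ℝ} (hg : ContDiff ℝ ∞ g)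
    (hc : HasCompactSupport g) (h0 : ∀ σ (j : ℕ), iteratedFDeriv ℝ j g (0, σ) = 0) (N : ℕ) :
    ∀ j : ℕ, ∃ B, 0 ≤ B ∧ ∀ y, ‖iteratedFDeriv ℝ j g y‖ ≤ B * ‖y.1‖ ^ N := by
  induction N with
  | zero =>
    intro j
    obtain ⟨B, hB⟩ := (hg.continuous_iteratedFDeriv (m := j)
      (by exact_mod_cast le_top)).bounded_above_of_compact_support (hc.iteratedFDeriv j)
    exact ⟨B, (norm_nonneg _).trans (hB 0), fun y => by simpa using hB y⟩
  | succ N ih =>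
    intro j
    obtain ⟨B, hB0, hB⟩ := ih (j + 1)
    refine ⟨B, hB0, fun y => ?_⟩
    have hd : Differentiable ℝ (iteratedFDeriv ℝ j g) :=
      hg.differentiable_iteratedFDeriv (by exact_mod_cast ENat.natCast_lt_top j)
    -- Mean value inequality on the segment from `(0, y.2)`, where the function is flat: one more
    -- derivative is spent to gain one power of `‖y.1‖`.
    have key := (convex_segment ((0 : W), y.2) y).norm_image_sub_le_of_norm_fderiv_le
      (f := iteratedFDeriv ℝ j g) (C := B * ‖y.1‖ ^ N) (fun x _ => hd x)
      (fun x hx => by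
        rw [norm_fderiv_iteratedFDeriv]
        refine (hB x).trans ?_
        obtain ⟨a, b, ha, hb, hab, rfl⟩ := hx
        gcongr
        simp only [Prod.fst_add, Prod.smul_fst, smul_zero, zero_add, norm_smul, Real.norm_eq_abs,
          abs_of_nonneg hb]
        exact mul_le_of_le_one_left (norm_nonneg _) (by linarith))
      (left_mem_segment ℝ _ _) (right_mem_segment ℝ _ _)
    rw [h0, sub_zero] at key
    have e : ‖y - (0, y.2)‖ = ‖y.1‖ := by
      simp [Prod.norm_def]
    rw [e] at key
    rw [pow_succ, ← mul_assoc]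
    exact key

/-- The derivatives of a function which is smooth and homogeneous of degree `0` away from the
origin. -/
theorem exists_norm_iteratedFDeriv_le_inv_pow [FiniteDimensional ℝ W] {χ : W → ℝ}
    (hχ : ContDiffOn ℝ ∞ χ {0}ᶜ) (hh : ∀ t : ℝ, 0 < t → ∀ v, v ≠ 0 → χ (t • v) = χ v) (i : ℕ) :
    ∃ B, 0 ≤ B ∧ ∀ y : W × S, y.1 ≠ 0 →
      ‖iteratedFDeriv ℝ i (fun p : W × S => χ p.1) y‖ ≤ B * ‖y.1‖⁻¹ ^ i := by
  set f : W × S → ℝ := fun p => χ p.1 with hf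
  have hsm : ContDiffOn ℝ ∞ f {y | y.1 ≠ 0} := hχ.comp contDiff_fst.contDiffOn (fun y hy => hy)
  have hcont : ContinuousOn (iteratedFDeriv ℝ i f) {y | y.1 ≠ 0} := by
    refine (hsm.continuousOn_iteratedFDerivWithin (m := i) (by exact_mod_cast le_top)
      isOpen_fst_ne_zero.uniqueDiffOn).congr fun y hy => ?_
    exact (iteratedFDerivWithin_of_isOpen i isOpen_fst_ne_zero hy).symm
  have : ProperSpace W := FiniteDimensional.proper_real W
  -- Invariance under translations in `S` and under dilations reduces the estimate to the compact
  -- set `sphere × {0}`; the dilation by `‖y.1‖⁻¹` yields this factor once per derivative.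
  obtain ⟨B, hB⟩ := ((isCompact_sphere (0 : W) 1).prod
    (isCompact_singleton (x := (0 : S)))).exists_bound_of_continuousOn
    (hcont.mono fun y hy => ne_zero_of_mem_unit_sphere ⟨y.1, hy.1⟩)
  refine ⟨max B 0, le_max_right _ _, fun y hy => ?_⟩
  have hy' : ‖y.1‖ ≠ 0 := norm_ne_zero_iff.mpr hy
  set s : ℝ := ‖y.1‖⁻¹ with hs
  have hs0 : 0 < s := by positivity
  have htr : iteratedFDeriv ℝ i f y = iteratedFDeriv ℝ i f (y.1, 0) := by
    have h1 : (fun p => f (p + (0, y.2))) = f := by ext p; simp [hf]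
    have h2 := iteratedFDeriv_comp_add_right (𝕜 := ℝ) (f := f) i (0, y.2) (y.1, 0)
    rw [h1] at h2
    rw [h2]; simp
  let e : (W × S) ≃L[ℝ] (W × S) := ContinuousLinearEquiv.smulLeft (Units.mk0 s hs0.ne')
  have he : ∀ p, e p = s • p := fun p => rfl
  have hsc : f ∘ e = f := by
    ext p
    simp only [Function.comp_apply, he, hf, Prod.smul_fst]
    by_cases hp : p.1 = 0
    · simp [hp]
    · exact hh s hs0 _ hp
  have key := e.iteratedFDerivWithin_comp_right f uniqueDiffOn_univ (mem_univ (e (y.1, 0))) i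
  simp only [preimage_univ, iteratedFDerivWithin_univ, hsc] at key
  rw [htr, key]
  refine (ContinuousMultilinearMap.norm_compContinuousLinearMap_le _ _).trans ?_
  have hmem : e (y.1, 0) ∈ sphere (0 : W) 1 ×ˢ {(0 : S)} := by
    rw [he]
    simp [norm_smul, hs, hy']
  refine mul_le_mul ((hB _ hmem).trans (le_max_left _ _)) ?_ (by positivity) (le_max_right _ _)
  rw [Finset.prod_const, Finset.card_univ, Fintype.card_fin]
  gcongr
  refine ContinuousLinearMap.opNorm_le_bound _ hs0.le fun p => ?_
  change ‖e p‖ ≤ _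
  rw [he, norm_smul, Real.norm_eq_abs, abs_of_pos hs0]

/-- The product of a flat function and of a homogeneous function of degree `0`. -/
theorem exists_norm_iteratedFDeriv_mul_le_pow [FiniteDimensional ℝ W] {χ : W → ℝ}
    (hχ : ContDiffOn ℝ ∞ χ {0}ᶜ) (hh : ∀ t : ℝ, 0 < t → ∀ v, v ≠ 0 → χ (t • v) = χ v)
    {g : W × S → ℝ} (hg : ContDiff ℝ ∞ g)
    (hc : HasCompactSupport g) (h0 : ∀ σ (j : ℕ), iteratedFDeriv ℝ j g (0, σ) = 0) (j N : ℕ) :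
    ∃ B, 0 ≤ B ∧ ∀ y : W × S, y.1 ≠ 0 →
      ‖iteratedFDeriv ℝ j (fun p : W × S => χ p.1 * g p) y‖ ≤ B * ‖y.1‖ ^ N := by
  choose A hA0 hA using fun i => exists_norm_iteratedFDeriv_le_inv_pow (S := S) hχ hh i
  -- The order of flatness `N + i` pays for the factor `‖y.1‖⁻¹ ^ i` lost by differentiating `χ`.
  choose B hB0 hB using fun i => exists_norm_iteratedFDeriv_le_pow hg hc h0 (N + i) (j - i)
  refine ⟨∑ i ∈ Finset.range (j + 1), j.choose i * A i * B i,
    Finset.sum_nonneg fun i _ => mul_nonneg (mul_nonneg (Nat.cast_nonneg _) (hA0 i)) (hB0 i),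
    fun y hy => ?_⟩
  have hsm : ContDiffOn ℝ ∞ (fun p : W × S => χ p.1) {y | y.1 ≠ 0} :=
    hχ.comp contDiff_fst.contDiffOn (fun y hy => hy)
  have key := norm_iteratedFDerivWithin_mul_le (n := j) (N := ∞) hsm hg.contDiffOn
    isOpen_fst_ne_zero.uniqueDiffOn hy (by exact_mod_cast le_top)
  simp only [iteratedFDerivWithin_of_isOpen _ isOpen_fst_ne_zero
    (show y ∈ {y : W × S | y.1 ≠ 0} from hy)] at key
  refine key.trans ?_
  rw [Finset.sum_mul]
  refine Finset.sum_le_sum fun i _ => ?_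
  have hy' : ‖y.1‖ ≠ 0 := norm_ne_zero_iff.mpr hy
  have h1 := hA i y hy
  have h2 := hB i y
  calc _ ≤ (j.choose i : ℝ) * (A i * ‖y.1‖⁻¹ ^ i) * (B i * ‖y.1‖ ^ (N + i)) := by
        gcongr
        exact mul_nonneg (Nat.cast_nonneg _) (mul_nonneg (hA0 i) (by positivity))
    _ = _ := by
        rw [pow_add, inv_pow]
        field_simp

/-- A function which is smooth away from `{0} × S`, and decays there with all its derivatives, is
smooth, and flat on `{0} × S`. -/
theorem contDiff_and_iteratedFDeriv_eq_zero (n : ℕ) :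
    ∀ {F : Type} [NormedAddCommGroup F] [NormedSpace ℝ F] {h : W × S → F},
      (∀ y, y.1 = 0 → h y = 0) → ContDiffOn ℝ ∞ h {y | y.1 ≠ 0} →
      (∀ j : ℕ, ∃ B, 0 ≤ B ∧ ∀ y, y.1 ≠ 0 → ‖iteratedFDeriv ℝ j h y‖ ≤ B * ‖y.1‖ ^ 2) →
      ContDiff ℝ n h ∧ ∀ y, y.1 = 0 → iteratedFDeriv ℝ n h y = 0 := by
  -- A bound `O(‖y.1‖ ^ 2)` forces the derivative to vanish on `{0} × S`, so `fderiv ℝ h` satisfies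
  -- the same hypotheses as `h` and the induction closes.
  have hZ : ∀ {F : Type} [NormedAddCommGroup F] [NormedSpace ℝ F] {h : W × S → F},
      (∀ y, y.1 = 0 → h y = 0) →
      (∀ j : ℕ, ∃ B, 0 ≤ B ∧ ∀ y, y.1 ≠ 0 → ‖iteratedFDeriv ℝ j h y‖ ≤ B * ‖y.1‖ ^ 2) →
      ∀ z : W × S, z.1 = 0 → HasFDerivAt h (0 : W × S →L[ℝ] F) z := by
    intro F _ _ h h0 hb z hz
    obtain ⟨B, hB0, hB⟩ := hb 0
    have hB' : ∀ y, ‖h y‖ ≤ B * ‖y.1‖ ^ 2 := by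
      intro y
      by_cases hy : y.1 = 0
      · simp [h0 y hy, hy]
      · simpa using hB y hy
    rw [hasFDerivAt_iff_isLittleO_nhds_zero]
    refine (Asymptotics.IsBigO.of_bound B (Filter.Eventually.of_forall fun v => ?_)).trans_isLittleO
      (Asymptotics.isLittleO_norm_pow_id one_lt_two)
    simp only [h0 z hz, sub_zero, zero_apply, norm_pow, norm_norm]
    refine (hB' _).trans ?_
    gcongr
    simpa [hz] using norm_fst_le v
  induction n with
  | zero =>
    intro F _ _ h h0 hs hb
    refine ⟨contDiff_zero.mpr (continuous_iff_continuousAt.mpr fun y => ?_), fun y hy => ?_⟩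
    · by_cases hy : y.1 = 0
      · exact (hZ h0 hb y hy).continuousAt
      · exact (hs.contDiffAt (isOpen_fst_ne_zero.mem_nhds hy)).continuousAt
    · rw [← norm_le_zero_iff, norm_iteratedFDeriv_zero, h0 y hy, norm_zero]
  | succ n ih =>
    intro F _ _ h h0 hs hb
    have h1 : ContDiffOn ℝ ∞ (fderiv ℝ h) {y | y.1 ≠ 0} :=
      ((contDiffOn_infty_iff_fderiv_of_isOpen isOpen_fst_ne_zero).mp hs).2
    have := ih (h := fderiv ℝ h) (fun y hy => (hZ h0 hb y hy).fderiv) h1 (fun j => by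
      obtain ⟨B, hB0, hB⟩ := hb (j + 1)
      exact ⟨B, hB0, fun y hy => by rw [norm_iteratedFDeriv_fderiv]; exact hB y hy⟩)
    refine ⟨?_, fun y hy => ?_⟩
    · push_cast
      rw [contDiff_succ_iff_fderiv]
      refine ⟨fun y => ?_, by simp, this.1⟩
      by_cases hy : y.1 = 0
      · exact (hZ h0 hb y hy).differentiableAt
      · exact (hs.contDiffAt (isOpen_fst_ne_zero.mem_nhds hy)).differentiableAt (by simp)
    · rw [← norm_le_zero_iff, ← norm_iteratedFDeriv_fderiv, this.2 y hy, norm_zero]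

/-- The product of a flat function of compact support and of a homogeneous function of degree `0`
is smooth and flat. -/
theorem contDiff_homogeneous_mul [FiniteDimensional ℝ W] {χ : W → ℝ}
    (hχ : ContDiffOn ℝ ∞ χ {0}ᶜ) (hh : ∀ t : ℝ, 0 < t → ∀ v, v ≠ 0 → χ (t • v) = χ v)
    {g : W × S → ℝ} (hg : ContDiff ℝ ∞ g)
    (hc : HasCompactSupport g) (h0 : ∀ σ (j : ℕ), iteratedFDeriv ℝ j g (0, σ) = 0) :
    ContDiff ℝ ∞ (fun p : W × S => χ p.1 * g p) ∧
      ∀ j N : ℕ, ∃ B, ∀ y : W × S,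
        ‖iteratedFDeriv ℝ j (fun p : W × S => χ p.1 * g p) y‖ ≤ B * ‖y.1‖ ^ N := by
  have hz : ∀ y : W × S, y.1 = 0 → χ y.1 * g y = 0 := by
    rintro ⟨w, σ⟩ hw
    have h1 : g (w, σ) = 0 := by
      simp only at hw
      rw [← norm_le_zero_iff, ← norm_iteratedFDeriv_zero (𝕜 := ℝ), hw, h0 σ 0, norm_zero]
    rw [h1, mul_zero]
  have hs : ContDiffOn ℝ ∞ (fun p : W × S => χ p.1 * g p) {y | y.1 ≠ 0} :=
    (hχ.comp contDiff_fst.contDiffOn (fun y hy => hy)).mul hg.contDiffOn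
  have key := fun n => contDiff_and_iteratedFDeriv_eq_zero n hz hs
    (fun j => exists_norm_iteratedFDeriv_mul_le_pow hχ hh hg hc h0 j 2)
  refine ⟨contDiff_infty.mpr fun n => (key n).1, fun j N => ?_⟩
  obtain ⟨B, hB0, hB⟩ := exists_norm_iteratedFDeriv_mul_le_pow hχ hh hg hc h0 j N
  refine ⟨B, fun y => ?_⟩
  by_cases hy : y.1 = 0
  · rw [(key j).2 y hy, norm_zero]; positivity
  · exact hB y hy

end Flat

/-! ### Convexity along the trajectories of a perturbed linear field -/

section Convexity

set_option maxSynthPendingDepth 3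

open Set Metric
open scoped Topology

variable {W S : Type} [NormedAddCommGroup W] [NormedSpace ℝ W] [NormedAddCommGroup S]
  [NormedSpace ℝ S]

theorem abs_bilin_le {B : W →L[ℝ] W →L[ℝ] ℝ} {x y : W} {β X Y : ℝ} (hB : ‖B‖ ≤ β)
    (hx : ‖x‖ ≤ X) (hy : ‖y‖ ≤ Y) : |B x y| ≤ β * X * Y := by
  have hβ : 0 ≤ β := (norm_nonneg B).trans hB
  have hX : 0 ≤ X := (norm_nonneg x).trans hx
  have := B.le_opNorm₂ x y
  rw [Real.norm_eq_abs] at this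
  refine this.trans ?_
  gcongr

/-- The vector field `F` on `W × S` is a small perturbation of the linear field `(L w, 0)`. -/
structure IsPerturbedLinear (L : W →L[ℝ] W) (R : W × S → W) (T : W × S → S)
    (F : W × S → W × S) (δ K : ℝ) : Prop where
  eq : ∀ ρ, F ρ = (L ρ.1 + R ρ, T ρ)
  contDiff_fst : ContDiff ℝ ∞ R
  contDiff_snd : ContDiff ℝ ∞ T
  delta_nonneg : 0 ≤ δ
  delta_le : δ ≤ 1
  norm_R : ∀ ρ, ‖R ρ‖ ≤ δ * ‖ρ.1‖
  norm_T : ∀ ρ, ‖T ρ‖ ≤ δ * ‖ρ.1‖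
  norm_T' : ∀ ρ, ‖T ρ‖ ≤ δ
  norm_fderiv_R : ∀ ρ, ‖fderiv ℝ R ρ‖ ≤ δ
  norm_fderiv_T : ∀ ρ, ‖fderiv ℝ T ρ (F ρ)‖ ≤ δ * (‖L‖ + 1)
  norm_fderiv_T' : ∀ ρ, ‖fderiv ℝ T ρ (F ρ)‖ ≤ K * ‖ρ.1‖ ^ 2

/-- A family of bilinear forms close to `b₀`. -/
structure IsFormFamily (b₀ : W →L[ℝ] W →L[ℝ] ℝ) (b : S → W →L[ℝ] W →L[ℝ] ℝ) (θ M : ℝ) :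
    Prop where
  contDiff : ContDiff ℝ ∞ b
  theta_le : θ ≤ 1
  norm_sub : ∀ σ, ‖b σ - b₀‖ ≤ θ
  norm_fderiv : ∀ σ, ‖fderiv ℝ b σ‖ ≤ M
  norm_fderiv_two : ∀ σ, ‖fderiv ℝ (fderiv ℝ b) σ‖ ≤ M

/-- First derivative of a quadratic form along the perturbed field. -/
theorem abs_deriv_form_sub_le {b₀ b b₁ : W →L[ℝ] W →L[ℝ] ℝ} {L : W →L[ℝ] W} {w R : W}
    {θ δ M : ℝ} (hδ1 : δ ≤ 1)
    (hb : ‖b - b₀‖ ≤ θ) (hb₁ : ‖b₁‖ ≤ M * δ) (hR : ‖R‖ ≤ δ * ‖w‖) :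
    |(b₁ w + b (L w + R)) w + b w (L w + R) - (b₀ (L w) w + b₀ w (L w))| ≤
      (2 * (‖L‖ + 1) * θ + (2 * ‖b₀‖ + M) * δ) * ‖w‖ ^ 2 := by
  have hLw : ‖L w‖ ≤ ‖L‖ * ‖w‖ := L.le_opNorm w
  have hw1 : ‖L w + R‖ ≤ (‖L‖ + 1) * ‖w‖ := by
    refine (norm_add_le _ _).trans ?_
    nlinarith [norm_nonneg w]
  have h1 := abs_bilin_le hb₁ (le_refl ‖w‖) (le_refl ‖w‖)
  have h2 := abs_bilin_le hb hw1 (le_refl ‖w‖)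
  have h3 := abs_bilin_le hb (le_refl ‖w‖) hw1
  have h4 := abs_bilin_le (le_refl ‖b₀‖) hR (le_refl ‖w‖)
  have h5 := abs_bilin_le (le_refl ‖b₀‖) (le_refl ‖w‖) hR
  have e : (b₁ w + b (L w + R)) w + b w (L w + R) - (b₀ (L w) w + b₀ w (L w)) =
      b₁ w w + (b - b₀) (L w + R) w + (b - b₀) w (L w + R) + b₀ R w + b₀ w R := by
    simp only [map_add, add_apply, sub_apply]
    ring
  rw [e]
  rw [abs_le] at *
  constructor <;> linarith [h1.1, h1.2, h2.1, h2.2, h3.1, h3.2, h4.1, h4.2, h5.1, h5.2]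

/-- Second derivative of a quadratic form along the perturbed field. -/
theorem deriv_two_form_ge {b₀ b b₁ b₂ : W →L[ℝ] W →L[ℝ] ℝ} {L : W →L[ℝ] W} {w R R' : W}
    {θ δ M c₀ : ℝ} (hδ0 : 0 ≤ δ) (hδ1 : δ ≤ 1)
    (hb : ‖b - b₀‖ ≤ θ) (hb₁ : ‖b₁‖ ≤ M * δ) (hb₂ : ‖b₂‖ ≤ 2 * M * (‖L‖ + 1) * δ)
    (hR : ‖R‖ ≤ δ * ‖w‖) (hR' : ‖R'‖ ≤ δ * (‖L‖ + 1) * ‖w‖)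
    (hc : c₀ * ‖w‖ ^ 2 ≤ b₀ (L (L w)) w + 2 * b₀ (L w) (L w) + b₀ w (L (L w))) :
    (c₀ - 4 * (‖L‖ + 1) ^ 2 * θ - (8 * ‖b₀‖ + 6 * M) * (‖L‖ + 1) * δ) * ‖w‖ ^ 2 ≤
      b₂ w w + 2 * b₁ (L w + R) w + 2 * b₁ w (L w + R) + b (L (L w + R) + R') w +
        2 * b (L w + R) (L w + R) + b w (L (L w + R) + R') := by
  set n := ‖w‖ with hn
  set Λ := ‖L‖ + 1 with hΛ
  have hn0 : 0 ≤ n := norm_nonneg w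
  have hL0 : 0 ≤ ‖L‖ := norm_nonneg L
  have hΛ1 : 1 ≤ Λ := by linarith
  have hLw : ‖L w‖ ≤ Λ * n := (L.le_opNorm w).trans (by nlinarith)
  have hw1 : ‖L w + R‖ ≤ Λ * n := by
    refine (norm_add_le _ _).trans ?_
    have := L.le_opNorm w
    nlinarith
  have hLR : ‖L R + R'‖ ≤ 2 * Λ * δ * n := by
    refine (norm_add_le _ _).trans ?_
    have h1 : ‖L R‖ ≤ ‖L‖ * (δ * n) := (L.le_opNorm R).trans (by gcongr)
    have h2 : 0 ≤ δ * n := by positivity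
    nlinarith
  have hw2 : ‖L (L w + R) + R'‖ ≤ Λ ^ 2 * n := by
    refine (norm_add_le _ _).trans ?_
    have h1 : ‖L (L w + R)‖ ≤ ‖L‖ * (Λ * n) := (L.le_opNorm _).trans (by gcongr)
    have h2 : δ * Λ * n ≤ 1 * Λ * n := by gcongr
    nlinarith
  have h1 := abs_bilin_le hb hw2 (le_refl n)
  have h2 := abs_bilin_le hb (le_refl n) hw2
  have h3 := abs_bilin_le (le_refl ‖b₀‖) hLR (le_refl n)
  have h4 := abs_bilin_le (le_refl ‖b₀‖) (le_refl n) hLR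
  have h5 := abs_bilin_le hb hw1 hw1
  have h6 := abs_bilin_le (le_refl ‖b₀‖) hR hw1
  have h7 := abs_bilin_le (le_refl ‖b₀‖) hLw hR
  have h8 := abs_bilin_le hb₁ hw1 (le_refl n)
  have h9 := abs_bilin_le hb₁ (le_refl n) hw1
  have h10 := abs_bilin_le hb₂ (le_refl n) (le_refl n)
  -- Freezing `b` to `b₀` and dropping `R`, `R'` leaves the second derivative for the linear field;
  -- every other term carries a factor `θ` or `δ`.
  have e : b₂ w w + 2 * b₁ (L w + R) w + 2 * b₁ w (L w + R) + b (L (L w + R) + R') w +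
        2 * b (L w + R) (L w + R) + b w (L (L w + R) + R') =
      (b₀ (L (L w)) w + 2 * b₀ (L w) (L w) + b₀ w (L (L w))) +
      ((b - b₀) (L (L w + R) + R') w + (b - b₀) w (L (L w + R) + R') + b₀ (L R + R') w +
        b₀ w (L R + R') + 2 * (b - b₀) (L w + R) (L w + R) + 2 * b₀ R (L w + R) +
        2 * b₀ (L w) R + 2 * b₁ (L w + R) w + 2 * b₁ w (L w + R) + b₂ w w) := by
    simp only [map_add, add_apply, sub_apply]
    ring
  rw [e]
  rw [abs_le] at *
  linarith [h1.1, h2.1, h3.1, h4.1, h5.1, h6.1, h7.1, h8.1, h9.1, h10.1]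

set_option maxHeartbeats 1000000 in
/-- Convexity of `b σ w w - r σ` along the trajectories of the perturbed field. -/
theorem IsPerturbedLinear.convexOn {L : W →L[ℝ] W} {R : W × S → W} {T : W × S → S}
    {F : W × S → W × S} {δ K : ℝ} (hF : IsPerturbedLinear L R T F δ K)
    {b₀ : W →L[ℝ] W →L[ℝ] ℝ} {b : S → W →L[ℝ] W →L[ℝ] ℝ} {θ M : ℝ} (hb : IsFormFamily b₀ b θ M)
    {c₀ : ℝ} (hc : ∀ w, c₀ * ‖w‖ ^ 2 ≤ b₀ (L (L w)) w + 2 * b₀ (L w) (L w) + b₀ w (L (L w)))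
    {r : S → ℝ} {ε : ℝ} (hr : ContDiff ℝ ∞ r) (hε : 0 ≤ ε) (hr1 : ∀ σ, ‖fderiv ℝ r σ‖ ≤ ε)
    (hr2 : ∀ σ, ‖fderiv ℝ (fderiv ℝ r) σ‖ ≤ ε)
    (hsmall : 4 * (‖L‖ + 1) ^ 2 * θ + (8 * ‖b₀‖ + 6 * M) * (‖L‖ + 1) * δ + ε * (1 + K) ≤ c₀)
    {γ : ℝ → W × S} (hγ : ∀ t, HasDerivAt γ (F (γ t)) t) :
    ConvexOn ℝ univ (fun t => b (γ t).2 (γ t).1 (γ t).1 - r (γ t).2) := by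
  have hθ0 : 0 ≤ θ := (norm_nonneg _).trans (hb.norm_sub 0)
  have hM0 : 0 ≤ M := (norm_nonneg (fderiv ℝ b 0)).trans (hb.norm_fderiv 0)
  have hδ0 := hF.delta_nonneg
  have hδ1 := hF.delta_le
  have hL0 : 0 ≤ ‖L‖ := norm_nonneg L
  have hw : ∀ t, HasDerivAt (fun t => (γ t).1) (L (γ t).1 + R (γ t)) t := fun t => by
    have := (hγ t).fst; rwa [hF.eq] at this
  have hσ : ∀ t, HasDerivAt (fun t => (γ t).2) (T (γ t)) t := fun t => by
    have := (hγ t).snd; rwa [hF.eq] at this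
  have hw1 : ∀ t, HasDerivAt (fun t => L (γ t).1 + R (γ t))
      (L (L (γ t).1 + R (γ t)) + fderiv ℝ R (γ t) (F (γ t))) t := fun t =>
    (L.hasFDerivAt.comp_hasDerivAt t (hw t)).add
      ((hF.contDiff_fst.differentiable (by simp) (γ t)).hasFDerivAt.comp_hasDerivAt t (hγ t))
  have hT : ∀ t, HasDerivAt (fun t => T (γ t)) (fderiv ℝ T (γ t) (F (γ t))) t := fun t =>
    (hF.contDiff_snd.differentiable (by simp) (γ t)).hasFDerivAt.comp_hasDerivAt t (hγ t)
  have hb0 : ∀ t, HasDerivAt (fun t => b (γ t).2) (fderiv ℝ b (γ t).2 (T (γ t))) t := fun t =>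
    (hb.contDiff.differentiable (by simp) (γ t).2).hasFDerivAt.comp_hasDerivAt t (hσ t)
  have hbd : ContDiff ℝ ∞ (fderiv ℝ b) := hb.contDiff.fderiv_right (by simp)
  have hrd : ContDiff ℝ ∞ (fderiv ℝ r) := hr.fderiv_right (by simp)
  have hb1 : ∀ t, HasDerivAt (fun t => fderiv ℝ b (γ t).2 (T (γ t)))
      (fderiv ℝ (fderiv ℝ b) (γ t).2 (T (γ t)) (T (γ t)) +
        fderiv ℝ b (γ t).2 (fderiv ℝ T (γ t) (F (γ t)))) t := fun t =>
    ((hbd.differentiable (by simp) (γ t).2).hasFDerivAt.comp_hasDerivAt t (hσ t)).clm_apply (hT t)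
  have hr0 : ∀ t, HasDerivAt (fun t => r (γ t).2) (fderiv ℝ r (γ t).2 (T (γ t))) t := fun t =>
    (hr.differentiable (by simp) (γ t).2).hasFDerivAt.comp_hasDerivAt t (hσ t)
  have hr1' : ∀ t, HasDerivAt (fun t => fderiv ℝ r (γ t).2 (T (γ t)))
      (fderiv ℝ (fderiv ℝ r) (γ t).2 (T (γ t)) (T (γ t)) +
        fderiv ℝ r (γ t).2 (fderiv ℝ T (γ t) (F (γ t)))) t := fun t =>
    ((hrd.differentiable (by simp) (γ t).2).hasFDerivAt.comp_hasDerivAt t (hσ t)).clm_apply (hT t)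
  have hu := fun t => (((hb0 t).clm_apply (hw t)).clm_apply (hw t)).sub (hr0 t)
  have hu1 := fun t => ((((((hb1 t).clm_apply (hw t)).add ((hb0 t).clm_apply (hw1 t))).clm_apply
    (hw t)).add (((hb0 t).clm_apply (hw t)).clm_apply (hw1 t))).sub (hr1' t))
  refine convexOn_of_hasDerivWithinAt2_nonneg convex_univ
    (fun t _ => (hu t).continuousAt.continuousWithinAt)
    (fun t _ => (hu t).hasDerivWithinAt) (fun t _ => (hu1 t).hasDerivWithinAt) fun t _ => ?_
  have hFn : ‖F (γ t)‖ ≤ (‖L‖ + 1) * ‖(γ t).1‖ := by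
    have h0 := norm_nonneg (γ t).1
    rw [hF.eq]
    refine max_le ?_ ?_
    · refine (norm_add_le _ _).trans ?_
      have := L.le_opNorm (γ t).1
      have := hF.norm_R (γ t)
      nlinarith
    · have := hF.norm_T (γ t)
      change ‖T (γ t)‖ ≤ _
      nlinarith
  have hT0 := hF.norm_T (γ t)
  have hT1 := hF.norm_T' (γ t)
  have hT2 := hF.norm_fderiv_T (γ t)
  have hT3 := hF.norm_fderiv_T' (γ t)
  have key := deriv_two_form_ge (b₀ := b₀) (b := b (γ t).2)
    (b₁ := fderiv ℝ b (γ t).2 (T (γ t)))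
    (b₂ := fderiv ℝ (fderiv ℝ b) (γ t).2 (T (γ t)) (T (γ t)) +
        fderiv ℝ b (γ t).2 (fderiv ℝ T (γ t) (F (γ t))))
    (R := R (γ t)) (R' := fderiv ℝ R (γ t) (F (γ t))) (M := M)
    hδ0 hδ1 (hb.norm_sub (γ t).2)
    ((ContinuousLinearMap.le_opNorm _ _).trans
      (mul_le_mul (hb.norm_fderiv _) hT1 (norm_nonneg _) hM0))
    (by
      refine (norm_add_le _ _).trans ?_
      have h1 : ‖fderiv ℝ (fderiv ℝ b) (γ t).2 (T (γ t)) (T (γ t))‖ ≤ M * δ * δ :=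
        (ContinuousLinearMap.le_opNorm₂ _ _ _).trans
          (mul_le_mul (mul_le_mul (hb.norm_fderiv_two _) hT1 (norm_nonneg _) hM0) hT1
            (norm_nonneg _) (by positivity))
      have h2 : ‖fderiv ℝ b (γ t).2 (fderiv ℝ T (γ t) (F (γ t)))‖ ≤ M * (δ * (‖L‖ + 1)) :=
        (ContinuousLinearMap.le_opNorm _ _).trans
          (mul_le_mul (hb.norm_fderiv _) hT2 (norm_nonneg _) hM0)
      have h3 : M * δ * δ ≤ M * δ * (‖L‖ + 1) := by
        gcongr; linarith
      linarith)
    (hF.norm_R _)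
    ((ContinuousLinearMap.le_opNorm _ _).trans (by
      calc _ ≤ δ * ((‖L‖ + 1) * ‖(γ t).1‖) :=
            mul_le_mul (hF.norm_fderiv_R _) hFn (norm_nonneg _) hδ0
        _ = _ := by ring))
    (hc (γ t).1)
  -- The contribution of `r` is at most `ε (1 + K) ‖w‖²`: `T` is of first order in `w`, and its
  -- derivative along the field is of second order. A first-order bound for the latter could not be
  -- absorbed by `c₀ ‖w‖²` near `w = 0`.
  have h4 : |fderiv ℝ (fderiv ℝ r) (γ t).2 (T (γ t)) (T (γ t))| ≤ ε * ‖(γ t).1‖ ^ 2 := by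
    have h5 : ‖T (γ t)‖ ≤ ‖(γ t).1‖ := by nlinarith [norm_nonneg (γ t).1]
    have := abs_bilin_le (hr2 (γ t).2) h5 h5
    linarith
  have h6 : |fderiv ℝ r (γ t).2 (fderiv ℝ T (γ t) (F (γ t)))| ≤ ε * (K * ‖(γ t).1‖ ^ 2) := by
    rw [← Real.norm_eq_abs]
    exact (ContinuousLinearMap.le_opNorm _ _).trans
      (mul_le_mul (hr1 _) hT3 (norm_nonneg _) hε)
  have h7 := mul_le_mul_of_nonneg_right hsmall (sq_nonneg ‖(γ t).1‖)
  simp only [add_apply, Pi.add_apply] at key ⊢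
  have h8 := (abs_le.mp h4).2
  have h9 := (abs_le.mp h6).2
  linarith

end Convexity

/-! ### Exponential decay in the cone -/

section Cone

set_option maxSynthPendingDepth 3

open Set Metric
open scoped Topology

/-- Since `P - 4 Q` is nondecreasing, the cone condition at the final time propagates backwards to
all of `[0, t]`; then `exp(c s) Q s` is nonincreasing. -/
theorem le_exp_mul_of_cone {P Q P' Q' : ℝ → ℝ} {c t : ℝ} (ht : 0 ≤ t)
    (hP : ∀ s ∈ Icc 0 t, HasDerivAt P (P' s) s) (hQ : ∀ s ∈ Icc 0 t, HasDerivAt Q (Q' s) s)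
    (hmono : ∀ s ∈ Icc 0 t, 0 ≤ P' s - 4 * Q' s)
    (hdec : ∀ s ∈ Icc 0 t, P s ≤ 4 * Q s → Q' s ≤ -c * Q s) (hend : P t ≤ 4 * Q t) :
    Q t ≤ Real.exp (-c * t) * Q 0 := by
  have hcone : ∀ s ∈ Icc 0 t, P s ≤ 4 * Q s := by
    have hm : MonotoneOn (fun s => P s - 4 * Q s) (Icc 0 t) := by
      refine monotoneOn_of_hasDerivWithinAt_nonneg (convex_Icc 0 t)
        (f' := fun s => P' s - 4 * Q' s) (fun s hs => ?_) (fun s hs => ?_) (fun s hs => ?_)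
      · exact ((hP s hs).sub ((hQ s hs).const_mul 4)).continuousAt.continuousWithinAt
      · have hs' := interior_subset hs
        exact ((hP s hs').sub ((hQ s hs').const_mul 4)).hasDerivWithinAt
      · exact hmono s (interior_subset hs)
    intro s hs
    have := hm hs ⟨ht, le_rfl⟩ hs.2
    simp only at this
    linarith
  have hexp : ∀ s, HasDerivAt (fun s => Real.exp (c * s)) (Real.exp (c * s) * c) s := fun s => by
    simpa using ((hasDerivAt_id s).const_mul c).exp
  have hm : AntitoneOn (fun s => Real.exp (c * s) * Q s) (Icc 0 t) := by
    refine antitoneOn_of_hasDerivWithinAt_nonpos (convex_Icc 0 t)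
      (f' := fun s => Real.exp (c * s) * c * Q s + Real.exp (c * s) * Q' s)
      (fun s hs => ?_) (fun s hs => ?_) (fun s hs => ?_)
    · exact ((hexp s).mul (hQ s hs)).continuousAt.continuousWithinAt
    · exact ((hexp s).mul (hQ s (interior_subset hs))).hasDerivWithinAt
    · have hs' := interior_subset hs
      have h1 := hdec s hs' (hcone s hs')
      have h2 := Real.exp_pos (c * s)
      nlinarith
  have := hm ⟨le_rfl, ht⟩ ⟨ht, le_rfl⟩ ht
  simp only [mul_zero, Real.exp_zero, one_mul] at this
  calc Q t = Real.exp (-c * t) * (Real.exp (c * t) * Q t) := by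
        rw [← mul_assoc, ← Real.exp_add]; simp
    _ ≤ _ := by gcongr

variable {W S : Type} [NormedAddCommGroup W] [NormedSpace ℝ W] [NormedAddCommGroup S]
  [NormedSpace ℝ S]

theorem IsPerturbedLinear.neg {L : W →L[ℝ] W} {R : W × S → W} {T : W × S → S}
    {F : W × S → W × S} {δ K : ℝ} (hF : IsPerturbedLinear L R T F δ K) :
    IsPerturbedLinear (-L) (fun ρ => -R ρ) (fun ρ => -T ρ) (fun ρ => -F ρ) δ K where
  eq ρ := by rw [hF.eq]; ext <;> simp [add_comm]
  contDiff_fst := hF.contDiff_fst.neg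
  contDiff_snd := hF.contDiff_snd.neg
  delta_nonneg := hF.delta_nonneg
  delta_le := hF.delta_le
  norm_R ρ := by simpa using hF.norm_R ρ
  norm_T ρ := by simpa using hF.norm_T ρ
  norm_T' ρ := by simpa using hF.norm_T' ρ
  norm_fderiv_R ρ := by simpa using hF.norm_fderiv_R ρ
  norm_fderiv_T ρ := by simpa using hF.norm_fderiv_T ρ
  norm_fderiv_T' ρ := by simpa using hF.norm_fderiv_T' ρ

theorem IsPerturbedLinear.hasDerivAt_form {L : W →L[ℝ] W} {R : W × S → W} {T : W × S → S}
    {F : W × S → W × S} {δ K : ℝ} (hF : IsPerturbedLinear L R T F δ K)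
    {b₀ : W →L[ℝ] W →L[ℝ] ℝ} {b : S → W →L[ℝ] W →L[ℝ] ℝ} {θ M : ℝ} (hb : IsFormFamily b₀ b θ M)
    {γ : ℝ → W × S} {t : ℝ} (hγ : HasDerivAt γ (F (γ t)) t) :
    ∃ u', HasDerivAt (fun t => b (γ t).2 (γ t).1 (γ t).1) u' t ∧
      |u' - (b₀ (L (γ t).1) (γ t).1 + b₀ (γ t).1 (L (γ t).1))| ≤
        (2 * (‖L‖ + 1) * θ + (2 * ‖b₀‖ + M) * δ) * ‖(γ t).1‖ ^ 2 := by
  have hw : HasDerivAt (fun t => (γ t).1) (L (γ t).1 + R (γ t)) t := by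
    have := hγ.fst; rwa [hF.eq] at this
  have hσ : HasDerivAt (fun t => (γ t).2) (T (γ t)) t := by
    have := hγ.snd; rwa [hF.eq] at this
  have hb0 : HasDerivAt (fun t => b (γ t).2) (fderiv ℝ b (γ t).2 (T (γ t))) t :=
    (hb.contDiff.differentiable (by simp) (γ t).2).hasFDerivAt.comp_hasDerivAt t hσ
  refine ⟨_, (hb0.clm_apply hw).clm_apply hw, ?_⟩
  have hM0 : 0 ≤ M := (norm_nonneg (fderiv ℝ b 0)).trans (hb.norm_fderiv 0)
  exact abs_deriv_form_sub_le hF.delta_le (hb.norm_sub _)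
    ((ContinuousLinearMap.le_opNorm _ _).trans
      (mul_le_mul (hb.norm_fderiv _) (hF.norm_T' _) (norm_nonneg _) hM0)) (hF.norm_R _)

theorem IsFormFamily.abs_sub_le {b₀ : W →L[ℝ] W →L[ℝ] ℝ} {b : S → W →L[ℝ] W →L[ℝ] ℝ} {θ M : ℝ}
    (hb : IsFormFamily b₀ b θ M) (σ : S) (w : W) : |b σ w w - b₀ w w| ≤ θ * ‖w‖ ^ 2 := by
  have := abs_bilin_le (hb.norm_sub σ) (le_refl ‖w‖) (le_refl ‖w‖)
  simp only [sub_apply] at this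
  calc _ ≤ _ := this
    _ = _ := by ring

/-- Forward trajectories of the perturbed field which end in the cone `p ≤ 4 q`, where the linear
field expands `p` and contracts `q`, decay exponentially. -/
theorem IsPerturbedLinear.decay {L : W →L[ℝ] W} {R : W × S → W} {T : W × S → S}
    {F : W × S → W × S} {δ K : ℝ} (hF : IsPerturbedLinear L R T F δ K)
    {p₀ q₀ : W →L[ℝ] W →L[ℝ] ℝ} {p q : S → W →L[ℝ] W →L[ℝ] ℝ} {θ M A : ℝ}
    (hp : IsFormFamily p₀ p θ M) (hq : IsFormFamily q₀ q θ M) {eP eQ : W → ℝ}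
    (hpL : ∀ w, p₀ (L w) w + p₀ w (L w) = eP w) (hqL : ∀ w, q₀ (L w) w + q₀ w (L w) = -eQ w)
    (heQ : ∀ w, 0 ≤ eQ w) (hn : ∀ w, ‖w‖ ^ 2 ≤ eP w + eQ w)
    (hA : 1 ≤ A) (hpA : ‖p₀‖ ≤ A) (hqA : ‖q₀‖ ≤ A)
    (hcoer : ∀ w, ‖w‖ ^ 2 ≤ A * (p₀ w w + q₀ w w)) (hqe : ∀ w, q₀ w w ≤ A * eQ w)
    (hθ : 20 * A * θ ≤ 1) (hsmall : (2 * (‖L‖ + 1) * θ + (2 * A + M) * δ) * (40 * A ^ 2) ≤ 1)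
    {γ : ℝ → W × S} {t : ℝ} (ht : 0 ≤ t) (hγ : ∀ s ∈ Icc 0 t, HasDerivAt γ (F (γ s)) s)
    (hend : p (γ t).2 (γ t).1 (γ t).1 ≤ 4 * q (γ t).2 (γ t).1 (γ t).1) :
    ‖(γ t).1‖ ^ 2 ≤
      10 * A * (A + 1) * Real.exp (-(40 * A ^ 2 * (A + 1))⁻¹ * t) * ‖(γ 0).1‖ ^ 2 := by
  have hθ0 : 0 ≤ θ := (norm_nonneg _).trans (hp.norm_sub 0)
  have hθ1 : θ ≤ 1 := hp.theta_le
  have hδ0 := hF.delta_nonneg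
  have hA0 : 0 < A := by linarith
  -- In the cone `p + q ≤ 5 q`, so coercivity gives `‖w‖² ≤ A (5 q + 2 θ ‖w‖²)`, and `20 A θ ≤ 1`
  -- absorbs the last term.
  have hcone : ∀ σ w, p σ w w ≤ 4 * q σ w w → ‖w‖ ^ 2 ≤ 10 * A * q σ w w := by
    intro σ w h
    have h1 := (abs_le.mp (hp.abs_sub_le σ w)).1
    have h2 := (abs_le.mp (hq.abs_sub_le σ w)).1
    have h3 := hcoer w
    have h4 : A * (p₀ w w + q₀ w w) ≤ A * (5 * q σ w w + 2 * (θ * ‖w‖ ^ 2)) :=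
      mul_le_mul_of_nonneg_left (by linarith) hA0.le
    have h5 := mul_le_mul_of_nonneg_right hθ (sq_nonneg ‖w‖)
    nlinarith
  have hqle : ∀ σ w, q σ w w ≤ (A + 1) * ‖w‖ ^ 2 := by
    intro σ w
    have h1 := (abs_le.mp (hq.abs_sub_le σ w)).2
    have h2 := (abs_le.mp (abs_bilin_le hqA (le_refl ‖w‖) (le_refl ‖w‖))).2
    nlinarith [sq_nonneg ‖w‖]
  set e : ℝ := 2 * (‖L‖ + 1) * θ + (2 * A + M) * δ with he
  have hM0 : 0 ≤ M := (norm_nonneg (fderiv ℝ p 0)).trans (hp.norm_fderiv 0)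
  have he0 : 0 ≤ e := by positivity
  have hbd : ∀ {b₀ : W →L[ℝ] W →L[ℝ] ℝ} (w : W), ‖b₀‖ ≤ A →
      (2 * (‖L‖ + 1) * θ + (2 * ‖b₀‖ + M) * δ) * ‖w‖ ^ 2 ≤ e * ‖w‖ ^ 2 := by
    intro b₀ w h
    rw [he]; gcongr
  have hP := fun s (hs : s ∈ Icc 0 t) => hF.hasDerivAt_form hp (hγ s hs)
  have hQ := fun s (hs : s ∈ Icc 0 t) => hF.hasDerivAt_form hq (hγ s hs)
  choose! P' hP1 hP2 using hP
  choose! Q' hQ1 hQ2 using hQ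
  have key := le_exp_mul_of_cone (c := (40 * A ^ 2 * (A + 1))⁻¹) ht hP1 hQ1 ?_ ?_ hend
  · have h1 := hcone _ _ hend
    have h2 := hqle (γ 0).2 (γ 0).1
    calc _ ≤ _ := h1
      _ ≤ 10 * A * (Real.exp (-(40 * A ^ 2 * (A + 1))⁻¹ * t) * ((A + 1) * ‖(γ 0).1‖ ^ 2)) := by
          gcongr
          exact key.trans (by gcongr)
      _ = _ := by ring
  -- `P' - 4 Q' ≥ eP + 4 eQ - 5 e ‖w‖² ≥ (1 - 5 e) ‖w‖² ≥ 0`.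
  · intro s hs
    have h1 := (abs_le.mp ((hP2 s hs).trans (hbd _ hpA))).1
    have h2 := (abs_le.mp ((hQ2 s hs).trans (hbd _ hqA))).2
    rw [hpL] at h1
    rw [hqL] at h2
    have h3 : 5 * e ≤ 1 := by nlinarith [mul_nonneg he0 (sq_nonneg A)]
    have h4 := mul_le_mul_of_nonneg_right h3 (sq_nonneg ‖(γ s).1‖)
    have := heQ (γ s).1
    have := hn (γ s).1
    linarith
  -- In the cone `‖w‖² ≤ 20 A² eQ`, and the error `e ‖w‖²` is at most `‖w‖² / (40 A²)`, half of the
  -- gain. Thus `Q' ≤ -‖w‖² / (40 A²)`, and `q ≤ (A + 1) ‖w‖²` gives the rate.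
  · intro s hs hc
    have h1 := hcone _ _ hc
    have h2 := (abs_le.mp ((hQ2 s hs).trans (hbd _ hqA))).2
    rw [hqL] at h2
    have h3 := (abs_le.mp (hq.abs_sub_le (γ s).2 (γ s).1)).2
    have h4 := hqe (γ s).1
    have h5 := hqle (γ s).2 (γ s).1
    set n2 := ‖(γ s).1‖ ^ 2 with hn2
    have hn0 : 0 ≤ n2 := sq_nonneg _
    have h6 : n2 ≤ 20 * A ^ 2 * eQ (γ s).1 := by
      have h7 : 10 * A * q (γ s).2 (γ s).1 (γ s).1 ≤ 10 * A * (A * eQ (γ s).1 + θ * n2) := by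
        gcongr; linarith
      have h8 := mul_le_mul_of_nonneg_right hθ hn0
      nlinarith
    have h9 : e * n2 * (40 * A ^ 2) ≤ n2 := by
      have := mul_le_mul_of_nonneg_right hsmall hn0
      linarith
    have h10 : Q' s * (40 * A ^ 2) ≤ -n2 := by
      have h11 : Q' s ≤ -eQ (γ s).1 + e * n2 := by linarith
      have h12 := mul_le_mul_of_nonneg_right h11 (by positivity : 0 ≤ 40 * A ^ 2)
      linarith
    have h13 : 0 < 40 * A ^ 2 * (A + 1) := by positivity
    rw [neg_mul, inv_mul_eq_div, ← neg_div, le_div_iff₀ h13]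
    nlinarith
end Cone

/-! ### The normal form and the Lyapunov forms -/

section NormalForm

set_option maxSynthPendingDepth 3

open Set Metric
open scoped Topology

variable {ℓ m k : ℕ}

/-- The real parts of the eigenvalues of the normal form. -/
def expansionRate (a : Fin ℓ → ℝ) (c : Fin m → ℝ) : HypIndex ℓ m → ℝ := Sum.elim a fun ij => c ij.2

theorem expansionRate_pos {a : Fin ℓ → ℝ} {c : Fin m → ℝ} (ha : ∀ j, 0 < a j) (hc : ∀ j, 0 < c j)
    (i : HypIndex ℓ m) : 0 < expansionRate a c i := by
  rcases i with i | i
  · exact ha i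
  · exact hc i.2

theorem lyapunovMatrix_eq (a : Fin ℓ → ℝ) (c : Fin m → ℝ) :
    lyapunovMatrix a c = Matrix.diagonal fun i => (2 * expansionRate a c i)⁻¹ := by
  unfold lyapunovMatrix
  congr 1
  ext i
  rcases i with i | i <;> rfl

theorem adaptedNormSq_eq (a : Fin ℓ → ℝ) (c : Fin m → ℝ) (x : HypIndex ℓ m → ℝ) :
    adaptedNormSq a c x = ∑ i, (2 * expansionRate a c i)⁻¹ * (x i * x i) := by
  simp only [adaptedNormSq, lyapunovMatrix_eq, dotProduct, Matrix.mulVec_diagonal, mul_assoc]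

theorem normalMatrix_apply_self (a : Fin ℓ → ℝ) (c d : Fin m → ℝ) (i : HypIndex ℓ m) :
    normalMatrix a c d i i = expansionRate a c i := by
  rcases i with i | ⟨i, j⟩
  · simp [normalMatrix, expansionRate]
  · fin_cases i <;> simp [normalMatrix, expansionRate]

/-- Transposition stays within the normal forms, so the identities for `x'` apply to `ξ'` with `d`
replaced by `-d`. -/
theorem normalMatrix_transpose (a : Fin ℓ → ℝ) (c d : Fin m → ℝ) :
    (normalMatrix a c d)ᵀ = normalMatrix a c (-d) := by
  ext i j
  rcases i with i | ⟨i, i'⟩ <;> rcases j with j | ⟨j, j'⟩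
  · by_cases h : i = j
    · subst h; simp [normalMatrix]
    · have h' : ¬ j = i := fun e => h e.symm
      simp [normalMatrix, h, h']
  · simp [normalMatrix]
  · simp [normalMatrix]
  · by_cases h : i' = j'
    · subst h
      fin_cases i <;> fin_cases j <;> simp [normalMatrix]
    · have h' : ¬ j' = i' := fun e => h e.symm
      simp [normalMatrix, Matrix.blockDiagonal_apply, h, h']

theorem normalMatrix_add_transpose (a : Fin ℓ → ℝ) (c d : Fin m → ℝ) :
    normalMatrix a c d + (normalMatrix a c d)ᵀ = Matrix.diagonal fun i => 2 * expansionRate a c i := by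
  ext i j
  rcases i with i | ⟨i, i'⟩ <;> rcases j with j | ⟨j, j'⟩
  · by_cases h : i = j
    · subst h; simp [normalMatrix, expansionRate]; ring
    · have h' : ¬ j = i := fun e => h e.symm
      simp [normalMatrix, h, h']
  · simp [normalMatrix]
  · simp [normalMatrix]
  · by_cases h : i' = j'
    · subst h
      fin_cases i <;> fin_cases j <;> simp [normalMatrix, expansionRate] <;> ring
    · have h' : ¬ j' = i' := fun e => h e.symm
      simp [normalMatrix, Matrix.blockDiagonal_apply, h, h']

theorem mulVec_dotProduct_eq {n : Type*} [Fintype n] (A : Matrix n n ℝ) (x y : n → ℝ) :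
    (A *ᵥ x) ⬝ᵥ y = (Aᵀ *ᵥ y) ⬝ᵥ x := by
  rw [dotProduct_comm, Matrix.dotProduct_mulVec, ← Matrix.mulVec_transpose]

theorem normalMatrix_quadratic (a : Fin ℓ → ℝ) (c d : Fin m → ℝ) (x : HypIndex ℓ m → ℝ) :
    2 * ((normalMatrix a c d *ᵥ x) ⬝ᵥ x) = ∑ i, 2 * expansionRate a c i * (x i * x i) := by
  have h1 : 2 * ((normalMatrix a c d *ᵥ x) ⬝ᵥ x) =
      ((normalMatrix a c d + (normalMatrix a c d)ᵀ) *ᵥ x) ⬝ᵥ x := by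
    rw [Matrix.add_mulVec, add_dotProduct, ← mulVec_dotProduct_eq, two_mul]
  rw [h1, normalMatrix_add_transpose]
  simp only [dotProduct, Matrix.mulVec_diagonal, mul_assoc]

theorem lyapunov_dotProduct {a : Fin ℓ → ℝ} {c : Fin m → ℝ} (d : Fin m → ℝ) (ha : ∀ j, 0 < a j)
    (hc : ∀ j, 0 < c j) (x y : HypIndex ℓ m → ℝ) :
    (lyapunovMatrix a c *ᵥ (normalMatrix a c d *ᵥ x)) ⬝ᵥ y +
      (lyapunovMatrix a c *ᵥ x) ⬝ᵥ (normalMatrix a c d *ᵥ y) = x ⬝ᵥ y := by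
  have h := lyapunovMatrix_spec a c d ha hc
  rw [dotProduct_comm (lyapunovMatrix a c *ᵥ x), mulVec_dotProduct_eq (normalMatrix a c d) y,
    Matrix.mulVec_mulVec, Matrix.mulVec_mulVec, ← add_dotProduct, ← Matrix.add_mulVec, add_comm, h,
    Matrix.one_mulVec]

/-- The diagonal bilinear form with weights `β` in the functionals `f i`. -/
noncomputable def diagForm {ι W : Type} [Fintype ι] [NormedAddCommGroup W] [NormedSpace ℝ W]
    (f : ι → W →L[ℝ] ℝ) (β : ι → ℝ) : W →L[ℝ] W →L[ℝ] ℝ :=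
  ∑ i, β i • (ContinuousLinearMap.mul ℝ ℝ).bilinearComp (f i) (f i)

theorem diagForm_apply {ι W : Type} [Fintype ι] [NormedAddCommGroup W] [NormedSpace ℝ W]
    (f : ι → W →L[ℝ] ℝ) (β : ι → ℝ) (w v : W) : diagForm f β w v = ∑ i, β i * (f i w * f i v) := by
  simp [diagForm, ContinuousLinearMap.bilinearComp_apply]

/-- The position coordinates. -/
noncomputable def posCoord (J : Type) [Fintype J] (i : J) : SymplSpace J →L[ℝ] ℝ :=
  (ContinuousLinearMap.proj i).comp (ContinuousLinearMap.fst ℝ (J → ℝ) (J → ℝ))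

/-- The momentum coordinates. -/
noncomputable def momCoord (J : Type) [Fintype J] (i : J) : SymplSpace J →L[ℝ] ℝ :=
  (ContinuousLinearMap.proj i).comp (ContinuousLinearMap.snd ℝ (J → ℝ) (J → ℝ))

/-- The form `⟨B₀ x, x⟩`. -/
noncomputable def posForm (a : Fin ℓ → ℝ) (c : Fin m → ℝ) :
    SymplSpace (HypIndex ℓ m) →L[ℝ] SymplSpace (HypIndex ℓ m) →L[ℝ] ℝ :=
  diagForm (posCoord _) fun i => (2 * expansionRate a c i)⁻¹

/-- The form `⟨B₀ ξ, ξ⟩`. -/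
noncomputable def momForm (a : Fin ℓ → ℝ) (c : Fin m → ℝ) :
    SymplSpace (HypIndex ℓ m) →L[ℝ] SymplSpace (HypIndex ℓ m) →L[ℝ] ℝ :=
  diagForm (momCoord _) fun i => (2 * expansionRate a c i)⁻¹

theorem posForm_apply (a : Fin ℓ → ℝ) (c : Fin m → ℝ) (w v : SymplSpace (HypIndex ℓ m)) :
    posForm a c w v = (lyapunovMatrix a c *ᵥ w.1) ⬝ᵥ v.1 := by
  simp [posForm, diagForm_apply, posCoord, lyapunovMatrix_eq, dotProduct, Matrix.mulVec_diagonal,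
    mul_assoc]

theorem momForm_apply (a : Fin ℓ → ℝ) (c : Fin m → ℝ) (w v : SymplSpace (HypIndex ℓ m)) :
    momForm a c w v = (lyapunovMatrix a c *ᵥ w.2) ⬝ᵥ v.2 := by
  simp [momForm, diagForm_apply, momCoord, lyapunovMatrix_eq, dotProduct, Matrix.mulVec_diagonal,
    mul_assoc]

/-- The linear Hamilton field of `⟨A₀ x, ξ⟩`. -/
noncomputable def linearField (a : Fin ℓ → ℝ) (c d : Fin m → ℝ) :
    SymplSpace (HypIndex ℓ m) →L[ℝ] SymplSpace (HypIndex ℓ m) :=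
  LinearMap.toContinuousLinearMap
    ((normalMatrix a c d).mulVecLin.prodMap (-(normalMatrix a c d)ᵀ.mulVecLin))

theorem linearField_apply (a : Fin ℓ → ℝ) (c d : Fin m → ℝ) (w : SymplSpace (HypIndex ℓ m)) :
    linearField a c d w = (normalMatrix a c d *ᵥ w.1, -((normalMatrix a c d)ᵀ *ᵥ w.2)) := rfl

theorem posForm_linearField {a : Fin ℓ → ℝ} {c : Fin m → ℝ} (d : Fin m → ℝ) (ha : ∀ j, 0 < a j)
    (hc : ∀ j, 0 < c j) (w v : SymplSpace (HypIndex ℓ m)) :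
    posForm a c (linearField a c d w) v + posForm a c w (linearField a c d v) = w.1 ⬝ᵥ v.1 := by
  simp only [posForm_apply, linearField_apply]
  exact lyapunov_dotProduct d ha hc _ _

theorem momForm_linearField {a : Fin ℓ → ℝ} {c : Fin m → ℝ} (d : Fin m → ℝ) (ha : ∀ j, 0 < a j)
    (hc : ∀ j, 0 < c j) (w v : SymplSpace (HypIndex ℓ m)) :
    momForm a c (linearField a c d w) v + momForm a c w (linearField a c d v) =
      -(w.2 ⬝ᵥ v.2) := by
  simp only [momForm_apply, linearField_apply, Matrix.mulVec_neg, neg_dotProduct, dotProduct_neg,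
    normalMatrix_transpose]
  rw [← neg_add, lyapunov_dotProduct (-d) ha hc]

theorem sq_norm_le_dotProduct {J : Type} [Fintype J] (x : J → ℝ) : ‖x‖ ^ 2 ≤ x ⬝ᵥ x := by
  have h0 : 0 ≤ x ⬝ᵥ x := by
    simp only [dotProduct]
    exact Finset.sum_nonneg fun i _ => mul_self_nonneg _
  refine (Real.le_sqrt (norm_nonneg _) h0).mp ?_
  refine (pi_norm_le_iff_of_nonneg (Real.sqrt_nonneg _)).mpr fun i => ?_
  rw [Real.norm_eq_abs]
  refine Real.abs_le_sqrt ?_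
  rw [pow_two]
  exact Finset.single_le_sum (f := fun i => x i * x i) (fun i _ => mul_self_nonneg _)
    (Finset.mem_univ i)

theorem sq_norm_le_add_dotProduct {J : Type} [Fintype J] (w : SymplSpace J) :
    ‖w‖ ^ 2 ≤ w.1 ⬝ᵥ w.1 + w.2 ⬝ᵥ w.2 := by
  have h1 := sq_norm_le_dotProduct w.1
  have h2 := sq_norm_le_dotProduct w.2
  rcases max_choice ‖w.1‖ ‖w.2‖ with h | h
  · rw [Prod.norm_def, h]; nlinarith [sq_nonneg ‖w.2‖]
  · rw [Prod.norm_def, h]; nlinarith [sq_nonneg ‖w.1‖]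

/-- Constants of coercivity of the adapted norms. -/
theorem exists_coercivity {a : Fin ℓ → ℝ} {c : Fin m → ℝ} (d : Fin m → ℝ) (ha : ∀ j, 0 < a j)
    (hc : ∀ j, 0 < c j) :
    ∃ A c₀ : ℝ, 1 ≤ A ∧ 0 < c₀ ∧ ‖posForm a c‖ ≤ A ∧ ‖momForm a c‖ ≤ A ∧
      (∀ w, ‖w‖ ^ 2 ≤ A * (posForm a c w w + momForm a c w w)) ∧
      (∀ w, posForm a c w w ≤ A * (w.1 ⬝ᵥ w.1)) ∧ (∀ w, momForm a c w w ≤ A * (w.2 ⬝ᵥ w.2)) ∧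
      ∀ w, c₀ * ‖w‖ ^ 2 ≤
        (posForm a c + momForm a c) (linearField a c d (linearField a c d w)) w +
        2 * (posForm a c + momForm a c) (linearField a c d w) (linearField a c d w) +
        (posForm a c + momForm a c) w (linearField a c d (linearField a c d w)) := by
  set re := expansionRate a c with hre
  have hpos : ∀ i, 0 < re i := expansionRate_pos ha hc
  have hs1 : 0 ≤ ∑ i, 2 * re i := Finset.sum_nonneg fun i _ => by have := hpos i; positivity
  have hs2 : 0 ≤ ∑ i, (2 * re i)⁻¹ := Finset.sum_nonneg fun i _ => by have := hpos i; positivity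
  -- A single constant dominates the numbers `2 Re λ`, their inverses and both norms; `A⁻¹` then
  -- bounds `2 Re λ` from below and serves as `c₀`.
  set A : ℝ := 1 + ∑ i, 2 * re i + ∑ i, (2 * re i)⁻¹ + ‖posForm a c‖ + ‖momForm a c‖ with hA
  have hn1 := norm_nonneg (posForm a c)
  have hn2 := norm_nonneg (momForm a c)
  have hA1 : 1 ≤ A := by linarith
  have hA0 : 0 < A := by linarith
  have hle1 : ∀ i, 2 * re i ≤ A := fun i => by
    have := Finset.single_le_sum (f := fun i => 2 * re i)
      (fun i _ => by have := hpos i; positivity) (Finset.mem_univ i)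
    linarith
  have hle2 : ∀ i, (2 * re i)⁻¹ ≤ A := fun i => by
    have := Finset.single_le_sum (f := fun i => (2 * re i)⁻¹)
      (fun i _ => by have := hpos i; positivity) (Finset.mem_univ i)
    linarith
  have hge1 : ∀ i, A⁻¹ ≤ 2 * re i := fun i => by
    have := hpos i
    exact inv_le_of_inv_le₀ (by positivity) (hle2 i)
  have hge2 : ∀ i, 1 ≤ A * (2 * re i)⁻¹ := fun i => by
    have := hpos i
    rw [← div_eq_mul_inv, le_div_iff₀ (by positivity), one_mul]
    exact hle1 i
  have hform : ∀ x : HypIndex ℓ m → ℝ, (lyapunovMatrix a c *ᵥ x) ⬝ᵥ x =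
      ∑ i, (2 * re i)⁻¹ * (x i * x i) := fun x => adaptedNormSq_eq a c x
  have hlow : ∀ x : HypIndex ℓ m → ℝ, x ⬝ᵥ x ≤ A * ((lyapunovMatrix a c *ᵥ x) ⬝ᵥ x) := fun x => by
    rw [hform, Finset.mul_sum]
    refine Finset.sum_le_sum fun i _ => ?_
    rw [← mul_assoc]
    exact le_mul_of_one_le_left (mul_self_nonneg _) (hge2 i)
  have hup : ∀ x : HypIndex ℓ m → ℝ, (lyapunovMatrix a c *ᵥ x) ⬝ᵥ x ≤ A * (x ⬝ᵥ x) := fun x => by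
    rw [hform, dotProduct, Finset.mul_sum]
    exact Finset.sum_le_sum fun i _ => mul_le_mul_of_nonneg_right (hle2 i) (mul_self_nonneg _)
  have hquad : ∀ (d : Fin m → ℝ) (x : HypIndex ℓ m → ℝ),
      A⁻¹ * (x ⬝ᵥ x) ≤ 2 * ((normalMatrix a c d *ᵥ x) ⬝ᵥ x) := fun d x => by
    rw [normalMatrix_quadratic, dotProduct, Finset.mul_sum]
    exact Finset.sum_le_sum fun i _ => mul_le_mul_of_nonneg_right (hge1 i) (mul_self_nonneg _)
  refine ⟨A, A⁻¹, hA1, by positivity, by linarith, by linarith, fun w => ?_, fun w => ?_,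
    fun w => ?_, fun w => ?_⟩
  · rw [posForm_apply, momForm_apply, mul_add]
    exact (sq_norm_le_add_dotProduct w).trans (add_le_add (hlow _) (hlow _))
  · rw [posForm_apply]; exact hup _
  · rw [momForm_apply]; exact hup _
  -- The polarized Lyapunov identities at `(L w, w)` and `(w, L w)` add up to `2⟨A₀ x', x'⟩ + 2⟨A₀ᵀ
  -- ξ', ξ'⟩`, in which the rotation parts `d` cancel.
  · set L := linearField a c d
    have h1 := posForm_linearField d ha hc (L w) w
    have h2 := posForm_linearField d ha hc w (L w)
    have h3 := momForm_linearField d ha hc (L w) w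
    have h4 := momForm_linearField d ha hc w (L w)
    have h5 : (L w).1 ⬝ᵥ w.1 = (normalMatrix a c d *ᵥ w.1) ⬝ᵥ w.1 := rfl
    have h6 : (L w).2 ⬝ᵥ w.2 = -((normalMatrix a c (-d) *ᵥ w.2) ⬝ᵥ w.2) := by
      rw [← normalMatrix_transpose, ← neg_dotProduct]; rfl
    have h7 := hquad d w.1
    have h8 := hquad (-d) w.2
    have h9 := mul_le_mul_of_nonneg_left (sq_norm_le_add_dotProduct w) (inv_pos.mpr hA0).le
    rw [dotProduct_comm w.1] at h2
    rw [dotProduct_comm w.2] at h4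
    simp only [add_apply]
    linarith

end NormalForm

/-! ### Extensions and cut-offs with small derivatives -/

section Cutoff

set_option maxSynthPendingDepth 3

open Set Metric
open scoped Topology

/-- A smooth function on an open set agrees near a given point with a function which is smooth on
the whole space, close to a constant, and has bounded derivatives. -/
theorem exists_contDiff_extension {S B : Type} [NormedAddCommGroup S] [NormedSpace ℝ S]
    [FiniteDimensional ℝ S] [NormedAddCommGroup B] [NormedSpace ℝ B] {V : Set S} (hV : IsOpen V)
    {h : S → B} (hh : ContDiffOn ℝ ∞ h V) {σ₀ : S} (hσ₀ : σ₀ ∈ V) {θ : ℝ} (hθ : 0 < θ) :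
    ∃ (η M : ℝ) (H : S → B), 0 < η ∧ ball σ₀ η ⊆ V ∧ ContDiff ℝ ∞ H ∧
      (∀ σ ∈ ball σ₀ η, H σ = h σ) ∧ (∀ σ, ‖H σ - h σ₀‖ ≤ θ) ∧ (∀ σ, ‖fderiv ℝ H σ‖ ≤ M) ∧
      ∀ σ, ‖fderiv ℝ (fderiv ℝ H) σ‖ ≤ M := by
  have hnhds : V ∩ h ⁻¹' ball (h σ₀) θ ∈ 𝓝 σ₀ :=
    Filter.inter_mem (hV.mem_nhds hσ₀)
      ((hh.continuousOn.continuousAt (hV.mem_nhds hσ₀)).preimage_mem_nhds (ball_mem_nhds _ hθ))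
  obtain ⟨η, hη, hsub⟩ := Metric.nhds_basis_closedBall.mem_iff.mp hnhds
  let ψ : ContDiffBump σ₀ := ⟨η / 2, η, by positivity, by linarith⟩
  have hts : tsupport ψ = closedBall σ₀ η := ψ.tsupport_eq
  -- Cutting off the difference from `h σ₀` keeps `H` within `θ` of that value everywhere, since `0
  -- ≤ ψ ≤ 1`.
  set H : S → B := fun σ => ψ σ • (h σ - h σ₀) + h σ₀ with hH
  have hc : HasCompactSupport (fun σ => ψ σ • (h σ - h σ₀)) := ψ.hasCompactSupport.smul_right
  have hsm0 : ContDiff ℝ ∞ (fun σ => ψ σ • (h σ - h σ₀)) := by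
    rw [contDiff_iff_contDiffAt]
    intro σ
    by_cases hσ : σ ∈ tsupport ψ
    · have hσV : σ ∈ V := (hsub (hts ▸ hσ)).1
      exact ψ.contDiff.contDiffAt.smul ((hh.contDiffAt (hV.mem_nhds hσV)).sub contDiffAt_const)
    · have h0 : (fun σ => ψ σ • (h σ - h σ₀)) =ᶠ[𝓝 σ] fun _ => 0 := by
        filter_upwards [(isClosed_tsupport ψ).isOpen_compl.mem_nhds hσ] with τ hτ
        rw [image_eq_zero_of_notMem_tsupport hτ, zero_smul]
      exact contDiffAt_const.congr_of_eventuallyEq h0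
  have hsm : ContDiff ℝ ∞ H := hsm0.add contDiff_const
  have hd1 : fderiv ℝ H = fderiv ℝ (fun σ => ψ σ • (h σ - h σ₀)) := by
    ext1 σ; exact fderiv_add_const _
  obtain ⟨M₁, hM₁⟩ := (hsm0.continuous_fderiv (by simp)).bounded_above_of_compact_support
    (hc.fderiv ℝ)
  have hsm1 : ContDiff ℝ ∞ (fderiv ℝ (fun σ => ψ σ • (h σ - h σ₀))) := hsm0.fderiv_right (by simp)
  obtain ⟨M₂, hM₂⟩ := (hsm1.continuous_fderiv (by simp)).bounded_above_of_compact_support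
    ((hc.fderiv ℝ).fderiv ℝ)
  refine ⟨η / 2, max M₁ M₂, H, by positivity, fun σ hσ => ?_, hsm, fun σ hσ => ?_, fun σ => ?_,
    fun σ => ?_, fun σ => ?_⟩
  · exact (hsub (ball_subset_closedBall (ball_subset_ball (by linarith) hσ))).1
  · have : ψ σ = 1 := ψ.one_of_mem_closedBall (ball_subset_closedBall hσ)
    simp [hH, this]
  · rw [hH, add_sub_cancel_right, norm_smul, Real.norm_eq_abs, abs_of_nonneg ψ.nonneg]
    by_cases hσ : σ ∈ tsupport ψ
    · have h1 : ‖h σ - h σ₀‖ ≤ θ := by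
        have := (hsub (hts ▸ hσ)).2
        rw [mem_preimage, mem_ball, dist_eq_norm] at this
        exact this.le
      calc _ ≤ 1 * ‖h σ - h σ₀‖ := by gcongr; exact ψ.le_one
        _ ≤ θ := by rwa [one_mul]
    · rw [image_eq_zero_of_notMem_tsupport hσ, zero_mul]; exact hθ.le
  · rw [hd1]; exact (hM₁ σ).trans (le_max_left _ _)
  · rw [hd1]; exact (hM₂ σ).trans (le_max_right _ _)

variable {E : Type} [NormedAddCommGroup E] [NormedSpace ℝ E]

theorem natCast_lt_infty (j : ℕ) : (j : ℕ∞ω) < ∞ := by exact_mod_cast ENat.natCast_lt_top j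

/-- Taylor's estimate by descending induction on the order: each integration from `ρ₀`, where the
lower derivatives vanish, gains a factor `s`. -/
theorem norm_iteratedFDeriv_le_of_jet_eq_zero {P : E → ℝ} (hP : ContDiff ℝ ∞ P) {ρ₀ : E} {n : ℕ}
    (h0 : ∀ j < n, iteratedFDeriv ℝ j P ρ₀ = 0) {C s : ℝ}
    (hC : ∀ ρ ∈ closedBall ρ₀ s, ‖iteratedFDeriv ℝ n P ρ‖ ≤ C) (i : ℕ) (hi : i ≤ n) :
    ∀ ρ ∈ closedBall ρ₀ s, ‖iteratedFDeriv ℝ (n - i) P ρ‖ ≤ C * s ^ i := by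
  induction i with
  | zero => simpa using hC
  | succ i ih =>
    intro ρ hρ
    have hs : 0 ≤ s := dist_nonneg.trans hρ
    have hd : Differentiable ℝ (iteratedFDeriv ℝ (n - (i + 1)) P) :=
      hP.differentiable_iteratedFDeriv (natCast_lt_infty _)
    have key := (convex_closedBall ρ₀ s).norm_image_sub_le_of_norm_fderiv_le
      (f := iteratedFDeriv ℝ (n - (i + 1)) P) (C := C * s ^ i) (fun x _ => hd x)
      (fun x hx => by
        rw [norm_fderiv_iteratedFDeriv, show n - (i + 1) + 1 = n - i by omega]
        exact ih (by omega) x hx)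
      (mem_closedBall_self hs) hρ
    rw [h0 _ (by omega), sub_zero] at key
    refine key.trans ?_
    have h1 : ‖ρ - ρ₀‖ ≤ s := by rwa [← dist_eq_norm]
    have h2 : 0 ≤ C * s ^ i :=
      (norm_nonneg _).trans (ih (by omega) ρ₀ (mem_closedBall_self hs))
    rw [pow_succ, ← mul_assoc]
    gcongr

/-- A function with vanishing `2`-jet at a point can be cut off near this point, with small second
derivatives. -/
theorem exists_cutoff_small [FiniteDimensional ℝ E] {P : E → ℝ} (hP : ContDiff ℝ ∞ P) {ρ₀ : E}
    (h0 : ∀ j < 3, iteratedFDeriv ℝ j P ρ₀ = 0) {δ r : ℝ} (hδ : 0 < δ) (hr : 0 < r) :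
    ∃ (η : ℝ) (ψ : E → ℝ), 0 < η ∧ η ≤ r ∧ ContDiff ℝ ∞ ψ ∧ (∀ ρ ∈ closedBall ρ₀ η, ψ ρ = 1) ∧
      tsupport ψ ⊆ closedBall ρ₀ (2 * η) ∧
      ∀ ρ, ‖iteratedFDeriv ℝ 2 (fun x => ψ x * P x) ρ‖ ≤ δ := by
  let χ : ContDiffBump (0 : E) := ⟨1, 2, one_pos, one_lt_two⟩
  have hχ : ∀ i : ℕ, ∃ B, 0 ≤ B ∧ ∀ x, ‖iteratedFDeriv ℝ i χ x‖ ≤ B := fun i => by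
    obtain ⟨B, hB⟩ := (χ.contDiff.continuous_iteratedFDeriv (m := i) (n := ∞)
      (by exact_mod_cast le_top)).bounded_above_of_compact_support (χ.hasCompactSupport.iteratedFDeriv i)
    exact ⟨B, (norm_nonneg _).trans (hB 0), hB⟩
  choose B hB0 hB using hχ
  have : ProperSpace E := FiniteDimensional.proper_real E
  obtain ⟨C', hC'⟩ := (isCompact_closedBall ρ₀ (2 : ℝ)).exists_bound_of_continuousOn
    (hP.continuous_iteratedFDeriv (m := (3 : ℕ)) (natCast_lt_infty 3).le).continuousOn
  set C : ℝ := max C' 0 with hCdef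
  have hC0 : 0 ≤ C := le_max_right _ _
  -- In the Leibniz formula, `i` derivatives on the cut-off cost `η⁻¹ ^ i`, while the derivative of
  -- order `2 - i` of `P` is at most `C (2 η) ^ (i + 1)`. Every product is `O(η)`, and `Z` collects
  -- the constants.
  set Z : ℝ := ∑ i ∈ Finset.range 3, ((2 : ℕ).choose i : ℝ) * B i * (C * 2 ^ (i + 1)) with hZ
  have hZ0 : 0 ≤ Z := Finset.sum_nonneg fun i _ => by have := hB0 i; positivity
  set η : ℝ := min (min 1 r) (δ / (Z + 1)) with hη
  have hη0 : 0 < η := by positivity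
  have hη1 : η ≤ 1 := (min_le_left _ _).trans (min_le_left _ _)
  have hηr : η ≤ r := (min_le_left _ _).trans (min_le_right _ _)
  have hηδ : Z * η ≤ δ := by
    have h1 : η ≤ δ / (Z + 1) := min_le_right _ _
    rw [le_div_iff₀ (by positivity)] at h1
    nlinarith
  set ψ : E → ℝ := fun x => χ (η⁻¹ • (x - ρ₀)) with hψ
  have hψs : ContDiff ℝ ∞ ψ := χ.contDiff.comp ((contDiff_id.sub contDiff_const).const_smul _)
  have hψd : ∀ i x, ‖iteratedFDeriv ℝ i ψ x‖ ≤ η⁻¹ ^ i * B i := by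
    intro i x
    have h1 := iteratedFDeriv_comp_sub (𝕜 := ℝ) (f := fun z => χ (η⁻¹ • z)) i ρ₀ x
    have h2 := congrFun (iteratedFDeriv_comp_const_smul (𝕜 := ℝ) (f := χ) (i := i) η⁻¹
      (χ.contDiff (n := (i : ℕ∞)))) (x - ρ₀)
    rw [h2] at h1
    rw [hψ, h1, norm_smul, norm_pow, Real.norm_eq_abs, abs_of_pos (by positivity)]
    gcongr
    exact hB i _
  have hts : tsupport ψ ⊆ closedBall ρ₀ (2 * η) := by
    refine closure_minimal (fun x hx => ?_) isClosed_closedBall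
    by_contra hx'
    refine hx (χ.zero_of_le_dist ?_)
    rw [mem_closedBall, not_le] at hx'
    rw [dist_zero_right, norm_smul, norm_inv, Real.norm_eq_abs, abs_of_pos hη0, ← dist_eq_norm,
      inv_mul_eq_div, le_div_iff₀ hη0]
    exact hx'.le
  refine ⟨η, ψ, hη0, hηr, hψs, fun x hx => ?_, hts, fun x => ?_⟩
  · refine χ.one_of_mem_closedBall ?_
    rw [mem_closedBall, dist_zero_right, norm_smul, norm_inv, Real.norm_eq_abs, abs_of_pos hη0,
      ← dist_eq_norm, inv_mul_eq_div, div_le_one hη0]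
    exact hx
  · by_cases hx : x ∈ closedBall ρ₀ (2 * η)
    · have hle : closedBall ρ₀ (2 * η) ⊆ closedBall ρ₀ 2 := closedBall_subset_closedBall (by linarith)
      have hPd := norm_iteratedFDeriv_le_of_jet_eq_zero hP h0
        (fun ρ hρ => (hC' ρ (hle hρ)).trans (le_max_left C' 0))
      refine (norm_iteratedFDeriv_mul_le hψs hP x (natCast_lt_infty 2).le).trans ?_
      refine le_trans ?_ hηδ
      rw [hZ, Finset.sum_mul]
      refine Finset.sum_le_sum fun i hi => ?_
      have hi' : i ≤ 2 := by simpa [Nat.lt_succ_iff] using hi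
      have h1 := hPd (i + 1) (by omega) x hx
      rw [show 3 - (i + 1) = 2 - i by omega] at h1
      have hB0' := hB0 i
      calc _ ≤ ((2 : ℕ).choose i : ℝ) * (η⁻¹ ^ i * B i) * (C * (2 * η) ^ (i + 1)) := by
            gcongr
            exact hψd i x
        _ = _ := by
            rw [mul_pow, pow_succ η, inv_pow]
            field_simp
    · have : iteratedFDeriv ℝ 2 (fun x => ψ x * P x) x = 0 := by
        by_contra h
        have h1 := support_iteratedFDeriv_subset 2 h
        exact hx (hts (tsupport_mul_subset_left h1))
      rw [this, norm_zero]
      exact hδ.le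

end Cutoff

/-! ### The Hamilton map -/

section HamiltonMap

set_option maxSynthPendingDepth 3

variable {ℓ m k : ℕ}

/-- The linear map which sends `dp` to the Hamilton field of `p`. -/
noncomputable def hamiltonMap (ℓ m k : ℕ) :
    (PhaseSpace ℓ m k →L[ℝ] ℝ) →L[ℝ] PhaseSpace ℓ m k :=
  ((ContinuousLinearMap.pi fun j => ContinuousLinearMap.apply ℝ ℝ ((0, Pi.single j 1), 0)).prod
    (ContinuousLinearMap.pi fun j => -ContinuousLinearMap.apply ℝ ℝ ((Pi.single j 1, 0), 0))).prod
  ((ContinuousLinearMap.pi fun j => ContinuousLinearMap.apply ℝ ℝ (0, (0, Pi.single j 1))).prod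
    (ContinuousLinearMap.pi fun j => -ContinuousLinearMap.apply ℝ ℝ (0, (Pi.single j 1, 0))))

theorem hamiltonField_eq (p : PhaseSpace ℓ m k → ℝ) (ρ : PhaseSpace ℓ m k) :
    hamiltonField p ρ = hamiltonMap ℓ m k (fderiv ℝ p ρ) := rfl

/-- In the sup norms every component is, up to sign, the value of `f` at a unit vector. -/
theorem norm_hamiltonMap_le (f : PhaseSpace ℓ m k →L[ℝ] ℝ) : ‖hamiltonMap ℓ m k f‖ ≤ ‖f‖ := by
  have h : ∀ v : PhaseSpace ℓ m k, ‖v‖ ≤ 1 → ‖f v‖ ≤ ‖f‖ := fun v hv =>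
    (f.le_opNorm v).trans (mul_le_of_le_one_right (norm_nonneg _) hv)
  refine max_le (max_le ?_ ?_) (max_le ?_ ?_) <;>
    refine (pi_norm_le_iff_of_nonneg (norm_nonneg _)).mpr fun j => ?_
  · exact h _ (by simp [Prod.norm_def, Pi.norm_single])
  · change ‖-f _‖ ≤ ‖f‖
    rw [norm_neg]; exact h _ (by simp [Prod.norm_def, Pi.norm_single])
  · exact h _ (by simp [Prod.norm_def, Pi.norm_single])
  · change ‖-f _‖ ≤ ‖f‖
    rw [norm_neg]; exact h _ (by simp [Prod.norm_def, Pi.norm_single])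

theorem norm_hamiltonMap_snd_le {f : PhaseSpace ℓ m k →L[ℝ] ℝ} {C : ℝ} (hC : 0 ≤ C)
    (h : ∀ s, |f (0, s)| ≤ C * ‖s‖) : ‖(hamiltonMap ℓ m k f).2‖ ≤ C := by
  have h' : ∀ s : SymplSpace (Fin k), ‖s‖ ≤ 1 → ‖f (0, s)‖ ≤ C := fun s hs =>
    (h s).trans (mul_le_of_le_one_right hC hs)
  refine max_le ?_ ?_ <;> refine (pi_norm_le_iff_of_nonneg hC).mpr fun j => ?_
  · exact h' _ (by simp [Prod.norm_def, Pi.norm_single])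
  · change ‖-f _‖ ≤ C
    rw [norm_neg]; exact h' _ (by simp [Prod.norm_def, Pi.norm_single])

theorem contDiff_hamiltonField {p : PhaseSpace ℓ m k → ℝ} (hp : ContDiff ℝ ∞ p) :
    ContDiff ℝ ∞ (hamiltonField p) :=
  (hamiltonMap ℓ m k).contDiff.comp (hp.fderiv_right (by simp))

end HamiltonMap

/-! ### The transport equation for flow integrals -/

section TransportEquation

open Set MeasureTheory

/-- By the group law, the integral started at `φ s y` is `∫_s^∞ G (φ t y) dt`; its derivative at `s
= 0` is `-G y`. -/
theorem IsDecayingIntegrand.fderiv_flowIntegral_field {E : Type} [NormedAddCommGroup E]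
    [NormedSpace ℝ E] [FiniteDimensional ℝ E] {F : E → E} {φ : ℝ → E → E} {G : E → ℝ} {U : Set E}
    {d : E → ℝ} {c C : ℝ} (h : IsDecayingIntegrand F φ G U d c C) {y : E} (hy : y ∈ U) :
    fderiv ℝ (flowIntegral φ G 0) y (F y) = -G y := by
  have hcont : Continuous fun t => G (φ t y) := by
    simpa using h.continuous_integrand 0 y
  have hint : IntegrableOn (fun t => G (φ t y)) (Ioi 0) := by
    have := (h.integrableOn 0 hy).mono_set Ioi_subset_Ici_self
    simpa using this
  have hdiff : DifferentiableAt ℝ (flowIntegral φ G 0) (φ 0 y) := by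
    rw [h.flow.zero]
    exact ((h.contDiffOn_flowIntegral 0).contDiffAt (h.isOpen.mem_nhds hy)).differentiableAt
      (by simp)
  have h1 := hdiff.hasFDerivAt.comp_hasDerivAt (0 : ℝ) (h.flow.hasDerivAt y 0)
  rw [h.flow.zero] at h1
  have heq : ∀ s, flowIntegral φ G 0 (φ s y) =
      (∫ t in s..0, G (φ t y)) + ∫ t in Ioi 0, G (φ t y) := by
    intro s
    rw [intervalIntegral.integral_interval_add_Ioi' (hcont.intervalIntegrable _ _) hint,
      ← (measurePreserving_add_right volume s).setIntegral_preimage_emb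
        (measurableEmbedding_addRight s), preimage_add_const_Ioi, sub_self, flowIntegral,
      integral_Ici_eq_integral_Ioi]
    simp only [zero_mul, Real.exp_zero, one_mul,
      h.flow.add (h.contDiff_field.of_le (by exact_mod_cast le_top))]
  have h2 : HasDerivAt (fun s => (∫ t in s..0, G (φ t y)) + ∫ t in Ioi 0, G (φ t y))
      (-G (φ 0 y)) 0 :=
    (intervalIntegral.integral_hasDerivAt_left (hcont.intervalIntegrable _ _)
      (hcont.stronglyMeasurableAtFilter _ _) hcont.continuousAt).add_const _
  rw [h.flow.zero] at h2
  exact h1.unique (h2.congr_of_eventuallyEq (Filter.Eventually.of_forall heq))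

end TransportEquation

/-! ### The Hamilton field of a quadratic form plus a small remainder -/

section Perturbation

set_option maxSynthPendingDepth 3

open Set Metric

variable {ℓ m k : ℕ}

/-- The Hamilton field of a quadratic Hamiltonian plus a cut-off remainder is a small perturbation
of a linear field. -/
theorem exists_isPerturbedLinear {κ q : PhaseSpace ℓ m k → ℝ} (hκ : ContDiff ℝ ∞ κ)
    (hc : HasCompactSupport κ) (h0 : ∀ σ, fderiv ℝ κ (0, σ) = 0) {δ : ℝ} (hδ0 : 0 ≤ δ)
    (hδ1 : δ ≤ 1) (h2 : ∀ ρ, ‖fderiv ℝ (fderiv ℝ κ) ρ‖ ≤ δ) (hs : ∀ ρ ∈ tsupport κ, ‖ρ.1‖ ≤ 1)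
    {L : SymplSpace (HypIndex ℓ m) →L[ℝ] SymplSpace (HypIndex ℓ m)}
    (hq : ∀ ρ, hamiltonField q ρ = (L ρ.1, 0) + hamiltonMap ℓ m k (fderiv ℝ κ ρ)) :
    ∃ K, 0 ≤ K ∧ IsPerturbedLinear L (fun ρ => (hamiltonMap ℓ m k (fderiv ℝ κ ρ)).1)
      (fun ρ => (hamiltonMap ℓ m k (fderiv ℝ κ ρ)).2) (hamiltonField q) δ K := by
  have hκ1 : ContDiff ℝ ∞ (fderiv ℝ κ) := hκ.fderiv_right (by simp)
  have hκ2 : ContDiff ℝ ∞ (fderiv ℝ (fderiv ℝ κ)) := hκ1.fderiv_right (by simp)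
  have hX : ContDiff ℝ ∞ fun ρ => hamiltonMap ℓ m k (fderiv ℝ κ ρ) :=
    (hamiltonMap ℓ m k).contDiff.comp hκ1
  obtain ⟨B, hB⟩ := (hκ2.continuous_fderiv (by simp)).bounded_above_of_compact_support
    (((hc.fderiv ℝ).fderiv ℝ).fderiv ℝ)
  have hB0 : 0 ≤ B := (norm_nonneg _).trans (hB 0)
  have hsub : ∀ ρ : PhaseSpace ℓ m k, ‖ρ - (0, ρ.2)‖ = ‖ρ.1‖ := fun ρ => by
    simp [Prod.norm_def]
  have hD : ∀ ρ, ‖fderiv ℝ κ ρ‖ ≤ δ * ‖ρ.1‖ := fun ρ => by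
    have := (convex_univ (𝕜 := ℝ)).norm_image_sub_le_of_norm_fderiv_le (f := fderiv ℝ κ)
      (fun x _ => hκ1.differentiable (by simp) x) (fun x _ => h2 x) (mem_univ (0, ρ.2))
      (mem_univ ρ)
    rwa [h0, sub_zero, hsub] at this
  have hout : ∀ ρ, ρ ∉ tsupport κ → fderiv ℝ κ ρ = 0 := fun ρ hρ => by
    by_contra h
    exact hρ (support_fderiv_subset ℝ h)
  have hout2 : ∀ ρ, ρ ∉ tsupport κ → fderiv ℝ (fderiv ℝ κ) ρ = 0 := fun ρ hρ => by
    by_contra h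
    exact hρ (tsupport_fderiv_subset ℝ (support_fderiv_subset ℝ h))
  have hXn : ∀ ρ, ‖hamiltonMap ℓ m k (fderiv ℝ κ ρ)‖ ≤ δ * ‖ρ.1‖ := fun ρ =>
    (norm_hamiltonMap_le _).trans (hD ρ)
  have hL0 : 0 ≤ ‖L‖ := norm_nonneg L
  have hF : ∀ ρ, ‖hamiltonField q ρ‖ ≤ (‖L‖ + 1) * ‖ρ.1‖ := fun ρ => by
    rw [hq]
    refine (norm_add_le _ _).trans ?_
    have h1 : ‖((L ρ.1, 0) : PhaseSpace ℓ m k)‖ = ‖L ρ.1‖ := by simp [Prod.norm_def]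
    have h3 := L.le_opNorm ρ.1
    have h4 := hXn ρ
    have h5 := mul_le_mul_of_nonneg_right hδ1 (norm_nonneg ρ.1)
    rw [h1]
    linarith
  have hXd : ∀ ρ, HasFDerivAt (fun ρ => hamiltonMap ℓ m k (fderiv ℝ κ ρ))
      ((hamiltonMap ℓ m k).comp (fderiv ℝ (fderiv ℝ κ) ρ)) ρ := fun ρ =>
    (hamiltonMap ℓ m k).hasFDerivAt.comp ρ (hκ1.differentiable (by simp) ρ).hasFDerivAt
  have hTd : ∀ ρ v, fderiv ℝ (fun ρ => (hamiltonMap ℓ m k (fderiv ℝ κ ρ)).2) ρ v =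
      (hamiltonMap ℓ m k (fderiv ℝ (fderiv ℝ κ) ρ v)).2 := fun ρ v => by
    rw [(hXd ρ).snd.fderiv]; rfl
  refine ⟨B * (‖L‖ + 1), by positivity, fun ρ => ?_, hX.fst, hX.snd, hδ0, hδ1, fun ρ => ?_,
    fun ρ => ?_, fun ρ => ?_, fun ρ => ?_, fun ρ => ?_, fun ρ => ?_⟩
  · rw [hq]; ext <;> simp
  · exact (norm_fst_le _).trans (hXn ρ)
  · exact (norm_snd_le _).trans (hXn ρ)
  · by_cases hρ : ρ ∈ tsupport κ
    · exact (norm_snd_le _).trans ((hXn ρ).trans (mul_le_of_le_one_right hδ0 (hs ρ hρ)))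
    · simpa [hout ρ hρ] using hδ0
  · refine ContinuousLinearMap.opNorm_le_bound _ hδ0 fun v => ?_
    rw [(hXd ρ).fst.fderiv]
    refine (norm_fst_le _).trans ((norm_hamiltonMap_le _).trans ?_)
    exact (ContinuousLinearMap.le_opNorm _ _).trans (by gcongr; exact h2 ρ)
  · rw [hTd]
    by_cases hρ : ρ ∈ tsupport κ
    · refine (norm_snd_le _).trans ((norm_hamiltonMap_le _).trans ?_)
      refine (ContinuousLinearMap.le_opNorm _ _).trans
        (mul_le_mul (h2 ρ) ((hF ρ).trans ?_) (norm_nonneg _) hδ0)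
      exact mul_le_of_le_one_right (by positivity) (hs ρ hρ)
    · rw [hout2 ρ hρ]
      simp only [zero_apply, map_zero, Prod.snd_zero, norm_zero]
      positivity
  · rw [hTd]
    refine norm_hamiltonMap_snd_le (by positivity) fun s => ?_
    have hsymm : IsSymmSndFDerivAt ℝ κ (0, ρ.2) :=
      hκ.contDiffAt.isSymmSndFDerivAt (by simpa using (natCast_lt_infty 2).le)
    -- `dκ` vanishes identically along `{0} × S`, hence so does its derivative in the directions
    -- `(0, s)`. By symmetry this entry of the Hessian at `ρ` is `O(‖w‖)`; paired with the field,
    -- itself `O(‖w‖)`, it gives the quadratic bound with `K = B (‖L‖ + 1)`.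
    have hzero : fderiv ℝ (fderiv ℝ κ) (0, ρ.2) (0, s) = 0 := by
      have h1 : HasFDerivAt (fun σ : SymplSpace (Fin k) => fderiv ℝ κ (0, σ))
          ((fderiv ℝ (fderiv ℝ κ) (0, ρ.2)).comp (ContinuousLinearMap.inr ℝ _ _)) ρ.2 :=
        HasFDerivAt.comp (g := fderiv ℝ κ) ρ.2
          (hκ1.differentiable (by simp) (0, ρ.2)).hasFDerivAt (hasFDerivAt_prodMk_right _ _)
      have h3 := h1.unique ((hasFDerivAt_const 0 ρ.2).congr_of_eventuallyEq
        (Filter.Eventually.of_forall h0))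
      exact congrArg (fun A => A s) h3
    have hlip := (convex_univ (𝕜 := ℝ)).norm_image_sub_le_of_norm_fderiv_le
      (f := fderiv ℝ (fderiv ℝ κ)) (fun x _ => hκ2.differentiable (by simp) x) (fun x _ => hB x)
      (mem_univ (0, ρ.2)) (mem_univ ρ)
    rw [hsub] at hlip
    have h3 : fderiv ℝ (fderiv ℝ κ) ρ (hamiltonField q ρ) (0, s) =
        (fderiv ℝ (fderiv ℝ κ) ρ - fderiv ℝ (fderiv ℝ κ) (0, ρ.2)) (hamiltonField q ρ) (0, s) := by
      rw [sub_apply, sub_apply, hsymm.eq _ (0, s), hzero, zero_apply, sub_zero]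
    rw [h3]
    refine (abs_bilin_le hlip (hF ρ) (y := ((0, s) : PhaseSpace ℓ m k)) (Y := ‖s‖) ?_).trans
      (le_of_eq ?_)
    · simp [Prod.norm_def]
    · ring

end Perturbation

/-! ### The global model near a point of the center manifold -/

section Model

set_option maxSynthPendingDepth 3

open Set Metric
open scoped Topology

theorem hasFDerivAt_quadratic {E : Type} [NormedAddCommGroup E] [NormedSpace ℝ E]
    {H : E →L[ℝ] E →L[ℝ] ℝ} (hH : ∀ u v, H u v = H v u) (y x : E) :
    HasFDerivAt (fun x => 2⁻¹ * H (x - y) (x - y)) (H (x - y)) x := by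
  have h1 : HasFDerivAt (fun x : E => x - y) (ContinuousLinearMap.id ℝ E) x :=
    (hasFDerivAt_id x).sub_const y
  have h2 : HasFDerivAt (fun x : E => H (x - y)) (H.comp (ContinuousLinearMap.id ℝ E)) x :=
    H.hasFDerivAt.comp x h1
  refine ((h2.clm_apply h1).const_mul 2⁻¹).congr_fderiv ?_
  ext v
  simp [hH v]
  ring

variable {ℓ m k : ℕ}

theorem IsHyperbolicAlong.hamiltonMap_hessian {V : Set (SymplSpace (Fin k))}
    {a : SymplSpace (Fin k) → Fin ℓ → ℝ} {c d : SymplSpace (Fin k) → Fin m → ℝ}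
    {p : PhaseSpace ℓ m k → ℝ} (hp : IsHyperbolicAlong V a c d p) {σ : SymplSpace (Fin k)}
    (hσ : σ ∈ V) (u : PhaseSpace ℓ m k) :
    hamiltonMap ℓ m k (fderiv ℝ (fderiv ℝ p) (0, σ) u) =
      (linearField (a σ) (c σ) (d σ) u.1, 0) := by
  have hH := hp.hessian σ hσ u
  refine Prod.ext (Prod.ext ?_ ?_) (Prod.ext ?_ ?_) <;> funext j
  · refine (hH _).trans ?_
    simp [linearField_apply]
  · refine (congrArg Neg.neg (hH _)).trans ?_
    simp only [mulVec_dotProduct_eq (normalMatrix (a σ) (c σ) (d σ)) (Pi.single j 1)]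
    simp [linearField_apply]
  · refine (hH _).trans ?_
    simp
  · refine (congrArg Neg.neg (hH _)).trans ?_
    simp

/-- Near a point of the center manifold, `p` coincides with a Hamiltonian whose Hamilton field is a
small perturbation of the linear field on the whole phase space. -/
theorem IsHyperbolicAlong.exists_model {V : Set (SymplSpace (Fin k))} (hV : IsOpen V)
    {a : SymplSpace (Fin k) → Fin ℓ → ℝ} {c d : SymplSpace (Fin k) → Fin m → ℝ}
    {p : PhaseSpace ℓ m k → ℝ} (hp : IsHyperbolicAlong V a c d p) {σ₀ : SymplSpace (Fin k)}
    (hσ₀ : σ₀ ∈ V) {δ : ℝ} (hδ0 : 0 < δ) (hδ1 : δ ≤ 1) :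
    ∃ (η K : ℝ) (q : PhaseSpace ℓ m k → ℝ) (R : PhaseSpace ℓ m k → SymplSpace (HypIndex ℓ m))
      (T : PhaseSpace ℓ m k → SymplSpace (Fin k)), 0 < η ∧ 0 ≤ K ∧ ContDiff ℝ ∞ q ∧
      (∀ ρ, ‖ρ.1‖ ≤ η → ‖ρ.2 - σ₀‖ ≤ η → q ρ = p ρ) ∧
      IsPerturbedLinear (linearField (a σ₀) (c σ₀) (d σ₀)) R T (hamiltonField q) δ K := by
  set ρ₀ : PhaseSpace ℓ m k := (0, σ₀) with hρ₀
  set H := fderiv ℝ (fderiv ℝ p) ρ₀ with hH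
  have hp1 : ContDiff ℝ ∞ (fderiv ℝ p) := hp.smooth.fderiv_right (by simp)
  have hsymm : ∀ u v, H u v = H v u :=
    hp.smooth.contDiffAt.isSymmSndFDerivAt (by simpa using (natCast_lt_infty 2).le)
  have hquad := hasFDerivAt_quadratic hsymm ρ₀
  have hH0 : ∀ s : SymplSpace (Fin k), H (0, s) = 0 := fun s => by
    refine ContinuousLinearMap.ext fun v => ?_
    rw [hH, hp.hessian σ₀ hσ₀]
    simp
  set Q : PhaseSpace ℓ m k → ℝ := fun ρ => p ρ₀ + 2⁻¹ * H (ρ - ρ₀) (ρ - ρ₀) with hQ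
  have hQd : ∀ ρ, HasFDerivAt Q (H (ρ - ρ₀)) ρ := fun ρ => (hquad ρ).const_add _
  have hQs : ContDiff ℝ ∞ Q := by
    have h1 : ContDiff ℝ ∞ fun ρ : PhaseSpace ℓ m k => ρ - ρ₀ := contDiff_id.sub contDiff_const
    exact contDiff_const.add (contDiff_const.mul ((H.contDiff.comp h1).clm_apply h1))
  set P : PhaseSpace ℓ m k → ℝ := fun ρ => p ρ - Q ρ with hP
  have hPs : ContDiff ℝ ∞ P := hp.smooth.sub hQs
  have hpd : ∀ ρ, HasFDerivAt p (fderiv ℝ p ρ) ρ := fun ρ =>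
    (hp.smooth.differentiable (by simp) ρ).hasFDerivAt
  have hPd : ∀ ρ, HasFDerivAt P (fderiv ℝ p ρ - H (ρ - ρ₀)) ρ := fun ρ => (hpd ρ).sub (hQd ρ)
  have hPd1 : fderiv ℝ P = fun ρ => fderiv ℝ p ρ - H (ρ - ρ₀) := funext fun ρ => (hPd ρ).fderiv
  have hP00 : P ρ₀ = 0 := by simp [hP, hQ]
  have hP1 : ∀ σ ∈ V, fderiv ℝ P (0, σ) = 0 := fun σ hσ => by
    rw [hPd1]
    simp only
    rw [hp.critical σ hσ, hρ₀, Prod.mk_sub_mk, sub_self, hH0, sub_zero]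
  have hP2 : fderiv ℝ (fderiv ℝ P) ρ₀ = 0 := by
    rw [hPd1]
    have h1 : HasFDerivAt (fun ρ => fderiv ℝ p ρ - H (ρ - ρ₀)) (H - H) ρ₀ := by
      refine (hp1.differentiable (by simp) ρ₀).hasFDerivAt.sub ?_
      exact H.hasFDerivAt.comp ρ₀ ((hasFDerivAt_id ρ₀).sub_const ρ₀)
    rw [h1.fderiv, sub_self]
  have hjet : ∀ j < 3, iteratedFDeriv ℝ j P ρ₀ = 0 := by
    intro j hj
    rw [← norm_eq_zero]
    interval_cases j
    · rw [norm_iteratedFDeriv_zero, hP00, norm_zero]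
    · rw [← norm_iteratedFDeriv_fderiv, norm_iteratedFDeriv_zero, hP1 σ₀ hσ₀, norm_zero]
    · rw [← norm_iteratedFDeriv_fderiv, ← norm_iteratedFDeriv_fderiv, norm_iteratedFDeriv_zero,
        hP2, norm_zero]
  obtain ⟨τ, hτ, hτV⟩ := Metric.isOpen_iff.mp hV σ₀ hσ₀
  -- On `Σ` the differential of `ψ P` is `ψ dP + P dψ`. For the cut-off remainder to remain critical
  -- there, `P` itself must vanish on `Σ`, not only `dP`.
  have hP0 : ∀ σ ∈ ball σ₀ τ, P (0, σ) = 0 := by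
    intro σ hσ
    have hd : ∀ σ, HasFDerivAt (fun σ : SymplSpace (Fin k) => P (0, σ))
        ((fderiv ℝ P (0, σ)).comp (ContinuousLinearMap.inr ℝ _ _)) σ := fun σ =>
      HasFDerivAt.comp (g := P) σ (hPs.differentiable (by simp) (0, σ)).hasFDerivAt
        (hasFDerivAt_prodMk_right _ _)
    have := (convex_ball σ₀ τ).norm_image_sub_le_of_norm_fderiv_le (C := 0)
      (fun x _ => (hd x).differentiableAt) (fun x hx => by
        rw [(hd x).fderiv, hP1 x (hτV hx)]; simp) (mem_ball_self hτ) hσ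
    rw [zero_mul, norm_le_zero_iff, sub_eq_zero] at this
    rw [this]
    exact hP00
  -- `τ / 3` makes `2 η < τ`, so that the support stays over the ball contained in `V`; `1 / 2`
  -- makes `‖ρ.1‖ ≤ 1` on the support.
  obtain ⟨η, ψ, hη, hητ, hψ, hψ1, hψs, hψ2⟩ :=
    exists_cutoff_small hPs hjet hδ0 (r := min (τ / 3) (1 / 2)) (by positivity)
  have hη1 : 2 * η < τ := by have := hητ.trans (min_le_left _ _); linarith
  have hη2 : 2 * η ≤ 1 := by have := hητ.trans (min_le_right _ _); linarith
  set κ : PhaseSpace ℓ m k → ℝ := fun ρ => ψ ρ * P ρ with hκ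
  have hκs : ContDiff ℝ ∞ κ := hψ.mul hPs
  have hts : tsupport κ ⊆ closedBall ρ₀ (2 * η) := tsupport_mul_subset_left.trans hψs
  have hκc : HasCompactSupport κ :=
    HasCompactSupport.of_support_subset_isCompact (isCompact_closedBall ρ₀ (2 * η))
      ((subset_tsupport κ).trans hts)
  have hκ0 : ∀ σ, fderiv ℝ κ (0, σ) = 0 := by
    intro σ
    by_cases hσ : (0, σ) ∈ tsupport κ
    · have h1 : σ ∈ ball σ₀ τ := by
        have h2 := hts hσ
        rw [mem_closedBall, dist_eq_norm] at h2
        rw [mem_ball, dist_eq_norm]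
        exact ((norm_snd_le _).trans h2).trans_lt hη1
      rw [hκ, fderiv_fun_mul (hψ.differentiable (by simp) _) (hPs.differentiable (by simp) _),
        hP0 σ h1, hP1 σ (hτV h1)]
      simp
    · by_contra h
      exact hσ (support_fderiv_subset ℝ h)
  have hκ2 : ∀ ρ, ‖fderiv ℝ (fderiv ℝ κ) ρ‖ ≤ δ := fun ρ => by
    rw [← norm_iteratedFDeriv_zero (𝕜 := ℝ), norm_iteratedFDeriv_fderiv,
      norm_iteratedFDeriv_fderiv]
    exact hψ2 ρ
  obtain ⟨K, hK, hpert⟩ := exists_isPerturbedLinear (q := fun ρ => Q ρ + κ ρ)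
    (L := linearField (a σ₀) (c σ₀) (d σ₀)) hκs hκc hκ0 hδ0.le hδ1 hκ2
    (fun ρ hρ => by
      have h2 := hts hρ
      rw [mem_closedBall, dist_eq_norm] at h2
      have h3 := (norm_fst_le _).trans h2
      simp only [hρ₀, Prod.fst_sub, sub_zero] at h3
      exact h3.trans hη2)
    (fun ρ => by
      have hadd : fderiv ℝ (fun ρ => Q ρ + κ ρ) ρ = H (ρ - ρ₀) + fderiv ℝ κ ρ :=
        ((hQd ρ).add (hκs.differentiable (by simp) ρ).hasFDerivAt).fderiv
      rw [hamiltonField_eq, hadd, map_add, hH, hp.hamiltonMap_hessian hσ₀]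
      simp [hρ₀])
  refine ⟨η, K, _, _, _, hη, hK, hQs.add hκs, fun ρ h1 h2 => ?_, hpert⟩
  have : ψ ρ = 1 := hψ1 ρ (by
    rw [mem_closedBall, dist_eq_norm]
    refine max_le ?_ h2
    simpa [hρ₀] using h1)
  simp [hκ, hP, this]

/-- Near a point of the center manifold, the adapted norms are given by smooth families of forms on
the whole phase space. -/
theorem IsHyperbolicAlong.exists_isFormFamily {V : Set (SymplSpace (Fin k))} (hV : IsOpen V)
    {a : SymplSpace (Fin k) → Fin ℓ → ℝ} {c d : SymplSpace (Fin k) → Fin m → ℝ}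
    {p : PhaseSpace ℓ m k → ℝ} (hp : IsHyperbolicAlong V a c d p) {σ₀ : SymplSpace (Fin k)}
    (hσ₀ : σ₀ ∈ V) {θ : ℝ} (hθ0 : 0 < θ) (hθ1 : θ ≤ 1) :
    ∃ (η M : ℝ) (P Q : SymplSpace (Fin k) →
        SymplSpace (HypIndex ℓ m) →L[ℝ] SymplSpace (HypIndex ℓ m) →L[ℝ] ℝ),
      0 < η ∧ ball σ₀ η ⊆ V ∧ IsFormFamily (posForm (a σ₀) (c σ₀)) P θ M ∧
      IsFormFamily (momForm (a σ₀) (c σ₀)) Q θ M ∧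
      ∀ σ ∈ ball σ₀ η, P σ = posForm (a σ) (c σ) ∧ Q σ = momForm (a σ) (c σ) := by
  have hp2 : ContDiff ℝ ∞ (fderiv ℝ (fderiv ℝ p)) :=
    (hp.smooth.fderiv_right (m := ∞) (by simp)).fderiv_right (by simp)
  have hrate : ∀ i, ContDiffOn ℝ ∞ (fun σ => (2 * expansionRate (a σ) (c σ) i)⁻¹) V := by
    intro i
    have h1 : ContDiff ℝ ∞ fun σ : SymplSpace (Fin k) =>
        fderiv ℝ (fderiv ℝ p) (0, σ) ((Pi.single i 1, 0), 0) ((0, Pi.single i 1), 0) :=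
      ((hp2.comp (contDiff_prodMk_right _)).clm_apply contDiff_const).clm_apply contDiff_const
    -- Smoothness of the rates in `σ` is not assumed: they are diagonal entries of the Hessian of
    -- the smooth function `p` on `Σ`.
    have h2 : ContDiffOn ℝ ∞ (fun σ => expansionRate (a σ) (c σ) i) V := by
      refine h1.contDiffOn.congr fun σ hσ => ?_
      rw [hp.hessian σ hσ, ← normalMatrix_apply_self (a σ) (c σ) (d σ) i]
      simp
    refine (contDiffOn_const.mul h2).inv fun σ hσ => ?_
    have := expansionRate_pos (hp.a_pos σ hσ) (hp.c_pos σ hσ) i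
    positivity
  have hform : ∀ f : HypIndex ℓ m → SymplSpace (HypIndex ℓ m) →L[ℝ] ℝ,
      ContDiffOn ℝ ∞ (fun σ => diagForm f fun i => (2 * expansionRate (a σ) (c σ) i)⁻¹) V :=
    fun f => ContDiffOn.sum fun i _ => (hrate i).smul contDiffOn_const
  obtain ⟨η₁, M₁, P, h1, h2, h3, h4, h5, h6, h7⟩ :=
    exists_contDiff_extension hV (hform (posCoord _)) hσ₀ hθ0
  obtain ⟨η₂, M₂, Q, k1, -, k3, k4, k5, k6, k7⟩ :=
    exists_contDiff_extension hV (hform (momCoord _)) hσ₀ hθ0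
  refine ⟨min η₁ η₂, max M₁ M₂, P, Q, by positivity,
    (ball_subset_ball (min_le_left _ _)).trans h2,
    ⟨h3, hθ1, h5, fun σ => (h6 σ).trans (le_max_left _ _), fun σ => (h7 σ).trans (le_max_left _ _)⟩,
    ⟨k3, hθ1, k5, fun σ => (k6 σ).trans (le_max_right _ _),
      fun σ => (k7 σ).trans (le_max_right _ _)⟩,
    fun σ hσ => ⟨h4 σ (ball_subset_ball (min_le_left _ _) hσ),
      k4 σ (ball_subset_ball (min_le_right _ _) hσ)⟩⟩

end Model

/-! ### Flat functions localized to a cone -/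

section ConeIntegrand

open Set Metric MeasureTheory

variable {W S : Type} [NormedAddCommGroup W] [NormedSpace ℝ W] [NormedAddCommGroup S]
  [NormedSpace ℝ S]

/-- A flat function localized to a cone is a decaying integrand if the trajectories which end in the
cone decay exponentially. -/
theorem isDecayingIntegrand_of_cone [FiniteDimensional ℝ W] [FiniteDimensional ℝ S]
    {F : W × S → W × S} {φ : ℝ → W × S → W × S} {U : Set (W × S)} {χ : W → ℝ} {g : W × S → ℝ}
    {D c : ℝ} (hD : 0 ≤ D) (hc : 0 < c) (hF : ContDiff ℝ ∞ F) (hφ : IsFlow F φ) (hU : IsOpen U)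
    (hUb : Bornology.IsBounded U) (hU1 : ∀ y ∈ U, ‖y.1‖ ≤ 1)
    (hcross : ∀ y, {t : ℝ | φ t y ∈ U}.OrdConnected) (hχ : ContDiffOn ℝ ∞ χ {0}ᶜ)
    (hh : ∀ t : ℝ, 0 < t → ∀ v, v ≠ 0 → χ (t • v) = χ v) (hg : ContDiff ℝ ∞ g)
    (hgU : tsupport g ⊆ U) (h0 : ∀ σ (j : ℕ), iteratedFDeriv ℝ j g (0, σ) = 0)
    (hdecay : ∀ y t, 0 ≤ t → (∀ s ∈ Icc 0 t, φ s y ∈ U) → (φ t y).1 ≠ 0 →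
      (φ t y).1 ∈ tsupport χ → ‖(φ t y).1‖ ^ 2 ≤ D * Real.exp (-c * t) * ‖y.1‖ ^ 2) :
    IsDecayingIntegrand F φ (fun ρ => χ ρ.1 * g ρ) U (fun ρ => ‖ρ.1‖) (c / 2) (Real.sqrt D) := by
  have : ProperSpace (W × S) := FiniteDimensional.proper_real _
  have hgc : HasCompactSupport g :=
    isCompact_of_isClosed_isBounded (isClosed_tsupport g) (hUb.subset hgU)
  obtain ⟨hsm, hflat⟩ := contDiff_homogeneous_mul hχ hh hg hgc h0
  have hsuppg : tsupport (fun ρ : W × S => χ ρ.1 * g ρ) ⊆ tsupport g := tsupport_mul_subset_right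
  have hsuppχ : tsupport (fun ρ : W × S => χ ρ.1 * g ρ) ⊆ Prod.fst ⁻¹' tsupport χ :=
    tsupport_mul_subset_left.trans (closure_minimal (fun ρ hρ => subset_closure hρ)
      ((isClosed_tsupport χ).preimage continuous_fst))
  have hmem : ∀ y ∈ U, ∀ t, 0 ≤ t → φ t y ∈ tsupport (fun ρ : W × S => χ ρ.1 * g ρ) →
      ∀ s ∈ Icc 0 t, φ s y ∈ U := fun y hy t _ h s hs =>
    (hcross y).out (x := 0) (y := t) (by simpa [hφ.zero] using hy) (hgU (hsuppg h)) hs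
  refine ⟨hF, hφ, hsm, hU, hUb, by positivity, Real.sqrt_nonneg _, fun y => norm_nonneg _, hU1, hmem,
    fun y hy t ht h => ?_, fun j N => ?_⟩
  -- The case `w = 0` is trivial. Otherwise the bound on squares gives, by square roots, the rate `c
  -- / 2` and the constant `√D`.
  · by_cases hw : (φ t y).1 = 0
    · simp only [hw, norm_zero]
      positivity
    · have h1 := hdecay y t ht (hmem y hy t ht h) hw (hsuppχ h)
      refine (sq_le_sq₀ (norm_nonneg _) (by positivity)).mp (h1.trans (le_of_eq ?_))
      rw [mul_pow, mul_pow, Real.sq_sqrt hD, ← Real.exp_nat_mul]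
      congr 3
      push_cast
      ring
  · obtain ⟨B, hB⟩ := hflat j N
    exact ⟨B, fun y _ => hB y⟩

end ConeIntegrand

/-! ### Choice of the constants -/

section LocalModel

set_option maxSynthPendingDepth 3

open Set Metric Filter
open scoped Topology

variable {ℓ m k : ℕ}

/-- The Hamiltonian `q`, the forms `P σ`, `Q σ` and the constants describe the situation at distance
`η` from the point `σ₀` of the center manifold. -/
structure IsLocalModel (V : Set (SymplSpace (Fin k))) (a : SymplSpace (Fin k) → Fin ℓ → ℝ)
    (c d : SymplSpace (Fin k) → Fin m → ℝ) (p : PhaseSpace ℓ m k → ℝ) (σ₀ : SymplSpace (Fin k))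
    (q : PhaseSpace ℓ m k → ℝ) (R : PhaseSpace ℓ m k → SymplSpace (HypIndex ℓ m))
    (T : PhaseSpace ℓ m k → SymplSpace (Fin k))
    (P Q : SymplSpace (Fin k) →
      SymplSpace (HypIndex ℓ m) →L[ℝ] SymplSpace (HypIndex ℓ m) →L[ℝ] ℝ)
    (A c₀ θ M δ K η : ℝ) : Prop where
  hyperbolic : IsHyperbolicAlong V a c d p
  one_le : 1 ≤ A
  norm_posForm : ‖posForm (a σ₀) (c σ₀)‖ ≤ A
  norm_momForm : ‖momForm (a σ₀) (c σ₀)‖ ≤ A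
  coercive : ∀ w, ‖w‖ ^ 2 ≤ A * (posForm (a σ₀) (c σ₀) w w + momForm (a σ₀) (c σ₀) w w)
  posForm_le : ∀ w, posForm (a σ₀) (c σ₀) w w ≤ A * (w.1 ⬝ᵥ w.1)
  momForm_le : ∀ w, momForm (a σ₀) (c σ₀) w w ≤ A * (w.2 ⬝ᵥ w.2)
  convex : ∀ w, c₀ * ‖w‖ ^ 2 ≤
    (posForm (a σ₀) (c σ₀) + momForm (a σ₀) (c σ₀))
      (linearField (a σ₀) (c σ₀) (d σ₀) (linearField (a σ₀) (c σ₀) (d σ₀) w)) w +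
    2 * (posForm (a σ₀) (c σ₀) + momForm (a σ₀) (c σ₀)) (linearField (a σ₀) (c σ₀) (d σ₀) w)
      (linearField (a σ₀) (c σ₀) (d σ₀) w) +
    (posForm (a σ₀) (c σ₀) + momForm (a σ₀) (c σ₀)) w
      (linearField (a σ₀) (c σ₀) (d σ₀) (linearField (a σ₀) (c σ₀) (d σ₀) w))
  smooth : ContDiff ℝ ∞ q
  perturbed : IsPerturbedLinear (linearField (a σ₀) (c σ₀) (d σ₀)) R T (hamiltonField q) δ K
  pos : IsFormFamily (posForm (a σ₀) (c σ₀)) P θ M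
  mom : IsFormFamily (momForm (a σ₀) (c σ₀)) Q θ M
  theta_small : 20 * A * θ ≤ 1
  decay_small : (2 * (‖linearField (a σ₀) (c σ₀) (d σ₀)‖ + 1) * θ + (2 * A + M) * δ) *
    (40 * A ^ 2) ≤ 1
  convex_small : 4 * (‖linearField (a σ₀) (c σ₀) (d σ₀)‖ + 1) ^ 2 * (2 * θ) +
    (8 * ‖posForm (a σ₀) (c σ₀) + momForm (a σ₀) (c σ₀)‖ + 6 * (2 * M)) *
      (‖linearField (a σ₀) (c σ₀) (d σ₀)‖ + 1) * δ + η * (1 + K) ≤ c₀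
  eta_pos : 0 < η
  eta_small : 2 * A * η ≤ 1
  ball_subset : ball σ₀ η ⊆ V
  pos_eq : ∀ σ ∈ ball σ₀ η, P σ = posForm (a σ) (c σ)
  mom_eq : ∀ σ ∈ ball σ₀ η, Q σ = momForm (a σ) (c σ)
  eq_of_mem : ∀ ρ : PhaseSpace ℓ m k, ‖ρ.1‖ ^ 2 ≤ 2 * A * η → ρ.2 ∈ ball σ₀ η → q ρ = p ρ

theorem eventually_mul_le (x : ℝ) {u : ℝ} (hu : 0 < u) : ∀ᶠ t in 𝓝[>] (0 : ℝ), x * t ≤ u := by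
  have h : Tendsto (fun t : ℝ => x * t) (𝓝[>] 0) (𝓝 (x * 0)) :=
    ((continuous_const_mul x).tendsto 0).mono_left nhdsWithin_le_nhds
  rw [mul_zero] at h
  exact (h.eventually (gt_mem_nhds hu)).mono fun t ht => ht.le

/-- The constants are chosen in the order of their dependence: `A`, `c₀` come from the linear part
at `σ₀`; `θ` is fixed next and determines `M`; then `δ`, which determines `K`; and `η` last. The
convexity condition is split into three terms of size `c₀ / 3`, the decay condition into two halves.
-/
theorem IsHyperbolicAlong.exists_isLocalModel {V : Set (SymplSpace (Fin k))} (hV : IsOpen V)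
    {a : SymplSpace (Fin k) → Fin ℓ → ℝ} {c d : SymplSpace (Fin k) → Fin m → ℝ}
    {p : PhaseSpace ℓ m k → ℝ} (hp : IsHyperbolicAlong V a c d p) {σ₀ : SymplSpace (Fin k)}
    (hσ₀ : σ₀ ∈ V) :
    ∃ q R T P Q A c₀ θ M δ K η, IsLocalModel V a c d p σ₀ q R T P Q A c₀ θ M δ K η := by
  obtain ⟨A, c₀, hA, hc₀, hpA, hqA, hco, hpe, hqe, hconv⟩ :=
    exists_coercivity (d σ₀) (hp.a_pos σ₀ hσ₀) (hp.c_pos σ₀ hσ₀)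
  set L := linearField (a σ₀) (c σ₀) (d σ₀) with hL
  set b₀ := posForm (a σ₀) (c σ₀) + momForm (a σ₀) (c σ₀) with hb₀
  have hA0 : 0 < A := by linarith
  have h3 : 0 < c₀ / 3 := by positivity
  obtain ⟨θ, ⟨⟨⟨hθ1, hθ2⟩, hθ3⟩, hθ4⟩, hθ0⟩ := ((((eventually_mul_le (4 * (‖L‖ + 1) ^ 2 * 2) h3).and
    (eventually_mul_le (20 * A) one_pos)).and (eventually_mul_le 1 one_pos)).and
    (eventually_mul_le (2 * (‖L‖ + 1) * (40 * A ^ 2)) one_half_pos)).and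
    self_mem_nhdsWithin |>.exists
  rw [one_mul] at hθ3
  obtain ⟨η₁, M, P, Q, hη₁, hball, hP, hQ, hPQ⟩ := hp.exists_isFormFamily hV hσ₀ hθ0 hθ3
  obtain ⟨δ, ⟨⟨hδ1, hδ2⟩, hδ3⟩, hδ0⟩ := (((eventually_mul_le
    ((8 * ‖b₀‖ + 6 * (2 * M)) * (‖L‖ + 1)) h3).and (eventually_mul_le 1 one_pos)).and
    (eventually_mul_le ((2 * A + M) * (40 * A ^ 2)) one_half_pos)).and self_mem_nhdsWithin |>.exists
  rw [one_mul] at hδ2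
  obtain ⟨η₂, K, q, R, T, hη₂, hK, hq, hqp, hpert⟩ := hp.exists_model hV hσ₀ hδ0 hδ2
  obtain ⟨η, ⟨⟨⟨⟨hη1, hη2⟩, hη3⟩, hη4⟩, hη5⟩, hη0⟩ := (((((eventually_mul_le (1 + K) h3).and
    (eventually_mul_le (2 * A) one_pos)).and (eventually_mul_le 1 hη₁)).and
    (eventually_mul_le 1 hη₂)).and (eventually_mul_le (2 * A) (pow_pos hη₂ 2))).and
    self_mem_nhdsWithin |>.exists
  rw [one_mul] at hη3 hη4
  have hsub : ball σ₀ η ⊆ ball σ₀ η₁ := ball_subset_ball hη3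
  refine ⟨q, R, T, P, Q, A, c₀, θ, M, δ, K, η, hp, hA, hpA, hqA, hco, hpe, hqe, hconv, hq, hpert,
    hP, hQ, hθ2, ?_, ?_, hη0, hη2, hsub.trans hball, fun σ hσ => (hPQ σ (hsub hσ)).1,
    fun σ hσ => (hPQ σ (hsub hσ)).2, fun ρ h1 h2 => hqp ρ ?_ ?_⟩
  · rw [← hL]; linarith
  · rw [← hL, ← hb₀]; linarith
  · exact (sq_le_sq₀ (norm_nonneg _) hη₂.le).mp (h1.trans hη5)
  · rw [mem_ball, dist_eq_norm] at h2
    exact h2.le.trans hη4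

end LocalModel

/-! ### The region and the existence of a modification -/

section Region

set_option maxSynthPendingDepth 3

open Set Metric Filter
open scoped Topology

variable {ℓ m k : ℕ} {V : Set (SymplSpace (Fin k))} {a : SymplSpace (Fin k) → Fin ℓ → ℝ}
  {c d : SymplSpace (Fin k) → Fin m → ℝ} {p : PhaseSpace ℓ m k → ℝ} {σ₀ : SymplSpace (Fin k)}
  {q : PhaseSpace ℓ m k → ℝ} {R : PhaseSpace ℓ m k → SymplSpace (HypIndex ℓ m)}
  {T : PhaseSpace ℓ m k → SymplSpace (Fin k)}
  {P Q : SymplSpace (Fin k) →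
    SymplSpace (HypIndex ℓ m) →L[ℝ] SymplSpace (HypIndex ℓ m) →L[ℝ] ℝ}
  {A c₀ θ M δ K η : ℝ} {r : SymplSpace (Fin k) → ℝ}

theorem IsSmallRadius.mem_ball (hr : IsSmallRadius σ₀ η r) {σ : SymplSpace (Fin k)}
    (hσ : 0 < r σ) : σ ∈ ball σ₀ η :=
  hr.support (subset_tsupport r hσ.ne')

theorem adaptedNormSq_nonneg {a : Fin ℓ → ℝ} {c : Fin m → ℝ} (ha : ∀ j, 0 < a j)
    (hc : ∀ j, 0 < c j) (x : HypIndex ℓ m → ℝ) : 0 ≤ adaptedNormSq a c x := by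
  rw [adaptedNormSq_eq]
  refine Finset.sum_nonneg fun i _ => ?_
  have := expansionRate_pos ha hc i
  have := mul_self_nonneg (x i)
  positivity

namespace IsLocalModel

variable (h : IsLocalModel V a c d p σ₀ q R T P Q A c₀ θ M δ K η)

include h

theorem sq_norm_le (σ : SymplSpace (Fin k)) (w : SymplSpace (HypIndex ℓ m)) :
    ‖w‖ ^ 2 ≤ 2 * A * (P σ w w + Q σ w w) := by
  have h1 := (abs_le.mp (h.pos.abs_sub_le σ w)).1
  have h2 := (abs_le.mp (h.mom.abs_sub_le σ w)).1
  have h3 := h.coercive w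
  have hA : 0 ≤ A := zero_le_one.trans h.one_le
  have h4 := mul_le_mul_of_nonneg_right h.theta_small (sq_nonneg ‖w‖)
  nlinarith [sq_nonneg ‖w‖]

theorem mem_region_iff (hr : IsSmallRadius σ₀ η r) (ρ : PhaseSpace ℓ m k) :
    ρ ∈ region V a c r ↔ P ρ.2 ρ.1 ρ.1 + Q ρ.2 ρ.1 ρ.1 < r ρ.2 := by
  have key : ρ.2 ∈ ball σ₀ η → P ρ.2 ρ.1 ρ.1 + Q ρ.2 ρ.1 ρ.1 =
      adaptedNormSq (a ρ.2) (c ρ.2) ρ.1.1 + adaptedNormSq (a ρ.2) (c ρ.2) ρ.1.2 := fun hσ => by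
    rw [h.pos_eq _ hσ, h.mom_eq _ hσ, posForm_apply, momForm_apply]
    rfl
  constructor
  · rintro ⟨hV, hlt⟩
    have h1 := adaptedNormSq_nonneg (h.hyperbolic.a_pos _ hV) (h.hyperbolic.c_pos _ hV) ρ.1.1
    have h2 := adaptedNormSq_nonneg (h.hyperbolic.a_pos _ hV) (h.hyperbolic.c_pos _ hV) ρ.1.2
    rwa [key (hr.mem_ball (by linarith))]
  · intro hlt
    have h1 := h.sq_norm_le ρ.2 ρ.1
    have h2 : 0 ≤ P ρ.2 ρ.1 ρ.1 + Q ρ.2 ρ.1 ρ.1 :=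
      nonneg_of_mul_nonneg_right ((sq_nonneg _).trans h1) (by linarith [h.one_le])
    have hσ := hr.mem_ball (h2.trans_lt hlt)
    exact ⟨h.ball_subset hσ, by rwa [← key hσ]⟩

theorem radius_pos (hr : IsSmallRadius σ₀ η r) {ρ : PhaseSpace ℓ m k}
    (hρ : ρ ∈ region V a c r) : 0 < r ρ.2 := by
  refine lt_of_le_of_lt ?_ ((h.mem_region_iff hr ρ).mp hρ)
  exact nonneg_of_mul_nonneg_right ((sq_nonneg _).trans (h.sq_norm_le ρ.2 ρ.1))
    (by linarith [h.one_le])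

theorem sq_norm_le_of_mem_region (hr : IsSmallRadius σ₀ η r) {ρ : PhaseSpace ℓ m k}
    (hρ : ρ ∈ region V a c r) : ‖ρ.1‖ ^ 2 ≤ 2 * A * η := by
  have hA : 0 ≤ A := zero_le_one.trans h.one_le
  refine (h.sq_norm_le ρ.2 ρ.1).trans ?_
  have := ((h.mem_region_iff hr ρ).mp hρ).le.trans (hr.small ρ.2)
  gcongr

theorem norm_le_one_of_mem_region (hr : IsSmallRadius σ₀ η r) {ρ : PhaseSpace ℓ m k}
    (hρ : ρ ∈ region V a c r) : ‖ρ.1‖ ≤ 1 := by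
  have := (h.sq_norm_le_of_mem_region hr hρ).trans h.eta_small
  exact (sq_le_one_iff₀ (norm_nonneg _)).mp this

theorem isOpen_region (hr : IsSmallRadius σ₀ η r) :
    IsOpen (region V a c r : Set (PhaseSpace ℓ m k)) := by
  have heq : (region V a c r : Set (PhaseSpace ℓ m k)) =
      {ρ | P ρ.2 ρ.1 ρ.1 + Q ρ.2 ρ.1 ρ.1 < r ρ.2} := Set.ext fun ρ => h.mem_region_iff hr ρ
  rw [heq]
  have hP := h.pos.contDiff.continuous
  have hQ := h.mom.contDiff.continuous
  have hrc := hr.smooth.continuous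
  exact isOpen_lt
    ((((hP.comp continuous_snd).clm_apply continuous_fst).clm_apply continuous_fst).add
      (((hQ.comp continuous_snd).clm_apply continuous_fst).clm_apply continuous_fst))
    (hrc.comp continuous_snd)

theorem isBounded_region (hr : IsSmallRadius σ₀ η r) :
    Bornology.IsBounded (region V a c r : Set (PhaseSpace ℓ m k)) := by
  refine (isBounded_closedBall.prod isBounded_ball :
    Bornology.IsBounded (closedBall (0 : SymplSpace (HypIndex ℓ m)) 1 ×ˢ ball σ₀ η)).subset ?_
  exact fun ρ hρ => ⟨by simpa using h.norm_le_one_of_mem_region hr hρ,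
    hr.mem_ball (h.radius_pos hr hρ)⟩

theorem eqOn_region (hr : IsSmallRadius σ₀ η r) : EqOn q p (region V a c r) := fun ρ hρ =>
  h.eq_of_mem ρ (h.sq_norm_le_of_mem_region hr hρ) (hr.mem_ball (h.radius_pos hr hρ))

theorem hamiltonField_eqOn (hr : IsSmallRadius σ₀ η r) {q₁ q₂ : PhaseSpace ℓ m k → ℝ}
    (hq : EqOn q₁ q₂ (region V a c r)) :
    EqOn (hamiltonField q₁) (hamiltonField q₂) (region V a c r) := fun ρ hρ => by
  rw [hamiltonField_eq, hamiltonField_eq,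
    (hq.eventuallyEq_of_mem ((h.isOpen_region hr).mem_nhds hρ)).fderiv_eq]

theorem exists_isModification (hr : IsSmallRadius σ₀ η r) :
    ∃ φ, IsModification (region V a c r) p q φ := by
  set L := linearField (a σ₀) (c σ₀) (d σ₀) with hL
  have hF := contDiff_hamiltonField h.smooth
  have hgrowth : ∀ ρ, ‖hamiltonField q ρ‖ ≤ (‖L‖ + 1) * (1 + ‖ρ‖) := by
    intro ρ
    have h0 := norm_nonneg L
    have h1 := norm_nonneg ρ.1
    have h2 : ‖ρ.1‖ ≤ ‖ρ‖ := norm_fst_le ρ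
    have h3 := h.perturbed.norm_R ρ
    have h4 := h.perturbed.norm_T ρ
    have h5 := mul_le_mul_of_nonneg_right h.perturbed.delta_le h1
    have h6 := L.le_opNorm ρ.1
    have h7 : ‖L‖ * ‖ρ.1‖ ≤ ‖L‖ * ‖ρ‖ := by gcongr
    rw [h.perturbed.eq]
    refine max_le ((norm_add_le _ _).trans ?_) (h4.trans ?_)
    · linarith
    · have := mul_nonneg h0 (norm_nonneg ρ)
      linarith
  obtain ⟨φ, hφ⟩ := exists_isFlow_of_linear_growth (hF.of_le (by exact_mod_cast le_top)) hgrowth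
  refine ⟨φ, h.smooth, h.eqOn_region hr, ⟨hφ.zero, hφ.hasDerivAt⟩, fun ρ => ?_⟩
  have hb : IsFormFamily (posForm (a σ₀) (c σ₀) + momForm (a σ₀) (c σ₀)) (fun σ => P σ + Q σ)
      (2 * θ) (2 * M) := by
    have hP := h.pos.contDiff.differentiable (by simp)
    have hQ := h.mom.contDiff.differentiable (by simp)
    have hP1 := (h.pos.contDiff.fderiv_right (m := ∞) (by simp)).differentiable (by simp)
    have hQ1 := (h.mom.contDiff.fderiv_right (m := ∞) (by simp)).differentiable (by simp)
    have hd : fderiv ℝ (fun σ => P σ + Q σ) = fun σ => fderiv ℝ P σ + fderiv ℝ Q σ :=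
      funext fun σ => fderiv_fun_add (hP σ) (hQ σ)
    refine ⟨h.pos.contDiff.add h.mom.contDiff, ?_, fun σ => ?_, fun σ => ?_, fun σ => ?_⟩
    · have h1 : 0 ≤ θ := (norm_nonneg _).trans (h.pos.norm_sub 0)
      have h2 := h.theta_small
      nlinarith [h.one_le]
    · rw [add_sub_add_comm, two_mul]
      exact (norm_add_le _ _).trans (add_le_add (h.pos.norm_sub σ) (h.mom.norm_sub σ))
    · rw [hd, two_mul]
      exact (norm_add_le _ _).trans (add_le_add (h.pos.norm_fderiv σ) (h.mom.norm_fderiv σ))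
    · rw [hd, fderiv_fun_add (hP1 σ) (hQ1 σ), two_mul]
      refine (norm_add_le (fderiv ℝ (fderiv ℝ P) σ) (fderiv ℝ (fderiv ℝ Q) σ)).trans ?_
      exact add_le_add (h.pos.norm_fderiv_two σ) (h.mom.norm_fderiv_two σ)
  have hconv := h.perturbed.convexOn hb h.convex hr.smooth h.eta_pos.le hr.small_fderiv
    hr.small_fderiv_two h.convex_small (hφ.hasDerivAt ρ)
  have heq : {t : ℝ | φ t ρ ∈ region V a c r} = {t ∈ univ |
      (P (φ t ρ).2 + Q (φ t ρ).2) (φ t ρ).1 (φ t ρ).1 - r (φ t ρ).2 < 0} := by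
    refine Set.ext fun t => ?_
    rw [mem_ofPred_eq, h.mem_region_iff hr, mem_ofPred_eq, sub_neg]
    exact (and_iff_right (mem_univ t)).symm
  rw [heq]
  exact (hconv.convex_lt 0).ordConnected

end IsLocalModel

end Region

section HomologicalEquation

set_option maxSynthPendingDepth 3

open Set Metric Filter MeasureTheory
open scoped Topology

variable {ℓ m k : ℕ} {V : Set (SymplSpace (Fin k))} {a : SymplSpace (Fin k) → Fin ℓ → ℝ}
  {c d : SymplSpace (Fin k) → Fin m → ℝ} {p : PhaseSpace ℓ m k → ℝ} {σ₀ : SymplSpace (Fin k)}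
  {q : PhaseSpace ℓ m k → ℝ} {R : PhaseSpace ℓ m k → SymplSpace (HypIndex ℓ m)}
  {T : PhaseSpace ℓ m k → SymplSpace (Fin k)}
  {P Q : SymplSpace (Fin k) →
    SymplSpace (HypIndex ℓ m) →L[ℝ] SymplSpace (HypIndex ℓ m) →L[ℝ] ℝ}
  {A c₀ θ M δ K η : ℝ} {r : SymplSpace (Fin k) → ℝ}

theorem IsHamiltonFlow.isFlow {φ : ℝ → PhaseSpace ℓ m k → PhaseSpace ℓ m k}
    (hφ : IsHamiltonFlow q φ) : IsFlow (hamiltonField q) φ :=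
  ⟨hφ.zero, hφ.hasDerivAt⟩

theorem IsFlatOn.iteratedFDeriv_eq_zero {g : PhaseSpace ℓ m k → ℝ} (hg : IsFlatOn V g)
    (hgV : tsupport g ⊆ region V a c r) (σ : SymplSpace (Fin k)) (j : ℕ) :
    iteratedFDeriv ℝ j g (0, σ) = 0 := by
  by_contra h0
  have h1 : (0, σ) ∈ tsupport g := support_iteratedFDeriv_subset j h0
  exact h0 (hg σ (hgV h1).1 j)

theorem homologicalSolution_eq (φ : ℝ → PhaseSpace ℓ m k → PhaseSpace ℓ m k)
    (χout χin : SymplSpace (HypIndex ℓ m) → ℝ) (g : PhaseSpace ℓ m k → ℝ) :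
    homologicalSolution φ χout χin g = fun ρ =>
      flowIntegral (fun t => φ (-t)) (fun ρ => χout ρ.1 * g ρ) 0 ρ -
        flowIntegral φ (fun ρ => χin ρ.1 * g ρ) 0 ρ := by
  funext ρ
  have h1 := integral_comp_neg_Ioi (0 : ℝ) fun t => χout (φ t ρ).1 * g (φ t ρ)
  rw [neg_zero] at h1
  simp only [homologicalSolution, flowIntegral, zero_mul, Real.exp_zero, one_mul, ← sub_eq_add_neg]
  rw [← h1, ← integral_Ici_eq_integral_Ioi]

namespace IsLocalModel

variable (h : IsLocalModel V a c d p σ₀ q R T P Q A c₀ θ M δ K η)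

include h

theorem isDecayingIntegrand_in (hr : IsSmallRadius σ₀ η r) {q' : PhaseSpace ℓ m k → ℝ}
    {φ : ℝ → PhaseSpace ℓ m k → PhaseSpace ℓ m k}
    (hq' : IsModification (region V a c r) p q' φ) {χout χin : SymplSpace (HypIndex ℓ m) → ℝ}
    (hχ : IsConePartition {σ | 0 < r σ} a c χout χin) {g : PhaseSpace ℓ m k → ℝ}
    (hg : ContDiff ℝ ∞ g) (hflat : IsFlatOn V g) (hsupp : tsupport g ⊆ region V a c r) :
    ∃ C D, IsDecayingIntegrand (hamiltonField q') φ (fun ρ => χin ρ.1 * g ρ) (region V a c r)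
      (fun ρ => ‖ρ.1‖) C D := by
  have hA0 : 0 < A := zero_lt_one.trans_le h.one_le
  have hfield := h.hamiltonField_eqOn hr (fun ρ hρ => (hq'.eqOn hρ).trans (h.eqOn_region hr hρ).symm)
  refine ⟨_, _, isDecayingIntegrand_of_cone (D := 10 * A * (A + 1))
    (c := (40 * A ^ 2 * (A + 1))⁻¹) (by positivity) (by positivity)
    (contDiff_hamiltonField hq'.smooth) hq'.flow.isFlow (h.isOpen_region hr)
    (h.isBounded_region hr) (fun ρ hρ => h.norm_le_one_of_mem_region hr hρ) hq'.crossing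
    hχ.smooth_in hχ.homogeneous_in hg hsupp (hflat.iteratedFDeriv_eq_zero hsupp)
    fun y t ht hs hw hχw => ?_⟩
  have hr0 := h.radius_pos hr (hs t ⟨ht, le_rfl⟩)
  have hσ := hr.mem_ball hr0
  have hlin := posForm_linearField (d σ₀) (h.hyperbolic.a_pos σ₀ (h.ball_subset
    (mem_ball_self h.eta_pos))) (h.hyperbolic.c_pos σ₀ (h.ball_subset (mem_ball_self h.eta_pos)))
  have hlin' := momForm_linearField (d σ₀) (h.hyperbolic.a_pos σ₀ (h.ball_subset
    (mem_ball_self h.eta_pos))) (h.hyperbolic.c_pos σ₀ (h.ball_subset (mem_ball_self h.eta_pos)))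
  have key := h.perturbed.decay h.pos h.mom (γ := fun s => φ s y) (fun w => hlin w w)
    (fun w => hlin' w w) (fun w => (sq_nonneg _).trans (sq_norm_le_dotProduct _)) sq_norm_le_add_dotProduct h.one_le
    h.norm_posForm h.norm_momForm h.coercive h.momForm_le h.theta_small h.decay_small ht
    (fun s hs' => by
      rw [← hfield (hs s hs')]
      exact hq'.flow.hasDerivAt y s)
    (by
      rw [h.pos_eq _ hσ, h.mom_eq _ hσ, posForm_apply, momForm_apply]
      exact (hχ.support_in _ hχw hw _ hr0).le)
  simpa only [hq'.flow.zero] using key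

theorem isDecayingIntegrand_out (hr : IsSmallRadius σ₀ η r) {q' : PhaseSpace ℓ m k → ℝ}
    {φ : ℝ → PhaseSpace ℓ m k → PhaseSpace ℓ m k}
    (hq' : IsModification (region V a c r) p q' φ) {χout χin : SymplSpace (HypIndex ℓ m) → ℝ}
    (hχ : IsConePartition {σ | 0 < r σ} a c χout χin) {g : PhaseSpace ℓ m k → ℝ}
    (hg : ContDiff ℝ ∞ g) (hflat : IsFlatOn V g) (hsupp : tsupport g ⊆ region V a c r) :
    ∃ C D, IsDecayingIntegrand (fun ρ => -hamiltonField q' ρ) (fun t => φ (-t))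
      (fun ρ => χout ρ.1 * g ρ) (region V a c r) (fun ρ => ‖ρ.1‖) C D := by
  have hA0 : 0 < A := zero_lt_one.trans_le h.one_le
  have hfield := h.hamiltonField_eqOn hr (fun ρ hρ => (hq'.eqOn hρ).trans (h.eqOn_region hr hρ).symm)
  refine ⟨_, _, isDecayingIntegrand_of_cone (D := 10 * A * (A + 1))
    (c := (40 * A ^ 2 * (A + 1))⁻¹) (by positivity) (by positivity)
    (contDiff_hamiltonField hq'.smooth).neg hq'.flow.isFlow.reverse (h.isOpen_region hr)
    (h.isBounded_region hr) (fun ρ hρ => h.norm_le_one_of_mem_region hr hρ)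
    (fun y => ⟨fun s hs t ht u hu => (hq'.crossing y).out ht hs
      ⟨neg_le_neg hu.2, neg_le_neg hu.1⟩⟩)
    hχ.smooth_out hχ.homogeneous_out hg hsupp (hflat.iteratedFDeriv_eq_zero hsupp)
    fun y t ht hs hw hχw => ?_⟩
  have hr0 := h.radius_pos hr (hs t ⟨ht, le_rfl⟩)
  have hσ := hr.mem_ball hr0
  have hlin := posForm_linearField (d σ₀) (h.hyperbolic.a_pos σ₀ (h.ball_subset
    (mem_ball_self h.eta_pos))) (h.hyperbolic.c_pos σ₀ (h.ball_subset (mem_ball_self h.eta_pos)))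
  have hlin' := momForm_linearField (d σ₀) (h.hyperbolic.a_pos σ₀ (h.ball_subset
    (mem_ball_self h.eta_pos))) (h.hyperbolic.c_pos σ₀ (h.ball_subset (mem_ball_self h.eta_pos)))
  have key := h.perturbed.neg.decay h.mom h.pos (γ := fun s => φ (-s) y)
    (eP := fun w => w.2 ⬝ᵥ w.2) (eQ := fun w => w.1 ⬝ᵥ w.1)
    (fun w => by
      have := hlin' w w
      simp only [neg_apply, map_neg]
      linarith)
    (fun w => by
      have := hlin w w
      simp only [neg_apply, map_neg]
      linarith)
    (fun w => (sq_nonneg _).trans (sq_norm_le_dotProduct _))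
    (fun w => (sq_norm_le_add_dotProduct w).trans_eq (add_comm _ _)) h.one_le
    h.norm_momForm h.norm_posForm (fun w => by rw [add_comm]; exact h.coercive w) h.posForm_le
    h.theta_small (by rw [norm_neg]; exact h.decay_small) ht
    (fun s hs' => by
      rw [← hfield (hs s hs')]
      exact hq'.flow.isFlow.reverse.hasDerivAt y s)
    (by
      rw [h.pos_eq _ hσ, h.mom_eq _ hσ, posForm_apply, momForm_apply]
      exact (hχ.support_out _ hχw hw _ hr0).le)
  simpa only [neg_zero, hq'.flow.zero] using key

theorem homologicalEquation (hr : IsSmallRadius σ₀ η r) {q' : PhaseSpace ℓ m k → ℝ}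
    {φ : ℝ → PhaseSpace ℓ m k → PhaseSpace ℓ m k}
    (hq' : IsModification (region V a c r) p q' φ) {χout χin : SymplSpace (HypIndex ℓ m) → ℝ}
    (hχ : IsConePartition {σ | 0 < r σ} a c χout χin) {g : PhaseSpace ℓ m k → ℝ}
    (hg : ContDiff ℝ ∞ g) (hflat : IsFlatOn V g) (hsupp : tsupport g ⊆ region V a c r) :
    (∀ ρ ∈ region V a c r,
      IntegrableOn (fun t => χout (φ t ρ).1 * g (φ t ρ)) (Iic 0) ∧
      IntegrableOn (fun t => χin (φ t ρ).1 * g (φ t ρ)) (Ici 0)) ∧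
    ContDiffOn ℝ ∞ (homologicalSolution φ χout χin g) (region V a c r) ∧
    IsFlatOn {σ | 0 < r σ} (homologicalSolution φ χout χin g) ∧
    ∀ ρ ∈ region V a c r,
      fderiv ℝ (homologicalSolution φ χout χin g) ρ (hamiltonField p ρ) = g ρ := by
  obtain ⟨C₁, D₁, hout⟩ := h.isDecayingIntegrand_out hr hq' hχ hg hflat hsupp
  obtain ⟨C₂, D₂, hin⟩ := h.isDecayingIntegrand_in hr hq' hχ hg hflat hsupp
  have hopen := h.isOpen_region hr
  have hso := hout.contDiffOn_flowIntegral 0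
  have hsi := hin.contDiffOn_flowIntegral 0
  rw [homologicalSolution_eq]
  refine ⟨fun ρ hρ => ⟨?_, ?_⟩, hso.sub hsi, fun σ hσ j => ?_, fun ρ hρ => ?_⟩
  · have h1 := hout.integrableOn 0 hρ
    simp only [zero_mul, Real.exp_zero, one_mul] at h1
    rw [← neg_zero] at h1
    simpa using h1.comp_neg_Iic
  · have h1 := hin.integrableOn 0 hρ
    simpa only [zero_mul, Real.exp_zero, one_mul] using h1
  · have hρ : ((0, σ) : PhaseSpace ℓ m k) ∈ region V a c r := by
      rw [h.mem_region_iff hr]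
      simpa using hσ
    have h1 := iteratedFDeriv_sub_apply (i := j)
      ((hso.contDiffAt (hopen.mem_nhds hρ)).of_le (natCast_lt_infty j).le)
      ((hsi.contDiffAt (hopen.mem_nhds hρ)).of_le (natCast_lt_infty j).le)
    refine h1.trans ?_
    rw [hout.iteratedFDeriv_flowIntegral_eq_zero 0 j hρ (by simp),
      hin.iteratedFDeriv_flowIntegral_eq_zero 0 j hρ (by simp), sub_zero]
  · have hdo := (hso.contDiffAt (hopen.mem_nhds hρ)).differentiableAt (by simp)
    have hdi := (hsi.contDiffAt (hopen.mem_nhds hρ)).differentiableAt (by simp)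
    have h1 := hout.fderiv_flowIntegral_field hρ
    have h2 := hin.fderiv_flowIntegral_field hρ
    rw [map_neg, neg_inj] at h1
    rw [fderiv_fun_sub hdo hdi, sub_apply, ← h.hamiltonField_eqOn hr hq'.eqOn hρ, h1, h2,
      sub_neg_eq_add, ← add_mul]
    by_cases hw : ρ.1 = 0
    · have h3 := hflat.iteratedFDeriv_eq_zero hsupp ρ.2 0
      have h4 : g ρ = 0 := by
        rw [← norm_eq_zero, ← norm_iteratedFDeriv_zero (𝕜 := ℝ),
          show ρ = (0, ρ.2) from Prod.ext hw rfl, h3, norm_zero]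
      rw [h4, mul_zero]
    · rw [hχ.sum_eq_one _ hw, one_mul]

end IsLocalModel

end HomologicalEquation

theorem proposition1p2 (ℓ m k : ℕ) (V : Set (SymplSpace (Fin k))) (hV : IsOpen V)
    (a : SymplSpace (Fin k) → Fin ℓ → ℝ) (c d : SymplSpace (Fin k) → Fin m → ℝ)
    (p : PhaseSpace ℓ m k → ℝ) (hp : IsHyperbolicAlong V a c d p)
    (σ₀ : SymplSpace (Fin k)) (hσ₀ : σ₀ ∈ V) :
    ∃ ε : ℝ, 0 < ε ∧ ∀ r : SymplSpace (Fin k) → ℝ, IsSmallRadius σ₀ ε r →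
      (∃ (q : PhaseSpace ℓ m k → ℝ) (φ : ℝ → PhaseSpace ℓ m k → PhaseSpace ℓ m k),
        IsModification (region V a c r) p q φ) ∧
      ∀ (q : PhaseSpace ℓ m k → ℝ) (φ : ℝ → PhaseSpace ℓ m k → PhaseSpace ℓ m k),
        IsModification (region V a c r) p q φ →
        ∀ χout χin : SymplSpace (HypIndex ℓ m) → ℝ,
          IsConePartition {σ | 0 < r σ} a c χout χin →
        ∀ g : PhaseSpace ℓ m k → ℝ,
          ContDiff ℝ ∞ g → IsFlatOn V g → tsupport g ⊆ region V a c r →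
          (∀ ρ ∈ region V a c r,
            MeasureTheory.IntegrableOn (fun t => χout (φ t ρ).1 * g (φ t ρ)) (Set.Iic 0) ∧
            MeasureTheory.IntegrableOn (fun t => χin (φ t ρ).1 * g (φ t ρ)) (Set.Ici 0)) ∧
          ContDiffOn ℝ ∞ (homologicalSolution φ χout χin g) (region V a c r) ∧
          IsFlatOn {σ | 0 < r σ} (homologicalSolution φ χout χin g) ∧
          ∀ ρ ∈ region V a c r,
            fderiv ℝ (homologicalSolution φ χout χin g) ρ (hamiltonField p ρ) = g ρ := by
  obtain ⟨q₀, R, T, P, Q, A, c₀, θ, M, δ, K, η, h⟩ := hp.exists_isLocalModel hV hσ₀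
  exact ⟨η, h.eta_pos, fun r hr => ⟨⟨q₀, h.exists_isModification hr⟩,
    fun q φ hq χout χin hχ g hg hflat hsupp => h.homologicalEquation hr hq hχ hg hflat hsupp⟩⟩
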